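/- Let $N,k\ge 1$ be integers and let $\alpha_1,\dots,\alpha_N,\beta_1,\dots,\beta_N$ be complex parameters with $|\alpha_j|<1$ and $0<|\beta_j|<1$. Let $k_j=k(j-1)$, and let $l_1<l_2<\dots<l_N\le N-1$ be integers. **Model.** $N$ walkers start at heights $k_1,\dots,k_N$ on line $0$ and end at heights $l_1,\dots,l_N$ on line $2N$, making one vertical jump between consecutive lines. Step $n$ is an upward jump of size $m\ge 0$ with weight $\alpha_n^m$ for $1\le n\le N$, and a downward jump of size $m\ge0$ with weight $\beta_{2N-n+1}^m$ for $N+1\le n\le 2N$. The paths are required not to intersect. The weight of an ensemble of paths is the product of the weights of its jumps. Let $Z$ be the sum of the weights of all nonintersecting ensembles, and, if $Z\ne0$, let $\mathrm{Prob}((s_1,x_1),\dots,(s_n,x_n))$ be the sum of the weights of the nonintersecting ensembles that pass through height $x_r$ on line $s_r$ for every $r$, divided by $Z$. **Kernel.** Let $F_n(z)=(1-\alpha_n z)^{-1}$ for $1\le n\le N$ and $F_n(z)=(1-\beta_{2N-n+1}/z)^{-1}$ for $N+1\le n\le 2N$, let $G_{ij}=\frac1{2\pi i}\oint_{\partial\mathbb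 D}\prod_{n=1}^{2N}F_n(z)\,z^{k_i-l_j-1}dz$, and let $$K(s_1,x_1;s_2,x_2)=-\mathbb 1_{s_1>s_2}\frac1{2\pi i}\oint_{\partial\mathbb D}\prod_{n=s_2+1}^{s_1}F_n(z)\frac{dz}{z^{x_1-x_2+1}}+\sum_{i,j=1}^N (G^{-1})_{ji}\Big(\frac1{2\pi i}\oint_{\partial\mathbb D}z^{k_i}\prod_{n=1}^{s_1}F_n(z)\frac{dz}{z^{x_1+1}}\Big)\Big(\frac1{2\pi i}\oint_{\partial\mathbb D}\prod_{n=s_2+1}^{2N}F_n(z)\frac{z^{x_2}dz}{z^{l_j+1}}\Big)$$ be the (Eynard–Mehta) kernel of the process. **Theorem.** If all $\alpha_j$ are nonnegative and all $\beta_j$ are positive, then $Z>0$. In general, suppose $Z\neq 0$. Then there are contours $\Gamma_\beta$ (finite unions of closed curves) in the open unit disc $\mathbb D$ that avoid all zeros of the polynomials $w^k-\beta_j^k$, have winding number $1$ around each $\beta_j$, and have winding number $0$ around every other zero of each $w^k-\beta_j^k$. For every such $\Gamma_\beta$ the following hold. 1. For all integers $x_1,x_2\ge 0$ and $0\le s_1,s_2\le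 N$, $$K(s_1,x_1;s_2,x_2)=-\mathbb 1_{s_1>s_2}\frac{1}{2\pi i}\oint_{\partial\mathbb D}\prod_{j=s_2+1}^{s_1}(1-\alpha_jz)^{-1}\frac{dz}{z^{x_1-x_2+1}}+\frac{k}{(2\pi i)^2}\oint_{\partial\mathbb D}\oint_{\Gamma_\beta}\frac{\prod_{r=1}^{s_2}(1-\alpha_rw)\prod_{j=1}^N(z^k-\beta_j^k)}{\prod_{\ell=1}^{s_1}(1-\alpha_\ell z)\prod_{t=1}^N(w^k-\beta_t^k)}\,\frac{w^{x_2+k-1}\,dw\,dz}{z^{x_1+1}(z^k-w^k)}.$$ 2. The process on the lines $0,\dots,N$ is determinantal with the kernel on the right-hand side of 1: for pairwise distinct points $(s_r,x_r)$ with integers $0\le s_r\le N$ and $x_r\ge0$, $1\le r\le n$, $$\mathrm{Prob}((s_1,x_1),\dots,(s_n,x_n))=\det\big(K(s_r,x_r;s_q,x_q)\big)_{r,q=1}^n .$$ 3. If $\beta_1=\dots=\beta_N=\beta$, then for all integers $x_1,x_2\ge0$ and $0\le s_1,s_2\le N$, $$K(s_1,x_1;s_2,x_2)=-\mathbb 1_{s_1>s_2}\frac{1}{2\pi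 i}\oint_{\partial\mathbb D}\prod_{j=s_2+1}^{s_1}(1-\alpha_jz)^{-1}\frac{dz}{z^{x_1-x_2+1}}+\frac{k}{(2\pi i)^2}\oint_{\partial\mathbb D}\oint_{\Gamma_\beta}\frac{\prod_{r=1}^{s_2}(1-\alpha_rw)\,(z^k-\beta^k)^N}{\prod_{\ell=1}^{s_1}(1-\alpha_\ell z)\,(w^k-\beta^k)^N}\,\frac{w^{x_2+k-1}\,dw\,dz}{z^{x_1+1}(z^k-w^k)}.$$ -/

import Mathlib

open scoped ComplexOrder

noncomputable section

namespace NonintersectingWalks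

/-! ### The path model

There are `N` walkers and `2 * N` steps.  The parameters `α j`, `β j` are used for `1 ≤ j ≤ N`
only.  The lines are numbered `0, 1, …, 2 * N` (line `s` here is the vertical line `s - N` of the
original picture), walkers are numbered from `0`, and `x i s` is the height at which walker `i`
crosses line `s`. -/

/-- Nonintersecting path ensembles from heights `a` on line `0` to heights `l` on line `2 * N`.
Step `n + 1` consists of a vertical jump half way between line `n` and line `n + 1`: upwards for the
first `N` steps, downwards for the last `N` steps.  The vertical segments traced by two different
walkers in the same step are disjoint; since these contain the heights on the lines, the
horizontal pieces are then disjoint as well. -/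
structure IsPathEnsemble (N : ℕ) (a l : Fin N → ℤ) (x : Fin N → Fin (2 * N + 1) → ℤ) : Prop where
  start : ∀ i, x i 0 = a i
  finish : ∀ i, x i (Fin.last (2 * N)) = l i
  up : ∀ i (n : Fin (2 * N)), (n : ℕ) < N → x i n.castSucc ≤ x i n.succ
  down : ∀ i (n : Fin (2 * N)), N ≤ (n : ℕ) → x i n.succ ≤ x i n.castSucc
  disjoint : ∀ i j, i ≠ j → ∀ n : Fin (2 * N),
    Disjoint (Set.uIcc (x i n.castSucc) (x i n.succ)) (Set.uIcc (x j n.castSucc) (x j n.succ))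

/-- The parameter of the `n`-th step, `1 ≤ n ≤ 2 * N`: `α n` on the left, `β (2N - n + 1)` on the
right. -/
def stepParam (N : ℕ) (α β : ℕ → ℂ) (n : ℕ) : ℂ :=
  if n ≤ N then α n else β (2 * N - n + 1)

/-- The weight of an ensemble: a jump of size `m` has weight (parameter of the step) `^ m`. -/
def weight (N : ℕ) (α β : ℕ → ℂ) (x : Fin N → Fin (2 * N + 1) → ℤ) : ℂ :=
  ∏ i : Fin N, ∏ n : Fin (2 * N),
    stepParam N α β (n + 1) ^ (x i n.succ - x i n.castSucc).natAbs

/-- Total weight of the ensembles with the property `A`. -/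
def totalWeight (N : ℕ) (a l : Fin N → ℤ) (α β : ℕ → ℂ)
    (A : (Fin N → Fin (2 * N + 1) → ℤ) → Prop) : ℂ :=
  ∑' x : {x : Fin N → Fin (2 * N + 1) → ℤ // IsPathEnsemble N a l x ∧ A x}, weight N α β x

/-- The normalising constant of the model conditioned on nonintersection. -/
def partitionFunction (N : ℕ) (a l : Fin N → ℤ) (α β : ℕ → ℂ) : ℂ :=
  totalWeight N a l α β fun _ => True

/-- Some path crosses line `s` at height `h`. -/
def PassesThrough {N : ℕ} (x : Fin N → Fin (2 * N + 1) → ℤ) (s : ℕ) (h : ℤ) : Prop :=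
  ∃ (i : Fin N) (m : Fin (2 * N + 1)), (m : ℕ) = s ∧ x i m = h

/-- The correlation function: the probability, under the weights conditioned on nonintersection,
that the paths pass through all the points `p 0, …, p (n - 1)` of `ℕ × ℕ`. -/
def correlation (N : ℕ) (a l : Fin N → ℤ) (α β : ℕ → ℂ) {n : ℕ} (p : Fin n → ℕ × ℕ) : ℂ :=
  totalWeight N a l α β (fun x => ∀ r, PassesThrough x (p r).1 (p r).2) /
    partitionFunction N a l α β

/-- The equally spaced starting heights `0, k, 2k, …, (N-1)k`. -/
def equallySpaced (N k : ℕ) : Fin N → ℤ := fun i => (k : ℤ) * (i : ℕ)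

/-! ### The correlation kernel of the process (Lindström–Gessel–Viennot, Eynard–Mehta) -/

/-- Generating function of the transition weights of step `n`, `1 ≤ n ≤ 2 * N`. -/
def transitionGF (N : ℕ) (α β : ℕ → ℂ) (n : ℕ) (z : ℂ) : ℂ :=
  if n ≤ N then (1 - α n * z)⁻¹ else (1 - β (2 * N - n + 1) / z)⁻¹

/-- `(2πi)⁻¹ ∮_{|z| = 1} f(z) dz`, counterclockwise. -/
def unitCircleIntegral (f : ℂ → ℂ) : ℂ :=
  (2 * (Real.pi : ℂ) * Complex.I)⁻¹ * ∮ z in C(0, 1), f z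

/-- The Gram matrix of the initial and final functions. -/
def gram (N : ℕ) (a l : Fin N → ℤ) (α β : ℕ → ℂ) : Matrix (Fin N) (Fin N) ℂ :=
  Matrix.of fun i j => unitCircleIntegral fun z =>
    (∏ n ∈ Finset.Icc 1 (2 * N), transitionGF N α β n z) * (z ^ a i / z ^ (l j + 1))

/-- The kernel `K(s₁, x₁; s₂, x₂)` of the process. -/
def kernel (N : ℕ) (a l : Fin N → ℤ) (α β : ℕ → ℂ) (s₁ : ℕ) (x₁ : ℤ) (s₂ : ℕ) (x₂ : ℤ) : ℂ :=
  -(if s₂ < s₁ then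
      unitCircleIntegral fun z =>
        (∏ n ∈ Finset.Ioc s₂ s₁, transitionGF N α β n z) / z ^ (x₁ - x₂ + 1)
    else 0) +
  ∑ i : Fin N, ∑ j : Fin N, ((gram N a l α β)⁻¹).transpose i j *
    (unitCircleIntegral fun z =>
      z ^ a i * (∏ n ∈ Finset.Icc 1 s₁, transitionGF N α β n z) / z ^ (x₁ + 1)) *
    (unitCircleIntegral fun z =>
      (∏ n ∈ Finset.Ioc s₂ (2 * N), transitionGF N α β n z) * z ^ x₂ / z ^ (l j + 1))

/-! ### Contours -/

/-- Closed curves parametrised by `[0, 1]` that are continuous and, off finitely many parameters,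
differentiable, with integrable derivative.  Every piecewise `C¹` closed curve is one. -/
structure IsClosedCurve (γ : ℝ → ℂ) : Prop where
  continuousOn : ContinuousOn γ (Set.Icc 0 1)
  closed : γ 0 = γ 1
  differentiable : ∃ S : Set ℝ, S.Finite ∧ ∀ t ∈ Set.Ioo (0 : ℝ) 1 \ S, DifferentiableAt ℝ γ t
  integrable : IntervalIntegrable (deriv γ) MeasureTheory.volume 0 1

/-- `∮_Γ f(w) dw` along a contour `Γ` made of the closed curves `Γ 0, …, Γ (m - 1)`. -/
def contourIntegral {m : ℕ} (Γ : Fin m → ℝ → ℂ) (f : ℂ → ℂ) : ℂ :=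
  ∑ i : Fin m, ∫ t in (0 : ℝ)..1, f (Γ i t) * deriv (Γ i) t

/-- The winding number of the contour `Γ` around `c` (for `c` not on `Γ`). -/
def windingNumber {m : ℕ} (Γ : Fin m → ℝ → ℂ) (c : ℂ) : ℂ :=
  (2 * (Real.pi : ℂ) * Complex.I)⁻¹ * contourIntegral Γ fun w => (w - c)⁻¹

/-- `Γ` is a contour in the open unit disc that goes once, counterclockwise, around each `β j` and
does not go around any other zero of `w ^ k - (β j) ^ k`. -/
structure IsContourAround (N k : ℕ) (β : ℕ → ℂ) {m : ℕ} (Γ : Fin m → ℝ → ℂ) : Prop where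
  curve : ∀ i, IsClosedCurve (Γ i)
  mem_disc : ∀ i, ∀ t ∈ Set.Icc (0 : ℝ) 1, ‖Γ i t‖ < 1
  avoids : ∀ i, ∀ t ∈ Set.Icc (0 : ℝ) 1, ∀ j ∈ Finset.Icc 1 N, Γ i t ^ k ≠ β j ^ k
  around : ∀ j ∈ Finset.Icc 1 N, windingNumber Γ (β j) = 1
  not_around : ∀ j ∈ Finset.Icc 1 N, ∀ c : ℂ, c ^ k = β j ^ k → c ≠ β j → windingNumber Γ c = 0

/-! ### The contour integral formulas -/

/-- `-1_{s₁ > s₂} (2πi)⁻¹ ∮ ∏_{j = s₂ + 1}^{s₁} (1 - α_j z)⁻¹ dz / z^{x₁ - x₂ + 1}`. -/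
def singleIntegralTerm (α : ℕ → ℂ) (s₁ x₁ s₂ x₂ : ℕ) : ℂ :=
  -(if s₂ < s₁ then
      unitCircleIntegral fun z =>
        (∏ j ∈ Finset.Ioc s₂ s₁, (1 - α j * z)⁻¹) / z ^ ((x₁ : ℤ) - (x₂ : ℤ) + 1)
    else 0)

/-- The double contour integral formula for general `β`. -/
def doubleIntegralKernel (N k : ℕ) (α β : ℕ → ℂ) {m : ℕ} (Γ : Fin m → ℝ → ℂ)
    (s₁ x₁ s₂ x₂ : ℕ) : ℂ :=
  singleIntegralTerm α s₁ x₁ s₂ x₂ +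
  (k : ℂ) / (2 * (Real.pi : ℂ) * Complex.I) ^ 2 *
    ∮ z in C(0, 1), contourIntegral Γ fun w =>
      ((∏ r ∈ Finset.Icc 1 s₂, (1 - α r * w)) * ∏ j ∈ Finset.Icc 1 N, (z ^ k - β j ^ k)) /
        ((∏ n ∈ Finset.Icc 1 s₁, (1 - α n * z)) * ∏ t ∈ Finset.Icc 1 N, (w ^ k - β t ^ k)) *
      (w ^ (x₂ + k - 1) / (z ^ (x₁ + 1) * (z ^ k - w ^ k)))

/-- The double contour integral formula when all `β j` equal `b`. -/
def doubleIntegralKernelConst (N k : ℕ) (α : ℕ → ℂ) (b : ℂ) {m : ℕ} (Γ : Fin m → ℝ → ℂ)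
    (s₁ x₁ s₂ x₂ : ℕ) : ℂ :=
  singleIntegralTerm α s₁ x₁ s₂ x₂ +
  (k : ℂ) / (2 * (Real.pi : ℂ) * Complex.I) ^ 2 *
    ∮ z in C(0, 1), contourIntegral Γ fun w =>
      ((∏ r ∈ Finset.Icc 1 s₂, (1 - α r * w)) * (z ^ k - b ^ k) ^ N) /
        ((∏ n ∈ Finset.Icc 1 s₁, (1 - α n * z)) * (w ^ k - b ^ k) ^ N) *
      (w ^ (x₂ + k - 1) / (z ^ (x₁ + 1) * (z ^ k - w ^ k)))

end NonintersectingWalks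

end

/-!
The partition function is computed by the Lindström–Gessel–Viennot method in its transfer matrix
form. For increasing configurations, the determinant of the weights of a single step is the weight
of the configuration of jumps if these are disjoint and `0` otherwise (`det_jump`). By Cauchy–Binet
(`det_sum_mul`, `det_chain`), the ensembles whose heights stay in `[-M, M]` have as total weight a
determinant of path weights, also if every visit of height `y` on line `s` carries a factor `V s y`
(`sum_box_eq_det`).

The correlation functions come from the factors `1 - v_r` at the marked points. Cutting a path at
its last visit of a marked point (`trans_eq_sum_last_visit`) and taking Schur complements expresses
the determinant with these factors as `det G * det (1 - v K)`, with `K` the Eynard–Mehta kernel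
(`det_marked`); inclusion–exclusion over `v ∈ {0, 1}ⁿ` then gives `det K`
(`sum_box_passesThrough`). The bound `M` is removed in the limit: the weights of the paths are
coefficients of products of geometric series, hence tend to integrals over the unit circle, and the
sum over all ensembles converges absolutely since the partial sums for the parameters `|α j|`,
`|β j|` are bounded by convergent determinants. Thus `Z = det G` and the correlation functions are
determinants of the kernel (`partitionFunction_eq_det`, `correlation_eq_det`). For nonnegative
parameters `Z` is a sum of nonnegative terms, and the ensemble in which one walker at a time jumps
down, the lowest first, has positive weight.

For the contour formula put `P = ∏ (X - β j)` and `Q = ∏ (X - β j ^ k)`. Because `l_j ≤ N - 1`, the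
final functions are values at `X ^ x ∏ (1 - α_r X)` of functionals on `ℂ[X] / (P)`
(`residueFunctional`), and the entries of `G` are their values at `1, X ^ k, …, X ^ (k (N - 1))`. So
`det G ≠ 0` makes these powers a basis of `ℂ[X] / (P)`, and multiplying the final functions by `G⁻¹`
yields the coordinates in this basis. These coordinates are contour integrals
(`IsContourAround.contourIntegral_eq_coeff`): `Γ` ignores the roots of `Q(w ^ k) / P(w)`, so
multiples of `P` do not contribute, and the curve `Γ ^ k` goes once around each `β j ^ k`, so the
substitution `u = w ^ k` reduces the powers of `X ^ k` to the duality, for the pairing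
`∮ f g / Q`, of `1, u, …, u ^ (N - 1)` and the polynomials `q_i` with
`(Q(v) - Q(u)) / (v - u) = ∑ v ^ i q_i(u)`. With the same identity,
`Q(z ^ k) / (Q(w ^ k) (z ^ k - w ^ k))` equals `∑ z ^ (k i) q_i(w ^ k) / Q(w ^ k)` plus
`1 / (z ^ k - w ^ k)`, which is holomorphic in `w` on the disc and integrates to `0`; this is the
double integral.

Admissible contours exist because different parameters with equal `k`-th powers would make the
powers of `X ^ k` dependent modulo `P` (`eq_of_pow_eq`), so that small circles around the `β j`
will do.
-/

noncomputable section

namespace NonintersectingWalks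

/-! ### The Cauchy–Binet formula and one-step determinants -/

section CauchyBinet

variable {R X : Type*} [CommRing R] [LinearOrder X] {N : ℕ}

/-- An injective tuple is, in exactly one way, a permutation of a strictly increasing one. -/
theorem sum_injective_eq_sum_strictMono_perm (I : Finset X) (F : (Fin N → X) → R) :
    ∑ f ∈ (Fintype.piFinset fun _ : Fin N => I).filter Function.Injective, F f =
      ∑ g ∈ (Fintype.piFinset fun _ : Fin N => I).filter StrictMono,
        ∑ σ : Equiv.Perm (Fin N), F (g ∘ σ) := by
  rw [← Finset.sum_product']
  symm
  refine Finset.sum_bij (fun p _ => p.1 ∘ p.2) ?_ ?_ ?_ ?_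
  · rintro ⟨g, σ⟩ h
    simp only [Finset.mem_product, Finset.mem_filter, Fintype.mem_piFinset, Finset.mem_univ,
      and_true] at h ⊢
    exact ⟨fun i => h.1 _, h.2.injective.comp σ.injective⟩
  · rintro ⟨g, σ⟩ h ⟨g', σ'⟩ h' e
    simp only [Finset.mem_product, Finset.mem_filter, Fintype.mem_piFinset, Finset.mem_univ,
      and_true] at h h' e
    have hg : g = g' := by
      refine (StrictMono.range_inj h.2 h'.2).1 ?_
      have := congrArg Set.range e
      rwa [EquivLike.range_comp g σ, EquivLike.range_comp g' σ'] at this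
    subst hg
    have : σ = σ' := Equiv.ext fun i => h.2.injective (congrFun e i)
    rw [this]
  · intro f hf
    simp only [Finset.mem_filter, Fintype.mem_piFinset] at hf
    refine ⟨(f ∘ Tuple.sort f, (Tuple.sort f)⁻¹), ?_, ?_⟩
    · simp only [Finset.mem_product, Finset.mem_filter, Fintype.mem_piFinset, Finset.mem_univ,
        and_true]
      exact ⟨fun i => hf.1 _, (Tuple.monotone_sort f).strictMono_of_injective
        (hf.2.comp (Tuple.sort f).injective)⟩
    · ext i
      simp
  · intros; rfl

/-- The Cauchy–Binet formula. -/
theorem det_sum_mul (I : Finset X) (A : Fin N → X → R) (B : X → Fin N → R) :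
    (Matrix.of fun i j => ∑ u ∈ I, A i u * B u j).det =
      ∑ f ∈ (Fintype.piFinset fun _ : Fin N => I).filter StrictMono,
        (Matrix.of fun i j => A i (f j)).det * (Matrix.of fun i j => B (f i) j).det := by
  have h1 : (Matrix.of fun i j => ∑ u ∈ I, A i u * B u j).det =
      ∑ f ∈ Fintype.piFinset fun _ : Fin N => I,
        (∏ i, A i (f i)) * (Matrix.of fun i j => B (f i) j).det := by
    have e : (Matrix.of fun i j => ∑ u ∈ I, A i u * B u j) =
        fun i => ∑ u ∈ I, A i u • B u := by
      ext i j
      simp [Finset.sum_apply]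
    rw [e]
    change Matrix.detRowAlternating.toMultilinearMap _ = _
    rw [MultilinearMap.map_sum_finset]
    refine Finset.sum_congr rfl fun f _ => ?_
    rw [MultilinearMap.map_smul_univ]
    rfl
  rw [h1, ← Finset.sum_filter_of_ne (p := Function.Injective),
    sum_injective_eq_sum_strictMono_perm]
  · refine Finset.sum_congr rfl fun g _ => ?_
    rw [← Matrix.det_transpose, Matrix.det_apply', Finset.sum_mul]
    refine Finset.sum_congr rfl fun σ _ => ?_
    have := Matrix.det_permute σ (Matrix.of fun i j => B (g i) j)
    have e : (Matrix.of fun i j => B ((g ∘ σ) i) j) =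
        (Matrix.of fun i j => B (g i) j).submatrix σ id := rfl
    rw [e, this]
    simp only [Matrix.transpose_apply, Matrix.of_apply, Function.comp]
    ring
  · intro f _ hf i j hij
    by_contra hne
    exact hf (by rw [Matrix.det_zero_of_row_eq hne (by ext; simp [hij]), mul_zero])

end CauchyBinet

/-- Weight of an upward jump from `x` to `y`. -/
def jump (a : ℂ) (x y : ℤ) : ℂ := if x ≤ y then a ^ (y - x).natAbs else 0

theorem jump_zero (x y : ℤ) : jump 0 x y = if x = y then 1 else 0 := by
  unfold jump
  rcases lt_trichotomy x y with h | h | h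
  · rw [if_pos h.le, if_neg h.ne, zero_pow (by omega)]
  · simp [h]
  · rw [if_neg (by omega), if_neg (by omega)]

theorem jump_mul_of_le {a : ℂ} {x x' y : ℤ} (h : x ≤ x') (h' : x' ≤ y) :
    jump a x y = a ^ (x' - x).natAbs * jump a x' y := by
  unfold jump
  rw [if_pos h', if_pos (h.trans h'), ← pow_add]
  congr 1
  omega

open Classical in
/-- The one-step transition determinant sees only the noncolliding configurations: at the lowest
walker that collides, two rows are proportional. -/
theorem det_jump {N : ℕ} (a : ℂ) {x y : Fin N → ℤ} (hx : StrictMono x) (hy : StrictMono y) :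
    (Matrix.of fun i j => jump a (x i) (y j)).det =
      if ∀ i j, i < j → y i < x j then ∏ i, jump a (x i) (y i) else 0 := by
  split_ifs with h
  · rw [Matrix.det_of_isUpperTriangular]
    · rfl
    · intro i j hij
      simp only [Matrix.of_apply, jump]
      rw [if_neg]
      have := h j i hij
      omega
  · push Not at h
    obtain ⟨i, ⟨j, hij, hyx⟩, hmin⟩ :=
      WellFounded.has_min (wellFounded_lt (α := Fin N)) {i | ∃ j, i < j ∧ x j ≤ y i} h
    set A : Matrix (Fin N) (Fin N) ℂ := Matrix.of fun i j => jump a (x i) (y j) with hA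
    -- row `i` is a multiple of row `j`: to the left of column `i` both are zero, because `i` is the
    -- lowest colliding walker, and from there on every jump from `x i` goes past `x j`
    have hrow : A i + (-a ^ (x j - x i).natAbs) • A j = 0 := by
      ext m
      simp only [hA, Pi.add_apply, Pi.smul_apply, Matrix.of_apply, smul_eq_mul, Pi.zero_apply]
      rcases lt_or_ge m i with hm | hm
      · have h1 : y m < x i := by
          by_contra hc
          exact hmin m ⟨i, hm, not_lt.1 hc⟩ hm
        have h2 : x i < x j := hx hij
        rw [jump, jump, if_neg (by omega), if_neg (by omega)]
        ring
      · have h1 : y i ≤ y m := hy.monotone hm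
        rw [jump_mul_of_le (hx hij).le (hyx.trans h1)]
        ring
    rw [← Matrix.det_updateRow_add_smul_self A hij.ne (-a ^ (x j - x i).natAbs), hrow]
    exact Matrix.det_eq_zero_of_row_eq_zero i fun m => by simp

open Classical in
/-- The determinant of a downward step. -/
theorem det_jump_swap {N : ℕ} (a : ℂ) {x y : Fin N → ℤ} (hx : StrictMono x) (hy : StrictMono y) :
    (Matrix.of fun i j => jump a (y j) (x i)).det =
      if ∀ i j, i < j → x i < y j then ∏ i, jump a (y i) (x i) else 0 := by
  rw [← det_jump a hy hx, ← Matrix.det_transpose]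
  rfl

/-! ### The Lindström–Gessel–Viennot formula -/

section Chain

/-- `chain I T n s x y` is the total weight of the paths from height `x` on line `s` to height `y`
on line `s + n` whose heights on the lines in between, and on line `s + n`, lie in `I`, the step
from line `t` to line `t + 1` having the weights `T t`. -/
def chain (I : Finset ℤ) (T : ℕ → ℤ → ℤ → ℂ) : ℕ → ℕ → ℤ → ℤ → ℂ
  | 0, _, x, y => if x = y then 1 else 0
  | n + 1, s, x, y => ∑ u ∈ I, T s x u * chain I T n (s + 1) u y

variable {N : ℕ}

open Classical in
/-- The weight of a step of all the walkers from the configuration `c` to `c'`, in determinantal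
form. It is set to zero if `c'` is not increasing. -/
def detStep (T : ℕ → ℤ → ℤ → ℂ) (s : ℕ) (c c' : Fin N → ℤ) : ℂ :=
  if StrictMono c' then (Matrix.of fun i j => T s (c i) (c' j)).det else 0

/-- A sum over tuples of length `n + 1` as an iterated sum. -/
theorem sum_piFinset_cons {α : Type*} (S : Finset α) (n : ℕ) (F : (Fin (n + 1) → α) → ℂ) :
    ∑ d ∈ Fintype.piFinset fun _ : Fin (n + 1) => S, F d =
      ∑ c ∈ S, ∑ d ∈ Fintype.piFinset fun _ : Fin n => S, F (Fin.cons c d) := by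
  rw [← Finset.sum_product']
  symm
  refine Finset.sum_bij' (fun p _ => Fin.cons p.1 p.2) (fun d _ => (d 0, Fin.tail d)) ?_ ?_ ?_ ?_ ?_
  · rintro ⟨c, d⟩ h
    simpa [Fin.forall_fin_succ] using h
  · intro d h
    simpa [Fin.forall_fin_succ, Fin.tail] using h
  · rintro ⟨c, d⟩ _
    simp
  · intro d _
    simp
  · intros; rfl

open Classical in
/-- Determinants of path weights expand over all sequences of strictly increasing
configurations. -/
theorem det_chain (I : Finset ℤ) (T : ℕ → ℤ → ℤ → ℂ) (n s : ℕ) {a l : Fin N → ℤ}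
    (ha : StrictMono a) (hl : StrictMono l) :
    (Matrix.of fun i j => chain I T n s (a i) (l j)).det =
      ∑ d ∈ Fintype.piFinset fun _ : Fin n => Fintype.piFinset fun _ : Fin N => I,
        (∏ m : Fin n, detStep T (s + m) ((Fin.cons a d : Fin (n + 1) → Fin N → ℤ) m.castSucc)
            ((Fin.cons a d : Fin (n + 1) → Fin N → ℤ) m.succ)) *
          if (Fin.cons a d : Fin (n + 1) → Fin N → ℤ) (Fin.last n) = l then 1 else 0 := by
  induction n generalizing s a with
  | zero =>
    have h := det_jump 0 ha hl
    simp only [jump_zero] at h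
    simp only [chain, h]
    simp only [Finset.prod_ite_zero, Finset.mem_univ, forall_const, Finset.prod_const_one]
    rw [← ite_and]
    have : (∀ i j, i < j → l i < a j) ∧ (∀ i, a i = l i) ↔ a = l := by
      constructor
      · exact fun h => funext h.2
      · rintro rfl
        exact ⟨fun i j h => ha h, fun _ => rfl⟩
    simp [this]
  | succ n ih =>
    rw [sum_piFinset_cons]
    simp only [chain]
    rw [det_sum_mul I (fun i u => T s (a i) u) (fun u j => chain I T n (s + 1) u (l j)),
      Finset.sum_filter]
    refine Finset.sum_congr rfl fun c _ => ?_
    split_ifs with hc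
    · rw [ih (s + 1) hc, Finset.mul_sum]
      refine Finset.sum_congr rfl fun d _ => ?_
      rw [Fin.prod_univ_succ, ← Fin.succ_last]
      simp only [Fin.cons_succ, Fin.castSucc_zero, Fin.cons_zero, Fin.val_zero, add_zero,
        Fin.val_succ, ← Fin.succ_castSucc]
      have e : ∀ m : Fin n, s + ((m : ℕ) + 1) = s + 1 + m := fun m => by omega
      simp only [detStep, if_pos hc, mul_assoc, e]
    · refine (Finset.sum_eq_zero fun d _ => ?_).symm
      rw [Fin.prod_univ_succ]
      simp [detStep, hc]

end Chain

/-! ### Path ensembles as determinants -/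

section Ensembles

variable {N : ℕ} {α β : ℕ → ℂ}

/-- The transition weights of the model from line `s` to line `s + 1`. -/
def step (N : ℕ) (α β : ℕ → ℂ) (s : ℕ) (x y : ℤ) : ℂ :=
  if s < N then jump (stepParam N α β (s + 1)) x y else jump (stepParam N α β (s + 1)) y x

/-- The transition weights, with an additional factor `V s y` for every visit of height `y` on
line `s ≥ 1`. -/
def decoratedStep (N : ℕ) (α β : ℕ → ℂ) (V : ℕ → ℤ → ℂ) (s : ℕ) (x y : ℤ) : ℂ :=
  step N α β s x y * V (s + 1) y

/-- The jumps from `c i` to `c' i` in step `s + 1` have the right direction: upwards for `s < N`,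
downwards for `N ≤ s`. -/
def IsMonotoneStep (N s : ℕ) (c c' : Fin N → ℤ) : Prop :=
  ∀ i, if s < N then c i ≤ c' i else c' i ≤ c i

/-- The segments traced in step `s + 1`, if they have the right direction, lie strictly above each
other, in the order of the walkers. -/
def IsNoncolliding (N s : ℕ) (c c' : Fin N → ℤ) : Prop :=
  ∀ i j, i < j → if s < N then c' i < c j else c i < c' j

theorem step_eq_pow {s : ℕ} {x y : ℤ} (h : if s < N then x ≤ y else y ≤ x) :
    step N α β s x y = stepParam N α β (s + 1) ^ (y - x).natAbs := by
  unfold step jump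
  split_ifs at h ⊢
  · rfl
  · congr 1
    omega

theorem step_eq_zero {s : ℕ} {x y : ℤ} (h : ¬ if s < N then x ≤ y else y ≤ x) :
    step N α β s x y = 0 := by
  unfold step jump
  split_ifs at h ⊢ <;> rfl

open Classical in
theorem det_step (s : ℕ) {c c' : Fin N → ℤ} (hc : StrictMono c) (hc' : StrictMono c') :
    (Matrix.of fun i j => step N α β s (c i) (c' j)).det =
      if IsNoncolliding N s c c' then ∏ i, step N α β s (c i) (c' i) else 0 := by
  by_cases hs : s < N
  · simp only [step, IsNoncolliding, if_pos hs]
    exact det_jump _ hc hc'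
  · simp only [step, IsNoncolliding, if_neg hs]
    exact det_jump_swap _ hc hc'

theorem det_decoratedStep (V : ℕ → ℤ → ℂ) (s : ℕ) (c c' : Fin N → ℤ) :
    (Matrix.of fun i j => decoratedStep N α β V s (c i) (c' j)).det =
      (∏ i, V (s + 1) (c' i)) * (Matrix.of fun i j => step N α β s (c i) (c' j)).det := by
  rw [← Matrix.det_mul_row]
  congr 1
  ext i j
  simp [decoratedStep, mul_comm]

theorem IsNoncolliding.strictMono {s : ℕ} {c c' : Fin N → ℤ} (hc : StrictMono c)
    (h : IsNoncolliding N s c c') (h' : IsMonotoneStep N s c c') : StrictMono c' := by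
  intro i j hij
  have h1 := h i j hij
  have h2 := h' i
  have h3 := h' j
  have h4 := hc hij
  split_ifs at h1 h2 h3 <;> omega

theorem isNoncolliding_of_disjoint {s : ℕ} {c c' : Fin N → ℤ} (hc : StrictMono c)
    (h' : IsMonotoneStep N s c c')
    (h : ∀ i j, i ≠ j → Disjoint (Set.uIcc (c i) (c' i)) (Set.uIcc (c j) (c' j))) :
    IsNoncolliding N s c c' := by
  intro i j hij
  have h2 := h' i
  have h3 := h' j
  have h4 := hc hij
  have h5 := Set.disjoint_left.1 (h i j hij.ne)
  have h6 := Set.disjoint_right.1 (h i j hij.ne)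
  split_ifs at h2 h3 ⊢
  · by_contra hcon
    rw [Set.uIcc_of_le h2, Set.uIcc_of_le h3] at h5
    exact h5 (a := c j) ⟨h4.le, not_lt.1 hcon⟩ ⟨le_rfl, h3⟩
  · by_contra hcon
    rw [Set.uIcc_of_ge h2, Set.uIcc_of_ge h3] at h5
    exact h5 (a := c i) ⟨h2, le_rfl⟩ ⟨not_lt.1 hcon, h4.le⟩

theorem IsNoncolliding.disjoint {s : ℕ} {c c' : Fin N → ℤ}
    (h : IsNoncolliding N s c c') (h' : IsMonotoneStep N s c c') (i j : Fin N) (hij : i ≠ j) :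
    Disjoint (Set.uIcc (c i) (c' i)) (Set.uIcc (c j) (c' j)) := by
  wlog hlt : i < j generalizing i j
  · exact (this j i hij.symm (lt_of_le_of_ne (not_lt.1 hlt) hij.symm)).symm
  have h1 := h i j hlt
  have h2 := h' i
  have h3 := h' j
  rw [Set.disjoint_left]
  intro x hx hx'
  rw [Set.mem_uIcc] at hx hx'
  split_ifs at h1 h2 h3 <;> omega

theorem isPathEnsemble_iff {a l : Fin N → ℤ} (x : Fin N → Fin (2 * N + 1) → ℤ) :
    IsPathEnsemble N a l x ↔ (∀ i, x i 0 = a i) ∧ (∀ i, x i (Fin.last (2 * N)) = l i) ∧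
      ∀ m : Fin (2 * N), IsMonotoneStep N m (fun i => x i m.castSucc) (fun i => x i m.succ) ∧
        ∀ i j, i ≠ j → Disjoint (Set.uIcc (x i m.castSucc) (x i m.succ))
          (Set.uIcc (x j m.castSucc) (x j m.succ)) := by
  constructor
  · intro h
    refine ⟨h.start, h.finish, fun m => ⟨fun i => ?_, fun i j hij => h.disjoint i j hij m⟩⟩
    split_ifs with hm
    · exact h.up i m hm
    · exact h.down i m (not_lt.1 hm)
  · rintro ⟨h1, h2, h3⟩
    refine ⟨h1, h2, fun i n hn => ?_, fun i n hn => ?_, fun i j hij n => (h3 n).2 i j hij⟩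
    · have := (h3 n).1 i
      rwa [if_pos hn] at this
    · have := (h3 n).1 i
      rwa [if_neg (not_lt.2 hn)] at this

theorem IsPathEnsemble.strictMono {a l : Fin N → ℤ} (ha : StrictMono a)
    {x : Fin N → Fin (2 * N + 1) → ℤ} (h : IsPathEnsemble N a l x) (m : Fin (2 * N + 1)) :
    StrictMono fun i => x i m := by
  induction m using Fin.induction with
  | zero => simpa only [h.start] using ha
  | succ m ih =>
    have := ((isPathEnsemble_iff x).1 h).2.2 m
    exact (isNoncolliding_of_disjoint ih this.1 this.2).strictMono ih this.1

open Classical in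
/-- For an increasing initial configuration, the product of one-step determinants is the weight
of the ensemble, and vanishes unless the ensemble is nonintersecting. -/
theorem prod_detStep (V : ℕ → ℤ → ℂ) {a l : Fin N → ℤ} (ha : StrictMono a)
    (x : Fin N → Fin (2 * N + 1) → ℤ) (hx : ∀ i, x i 0 = a i) :
    (∏ i, V 0 (a i)) * ((∏ m : Fin (2 * N), detStep (decoratedStep N α β V) m
        (fun i => x i m.castSucc) (fun i => x i m.succ)) *
        if (fun i => x i (Fin.last (2 * N))) = l then 1 else 0) =
      if IsPathEnsemble N a l x then
        weight N α β x * ∏ i, ∏ m : Fin (2 * N + 1), V m (x i m) else 0 := by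
  split_ifs with h1 h2 h2
  · have hmono := h2.strictMono ha
    have h3 := ((isPathEnsemble_iff x).1 h2).2.2
    have key : ∀ m : Fin (2 * N), detStep (decoratedStep N α β V) m
        (fun i => x i m.castSucc) (fun i => x i m.succ) =
        (∏ i, V (m + 1) (x i m.succ)) *
          ∏ i, stepParam N α β (m + 1) ^ (x i m.succ - x i m.castSucc).natAbs := by
      intro m
      rw [detStep, if_pos (hmono _), det_decoratedStep, det_step _ (hmono _) (hmono _),
        if_pos (isNoncolliding_of_disjoint (hmono _) (h3 m).1 (h3 m).2)]
      congr 1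
      exact Finset.prod_congr rfl fun i _ => step_eq_pow ((h3 m).1 i)
    simp only [key, Finset.prod_mul_distrib, weight]
    rw [Finset.prod_comm (s := Finset.univ (α := Fin N)) (t := Finset.univ (α := Fin (2 * N))),
      Finset.prod_comm (s := Finset.univ (α := Fin N)) (t := Finset.univ (α := Fin (2 * N + 1))),
      Fin.prod_univ_succ (n := 2 * N)]
    simp only [hx, Fin.val_zero, Fin.val_succ]
    ring
  · rw [mul_one]
    by_contra hne
    refine h2 ((isPathEnsemble_iff x).2 ⟨hx, fun i => congrFun h1 i, ?_⟩)
    have hne' := right_ne_zero_of_mul hne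
    rw [Finset.prod_ne_zero_iff] at hne'
    have hmono : ∀ m : Fin (2 * N + 1), StrictMono fun i => x i m := by
      intro m
      refine Fin.cases ?_ (fun m => ?_) m
      · simpa only [hx] using ha
      · by_contra hc
        exact hne' m (Finset.mem_univ _) (if_neg hc)
    intro m
    have h4 := hne' m (Finset.mem_univ _)
    rw [detStep, if_pos (hmono _), det_decoratedStep, det_step _ (hmono _) (hmono _)] at h4
    have h5 := right_ne_zero_of_mul h4
    split_ifs at h5 with h6
    · rw [Finset.prod_ne_zero_iff] at h5
      have h7 : IsMonotoneStep N m (fun i => x i m.castSucc) (fun i => x i m.succ) := by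
        intro i
        by_contra hc
        exact h5 i (Finset.mem_univ _) (step_eq_zero hc)
      exact ⟨h7, h6.disjoint h7⟩
    · exact absurd rfl h5
  · exact absurd (funext fun i => h2.finish i) h1
  · simp

/-- Families of heights that lie in `[-M, M]`. -/
def box (N M : ℕ) : Finset (Fin N → Fin (2 * N + 1) → ℤ) :=
  Fintype.piFinset fun _ => Fintype.piFinset fun _ => Finset.Icc (-(M : ℤ)) M

open Classical in
/-- The Lindström–Gessel–Viennot formula for ensembles of bounded height, with a factor `V s y`
for every visit of height `y` on line `s`. -/
theorem sum_box_eq_det (V : ℕ → ℤ → ℂ) {a l : Fin N → ℤ} (ha : StrictMono a) (hl : StrictMono l)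
    (M : ℕ) (haM : ∀ i, a i ∈ Finset.Icc (-(M : ℤ)) M) :
    ∑ x ∈ box N M, (if IsPathEnsemble N a l x then
        weight N α β x * ∏ i, ∏ m : Fin (2 * N + 1), V m (x i m) else 0) =
      (∏ i, V 0 (a i)) * (Matrix.of fun i j =>
        chain (Finset.Icc (-(M : ℤ)) M) (decoratedStep N α β V) (2 * N) 0 (a i) (l j)).det := by
  rw [det_chain _ _ _ _ ha hl, Finset.mul_sum]
  set F : (Fin N → Fin (2 * N + 1) → ℤ) → ℂ := fun x => if IsPathEnsemble N a l x then
        weight N α β x * ∏ i, ∏ m : Fin (2 * N + 1), V m (x i m) else 0 with hF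
  have h1 : ∑ x ∈ box N M, F x = ∑ c ∈ Fintype.piFinset fun _ : Fin (2 * N + 1) =>
      Fintype.piFinset fun _ : Fin N => Finset.Icc (-(M : ℤ)) M, F (Function.swap c) := by
    refine Finset.sum_nbij' Function.swap Function.swap ?_ ?_ ?_ ?_ ?_
    · intro x hx
      simp only [box, Fintype.mem_piFinset, Function.swap] at hx ⊢
      exact fun m i => hx i m
    · intro x hx
      simp only [box, Fintype.mem_piFinset, Function.swap] at hx ⊢
      exact fun m i => hx i m
    · intros; rfl
    · intros; rfl
    · intros; rfl
  rw [h1, sum_piFinset_cons, Finset.sum_eq_single_of_mem a (by simpa using haM)]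
  · refine Finset.sum_congr rfl fun d _ => ?_
    have h2 := prod_detStep (α := α) (β := β) V (l := l) ha
      (Function.swap (Fin.cons a d : Fin (2 * N + 1) → Fin N → ℤ)) (fun i => rfl)
    rw [hF]
    simp only
    rw [← h2]
    simp only [zero_add]
  · intro c _ hc
    refine Finset.sum_eq_zero fun d _ => ?_
    rw [hF]
    simp only
    rw [if_neg]
    intro h
    exact hc (funext fun i => h.start i)

end Ensembles

/-! ### The Eynard–Mehta theorem for paths of bounded height -/

section Trans

variable {I : Finset ℤ} {T : ℕ → ℤ → ℤ → ℂ}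

/-- The weight of the paths from height `x` on line `s` to height `y` on line `s' ≥ s`. -/
def trans (I : Finset ℤ) (T : ℕ → ℤ → ℤ → ℂ) (s s' : ℕ) (x y : ℤ) : ℂ := chain I T (s' - s) s x y

theorem trans_self (s : ℕ) (x y : ℤ) : trans I T s s x y = if x = y then 1 else 0 := by
  simp [trans, chain]

theorem trans_of_lt {s s' : ℕ} (h : s < s') (x y : ℤ) :
    trans I T s s' x y = ∑ u ∈ I, T s x u * trans I T (s + 1) s' u y := by
  obtain ⟨k, rfl⟩ := Nat.exists_eq_add_of_lt h
  have e1 : s + k + 1 - s = k + 1 := by omega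
  have e2 : s + k + 1 - (s + 1) = k := by omega
  simp only [trans, e1, e2, chain]

end Trans

section EynardMehta

variable {N n : ℕ} (I : Finset ℤ) (T : ℕ → ℤ → ℤ → ℂ) (L : ℕ) (a l : Fin N → ℤ)
  (p : Fin n → ℕ × ℤ) (v : Fin n → ℂ)

/-- The factor for visiting height `x` on line `s`: it is `1 - v r` at the marked point `p r` and
`1` elsewhere. -/
def mark (s : ℕ) (x : ℤ) : ℂ := 1 - ∑ r, if p r = (s, x) then v r else 0

/-- The transition weights including the factors for the visits of marked points at the end of
the step. -/
def markedStep (s : ℕ) (x y : ℤ) : ℂ := T s x y * mark p v (s + 1) y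

/-- Decomposition of the paths at their last visit of a marked point. -/
theorem trans_eq_sum_last_visit (hp : ∀ r, (p r).1 ≤ L) {s : ℕ} (hs : s ≤ L) (x y : ℤ) :
    trans I T s L x y = mark p v s x * trans I (markedStep T p v) s L x y +
      ∑ r, if s ≤ (p r).1 then trans I T s (p r).1 x (p r).2 *
        (v r * trans I (markedStep T p v) (p r).1 L (p r).2 y) else 0 := by
  have aux : ∀ (s : ℕ) (x : ℤ), (∑ r, if s ≤ (p r).1 then trans I T s (p r).1 x (p r).2 *
        (v r * trans I (markedStep T p v) (p r).1 L (p r).2 y) else 0) =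
      (∑ r, if p r = (s, x) then v r else 0) * trans I (markedStep T p v) s L x y +
      ∑ r, if s < (p r).1 then trans I T s (p r).1 x (p r).2 *
        (v r * trans I (markedStep T p v) (p r).1 L (p r).2 y) else 0 := by
    intro s x
    rw [Finset.sum_mul, ← Finset.sum_add_distrib]
    refine Finset.sum_congr rfl fun r _ => ?_
    rcases lt_trichotomy s (p r).1 with h | h | h
    · rw [if_pos h.le, if_neg (by rw [Prod.ext_iff]; exact fun e => h.ne' e.1), if_pos h]
      ring
    · subst h
      rw [if_pos le_rfl, if_neg (lt_irrefl _), trans_self]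
      by_cases hx : x = (p r).2
      · subst hx
        simp
      · have : ¬ p r = ((p r).1, x) := fun e => hx (congrArg Prod.snd e).symm
        simp [hx, this]
    · rw [if_neg (by omega), if_neg (by rw [Prod.ext_iff]; exact fun e => h.ne e.1),
        if_neg (by omega)]
      ring
  rw [aux, mark]
  have key : trans I T s L x y = trans I (markedStep T p v) s L x y +
      ∑ r, if s < (p r).1 then trans I T s (p r).1 x (p r).2 *
        (v r * trans I (markedStep T p v) (p r).1 L (p r).2 y) else 0 := by
    induction hs using Nat.decreasingInduction generalizing x with
    | self =>
      rw [trans_self, trans_self, Finset.sum_eq_zero, add_zero]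
      intro r _
      rw [if_neg (not_lt.2 (hp r))]
    | of_succ s hs ih =>
      rw [trans_of_lt hs, trans_of_lt hs]
      have h2 : ∀ r, (if s < (p r).1 then trans I T s (p r).1 x (p r).2 *
            (v r * trans I (markedStep T p v) (p r).1 L (p r).2 y) else 0) =
          ∑ u ∈ I, T s x u * (if s + 1 ≤ (p r).1 then trans I T (s + 1) (p r).1 u (p r).2 *
            (v r * trans I (markedStep T p v) (p r).1 L (p r).2 y) else 0) := by
        intro r
        split_ifs with h h' h'
        · rw [trans_of_lt h, Finset.sum_mul]
          exact Finset.sum_congr rfl fun u _ => by ring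
        · omega
        · omega
        · simp
      simp only [h2]
      rw [Finset.sum_comm, ← Finset.sum_add_distrib]
      refine Finset.sum_congr rfl fun u _ => ?_
      rw [← Finset.mul_sum, aux, ih, markedStep, mark]
      ring
  rw [key]
  ring

/-- The matrix of weights of the paths between the end points. -/
def endMatrix : Matrix (Fin N) (Fin N) ℂ := Matrix.of fun i j => trans I T 0 L (a i) (l j)

/-- The Eynard–Mehta kernel at the points `(s₁, x₁)`, `(s₂, x₂)`, for paths whose heights lie in
`I`. -/
def boundedKernel (s₁ : ℕ) (x₁ : ℤ) (s₂ : ℕ) (x₂ : ℤ) : ℂ :=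
  -(if s₂ < s₁ then trans I T s₂ s₁ x₂ x₁ else 0) +
    ∑ i, ∑ j, ((endMatrix I T L a l)⁻¹).transpose i j * trans I T 0 s₁ (a i) x₁ *
      trans I T s₂ L x₂ (l j)

theorem mark_apply (hinj : Function.Injective p) (r : Fin n) :
    mark p v (p r).1 (p r).2 = 1 - v r := by
  rw [mark, Finset.sum_eq_single r]
  · simp
  · intro q _ hq
    rw [if_neg]
    exact fun e => hq (hinj e)
  · simp

/-- The factors at the marked points change the determinant of the weight matrix by the factor
`det (1 - v K)` on the marked points. The two sides are the two Schur complement formulas for the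
block matrix `[G, Φ D; Ψ, 1 + U D]`, where `Φ` and `Ψ` are the weights of the paths to and from the
marked points, `U` those of the paths between marked points on different lines, and `D` is the
diagonal matrix of `v`. -/
theorem det_marked (hp : ∀ r, (p r).1 ≤ L) (hinj : Function.Injective p)
    (hG : (endMatrix I T L a l).det ≠ 0) :
    (Matrix.of fun i j => mark p v 0 (a i) *
        trans I (markedStep T p v) 0 L (a i) (l j)).det =
      (endMatrix I T L a l).det * (1 - Matrix.diagonal v * Matrix.of fun r q =>
        boundedKernel I T L a l (p r).1 (p r).2 (p q).1 (p q).2).det := by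
  set G := endMatrix I T L a l with hGdef
  set Gv : Matrix (Fin N) (Fin N) ℂ := Matrix.of fun i j => mark p v 0 (a i) *
        trans I (markedStep T p v) 0 L (a i) (l j) with hGv
  set Φ : Matrix (Fin N) (Fin n) ℂ := Matrix.of fun i r => trans I T 0 (p r).1 (a i) (p r).2
    with hΦ
  set Ψ : Matrix (Fin n) (Fin N) ℂ := Matrix.of fun r j => trans I T (p r).1 L (p r).2 (l j)
    with hΨ
  set Θ : Matrix (Fin n) (Fin N) ℂ := Matrix.of fun r j =>
    trans I (markedStep T p v) (p r).1 L (p r).2 (l j) with hΘ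
  set U : Matrix (Fin n) (Fin n) ℂ := Matrix.of fun r q =>
    if (p r).1 < (p q).1 then trans I T (p r).1 (p q).1 (p r).2 (p q).2 else 0 with hU
  set D := Matrix.diagonal v with hD
  have h1 : G = Gv + Φ * D * Θ := by
    ext i j
    simp only [hGdef, endMatrix, Matrix.of_apply, Matrix.add_apply, hGv]
    rw [trans_eq_sum_last_visit I T L p v hp (Nat.zero_le L)]
    congr 1
    rw [Matrix.mul_apply]
    refine Finset.sum_congr rfl fun r _ => ?_
    rw [if_pos (Nat.zero_le _), hD, Matrix.mul_diagonal]
    simp only [hΦ, hΘ, Matrix.of_apply]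
    ring
  have h2 : Ψ = (1 + U * D) * Θ := by
    ext r j
    rw [Matrix.add_mul, Matrix.one_mul, Matrix.add_apply, hΨ, Matrix.of_apply,
      trans_eq_sum_last_visit I T L p v hp (hp r), mark_apply p v hinj, Matrix.mul_apply]
    have h3 : ∀ q, (if (p r).1 ≤ (p q).1 then trans I T (p r).1 (p q).1 (p r).2 (p q).2 *
          (v q * trans I (markedStep T p v) (p q).1 L (p q).2 (l j)) else 0) =
        (if r = q then v r * Θ r j else 0) + (U * D) r q * Θ q j := by
      intro q
      rw [hD, Matrix.mul_diagonal]
      simp only [hU, hΘ, Matrix.of_apply]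
      rcases lt_trichotomy (p r).1 (p q).1 with h | h | h
      · rw [if_pos h.le, if_pos h, if_neg]
        · ring
        · rintro rfl
          exact lt_irrefl _ h
      · rw [if_pos h.le, if_neg h.not_lt]
        by_cases hrq : r = q
        · subst hrq
          simp [trans_self]
        · have hne : (p r).2 ≠ (p q).2 := fun e => hrq (hinj (Prod.ext h e))
          rw [h, trans_self, if_neg hne, if_neg hrq]
          ring
      · rw [if_neg (not_le.2 h), if_neg h.not_gt, if_neg]
        · ring
        · rintro rfl
          exact lt_irrefl _ h
    simp only [h3, Finset.sum_add_distrib, Finset.sum_ite_eq, Finset.mem_univ, if_true]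
    simp only [hΘ, Matrix.of_apply]
    ring
  -- `U` only has entries from a line to later lines
  have h3 : (1 + U * D).det = 1 := by
    have hT : (1 + U * D).BlockTriangular fun r => (p r).1 := by
      intro r q h
      have hne : r ≠ q := by
        rintro rfl
        exact lt_irrefl _ h
      rw [Matrix.add_apply, Matrix.one_apply_ne hne, hD, Matrix.mul_diagonal, hU,
        Matrix.of_apply, if_neg h.not_gt]
      ring
    rw [hT.det]
    refine Finset.prod_eq_one fun k _ => ?_
    have : (1 + U * D).toSquareBlock (fun r => (p r).1) k = 1 := by
      ext ⟨r, hr⟩ ⟨q, hq⟩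
      simp only [Matrix.toSquareBlock_def, Matrix.of_apply, Matrix.add_apply, hD,
        Matrix.mul_diagonal, hU]
      rw [if_neg (by omega), zero_mul, add_zero]
      simp [Matrix.one_apply]
    rw [this, Matrix.det_one]
  have h4 : (1 - D * Matrix.of fun r q =>
      boundedKernel I T L a l (p r).1 (p r).2 (p q).1 (p q).2).det =
      (1 + U * D - Ψ * G⁻¹ * (Φ * D)).det := by
    rw [← Matrix.det_transpose]
    congr 1
    have : (Matrix.of fun r q =>
        boundedKernel I T L a l (p r).1 (p r).2 (p q).1 (p q).2).transpose =
        -U + Ψ * G⁻¹ * Φ := by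
      ext r q
      simp only [Matrix.transpose_apply, Matrix.of_apply, boundedKernel, Matrix.add_apply,
        Matrix.neg_apply, hU]
      congr 1
      rw [Matrix.mul_apply]
      refine Finset.sum_congr rfl fun i _ => ?_
      rw [Matrix.mul_apply, Finset.sum_mul]
      refine Finset.sum_congr rfl fun j _ => ?_
      simp only [hΦ, hΨ, Matrix.of_apply]
      ring
    rw [Matrix.transpose_sub, Matrix.transpose_mul, Matrix.transpose_one, this, hD,
      Matrix.diagonal_transpose, Matrix.add_mul, Matrix.mul_assoc _ Φ, Matrix.neg_mul]
    abel
  rw [h4]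
  have : Invertible G := Matrix.invertibleOfIsUnitDet G (isUnit_iff_ne_zero.2 hG)
  have : Invertible (1 + U * D) :=
    Matrix.invertibleOfIsUnitDet _ (isUnit_iff_ne_zero.2 (by rw [h3]; exact one_ne_zero))
  have h5 := Matrix.det_fromBlocks₁₁ G (Φ * D) Ψ (1 + U * D)
  rw [Matrix.det_fromBlocks₂₂, h3, one_mul] at h5
  have h6 : Φ * D * ⅟(1 + U * D) * Ψ = Φ * D * Θ := by
    rw [h2, Matrix.mul_assoc (Φ * D), ← Matrix.mul_assoc _ _ Θ, invOf_mul_self, Matrix.one_mul]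
  rw [h6, Matrix.invOf_eq_nonsing_inv] at h5
  rw [← h5, h1, add_sub_cancel_right]

end EynardMehta

/-! ### Correlations of ensembles of bounded height -/

section InclusionExclusion

/-- Inclusion–exclusion for determinants. -/
theorem det_eq_sum_neg_one_pow_mul_det {n : ℕ} (K : Matrix (Fin n) (Fin n) ℂ) :
    K.det = ∑ t : Finset (Fin n), (-1) ^ t.card *
      (1 - Matrix.diagonal (fun r => if r ∈ t then (1 : ℂ) else 0) * K).det := by
  classical
  have h := (Matrix.detRowAlternating (R := ℂ) (n := Fin n)).toMultilinearMap.map_add_univ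
    (fun r => (K - 1 : Matrix (Fin n) (Fin n) ℂ) r) (fun r => (1 : Matrix (Fin n) (Fin n) ℂ) r)
  have e : ((fun r => (K - 1 : Matrix (Fin n) (Fin n) ℂ) r) +
      fun r => (1 : Matrix (Fin n) (Fin n) ℂ) r) = K := by
    ext r q
    simp
  rw [e] at h
  refine Eq.trans h (Finset.sum_congr rfl fun t _ => ?_)
  have e2 : Matrix.of (t.piecewise (fun r => (K - 1 : Matrix (Fin n) (Fin n) ℂ) r)
      (fun r => (1 : Matrix (Fin n) (Fin n) ℂ) r)) =
      Matrix.diagonal (fun r => if r ∈ t then (-1 : ℂ) else 1) *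
        (1 - Matrix.diagonal (fun r => if r ∈ t then (1 : ℂ) else 0) * K) := by
    ext r q
    rw [Matrix.diagonal_mul, Matrix.sub_apply, Matrix.diagonal_mul]
    by_cases hr : r ∈ t <;> simp [Finset.piecewise, hr]
  change Matrix.det (Matrix.of (t.piecewise _ _)) = _
  rw [e2, Matrix.det_mul, Matrix.det_diagonal]
  congr 1
  rw [Finset.prod_ite]
  simp

variable {N n : ℕ}

theorem mark_indicator {p : Fin n → ℕ × ℤ} (hinj : Function.Injective p) (t : Finset (Fin n))
    (s : ℕ) (x : ℤ) [Decidable (∃ r ∈ t, p r = (s, x))] :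
    mark p (fun r => if r ∈ t then (1 : ℂ) else 0) s x =
      if ∃ r ∈ t, p r = (s, x) then 0 else 1 := by
  unfold mark
  split_ifs with h
  · obtain ⟨r, hr, hpr⟩ := h
    rw [Finset.sum_eq_single r]
    · simp [hpr, hr]
    · intro q _ hq
      rw [if_neg]
      exact fun e => hq (hinj (e.trans hpr.symm))
    · simp
  · rw [Finset.sum_eq_zero, sub_zero]
    intro r _
    by_cases h1 : p r = (s, x)
    · rw [if_pos h1]
      exact if_neg fun h2 => h ⟨r, h2, h1⟩
    · rw [if_neg h1]

open Classical in
/-- The indicator of passing through all the marked points, by inclusion–exclusion over the sets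
of avoided points. -/
theorem indicator_passesThrough {p : Fin n → ℕ × ℤ} (hinj : Function.Injective p)
    (x : Fin N → Fin (2 * N + 1) → ℤ) :
    (if ∀ r, PassesThrough x (p r).1 (p r).2 then (1 : ℂ) else 0) =
      ∑ t : Finset (Fin n), (-1) ^ t.card * ∏ i, ∏ m : Fin (2 * N + 1),
        mark p (fun r => if r ∈ t then (1 : ℂ) else 0) m (x i m) := by
  have h1 : (if ∀ r, PassesThrough x (p r).1 (p r).2 then (1 : ℂ) else 0) =
      ∏ r, ((-(if PassesThrough x (p r).1 (p r).2 then (0 : ℂ) else 1)) + 1) := by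
    rw [← Finset.prod_const_one (s := (Finset.univ : Finset (Fin n)))]
    have := Finset.prod_ite_zero (s := (Finset.univ : Finset (Fin n)))
      (p := fun r => PassesThrough x (p r).1 (p r).2) (f := fun _ => (1 : ℂ))
    simp only [Finset.mem_univ, forall_const] at this
    rw [← this]
    refine Finset.prod_congr rfl fun r _ => ?_
    split_ifs <;> simp
  rw [h1, Finset.prod_add, Finset.powerset_univ]
  refine Finset.sum_congr rfl fun t _ => ?_
  simp only [Finset.prod_const_one, mul_one]
  rw [Finset.prod_neg]
  congr 1
  have h2 : ∀ r, (if PassesThrough x (p r).1 (p r).2 then (0 : ℂ) else 1) =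
      if ¬ PassesThrough x (p r).1 (p r).2 then 1 else 0 := fun r => by rw [ite_not]
  have h3 : ∀ (i : Fin N) (m : Fin (2 * N + 1)),
      mark p (fun r => if r ∈ t then (1 : ℂ) else 0) m (x i m) =
      if ¬ ∃ r ∈ t, p r = ((m : ℕ), x i m) then 1 else 0 := fun i m => by
    rw [mark_indicator hinj, ite_not]
  simp only [h2, h3, Finset.prod_ite_zero, Finset.prod_const_one, Finset.mem_univ, forall_const]
  refine if_congr ?_ rfl rfl
  constructor
  · rintro h i m ⟨r, hr, e⟩
    exact h r hr ⟨i, m, by rw [e], by rw [e]⟩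
  · rintro h r hr ⟨i, m, e1, e2⟩
    exact h i m ⟨r, hr, Prod.ext e1.symm e2.symm⟩

end InclusionExclusion

section BoundedCorrelation

variable {N n : ℕ} {α β : ℕ → ℂ}

open Classical in
/-- The total weight of the ensembles of bounded height. -/
theorem sum_box_weight {a l : Fin N → ℤ} (ha : StrictMono a) (hl : StrictMono l)
    (M : ℕ) (haM : ∀ i, a i ∈ Finset.Icc (-(M : ℤ)) M) :
    ∑ x ∈ box N M, (if IsPathEnsemble N a l x then weight N α β x else 0) =
      (endMatrix (Finset.Icc (-(M : ℤ)) M) (step N α β) (2 * N) a l).det := by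
  have h := sum_box_eq_det (α := α) (β := β) (fun _ _ => 1) ha hl M haM
  have e : decoratedStep N α β (fun _ _ => 1) = step N α β := by
    ext s x y
    simp [decoratedStep]
  rw [e] at h
  simpa [endMatrix, trans] using h

open Classical in
/-- The Eynard–Mehta theorem for ensembles of bounded height. -/
theorem sum_box_passesThrough {a l : Fin N → ℤ} (ha : StrictMono a) (hl : StrictMono l)
    (M : ℕ) (haM : ∀ i, a i ∈ Finset.Icc (-(M : ℤ)) M)
    (hG : (endMatrix (Finset.Icc (-(M : ℤ)) M) (step N α β) (2 * N) a l).det ≠ 0)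
    {p : Fin n → ℕ × ℤ} (hp : ∀ r, (p r).1 ≤ 2 * N) (hinj : Function.Injective p) :
    ∑ x ∈ box N M, (if IsPathEnsemble N a l x ∧ ∀ r, PassesThrough x (p r).1 (p r).2
        then weight N α β x else 0) =
      (endMatrix (Finset.Icc (-(M : ℤ)) M) (step N α β) (2 * N) a l).det *
        (Matrix.of fun r q => boundedKernel (Finset.Icc (-(M : ℤ)) M) (step N α β) (2 * N) a l
          (p r).1 (p r).2 (p q).1 (p q).2).det := by
  have h1 : ∀ x, (if IsPathEnsemble N a l x ∧ ∀ r, PassesThrough x (p r).1 (p r).2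
        then weight N α β x else 0) = ∑ t : Finset (Fin n), (-1) ^ t.card *
        (if IsPathEnsemble N a l x then weight N α β x * ∏ i, ∏ m : Fin (2 * N + 1),
          mark p (fun r => if r ∈ t then (1 : ℂ) else 0) m (x i m) else 0) := by
    intro x
    by_cases hx : IsPathEnsemble N a l x
    · have := indicator_passesThrough (N := N) hinj x
      simp only [hx, true_and, if_true]
      rw [← mul_one (weight N α β x), ← mul_ite_zero, this, Finset.mul_sum]
      exact Finset.sum_congr rfl fun t _ => by ring
    · simp [hx]
  simp only [h1]
  rw [Finset.sum_comm, det_eq_sum_neg_one_pow_mul_det (Matrix.of _), Finset.mul_sum]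
  refine Finset.sum_congr rfl fun t _ => ?_
  rw [← Finset.mul_sum, sum_box_eq_det _ ha hl M haM, ← Matrix.det_mul_column]
  have := det_marked (Finset.Icc (-(M : ℤ)) M) (step N α β) (2 * N) a l p
    (fun r => if r ∈ t then (1 : ℂ) else 0) hp hinj hG
  simp only [trans, Nat.sub_zero] at this
  have e : decoratedStep N α β (mark p fun r => if r ∈ t then (1 : ℂ) else 0) =
    markedStep (step N α β) p fun r => if r ∈ t then (1 : ℂ) else 0 := rfl
  rw [e]
  simp only [Matrix.of_apply]
  rw [this]
  ring_nf

end BoundedCorrelation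

/-! ### Transition weights as Laurent coefficients -/

section Laurent

open PowerSeries

/-- The coefficients of a power series, extended by zero to negative indices. -/
def intCoeff (A : PowerSeries ℂ) (d : ℤ) : ℂ := if 0 ≤ d then coeff d.toNat A else 0

theorem intCoeff_natCast (A : PowerSeries ℂ) (d : ℕ) : intCoeff A d = coeff d A := by
  simp [intCoeff]

theorem intCoeff_of_neg (A : PowerSeries ℂ) {d : ℤ} (h : d < 0) : intCoeff A d = 0 :=
  if_neg (not_le.2 h)

theorem intCoeff_one (d : ℤ) : intCoeff 1 d = if d = 0 then 1 else 0 := by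
  rcases lt_or_ge d 0 with h | h
  · rw [intCoeff_of_neg _ h, if_neg h.ne]
  · obtain ⟨n, rfl⟩ := Int.eq_ofNat_of_zero_le h
    rw [intCoeff_natCast, coeff_one]
    simp

/-- One-sided convolutions are finite sums, and are not affected by a truncation of the
heights. -/
theorem sum_intCoeff_mul (A B : PowerSeries ℂ) {c d x y : ℤ} (hx : x ∈ Finset.Icc c d)
    (hy : y ∈ Finset.Icc c d) :
    ∑ u ∈ Finset.Icc c d, intCoeff A (u - x) * intCoeff B (y - u) = intCoeff (A * B) (y - x) := by
  rw [Finset.mem_Icc] at hx hy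
  rcases lt_or_ge y x with h | h
  · rw [intCoeff_of_neg _ (by omega)]
    refine Finset.sum_eq_zero fun u _ => ?_
    rcases lt_or_ge u x with h' | h'
    · rw [intCoeff_of_neg A (by omega), zero_mul]
    · rw [intCoeff_of_neg B (by omega), mul_zero]
  · obtain ⟨n, hn⟩ := Int.eq_ofNat_of_zero_le (sub_nonneg.2 h)
    rw [hn, intCoeff_natCast, coeff_mul]
    have hs : Finset.Icc x y ⊆ Finset.Icc c d := Finset.Icc_subset_Icc hx.1 hy.2
    rw [← Finset.sum_subset hs]
    · refine Finset.sum_bij' (fun u _ => ((u - x).toNat, (y - u).toNat))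
        (fun q _ => x + (q.1 : ℤ)) ?_ ?_ ?_ ?_ ?_
      · intro u hu
        rw [Finset.mem_Icc] at hu
        rw [Finset.HasAntidiagonal.mem_antidiagonal]
        omega
      · intro q hq
        rw [Finset.HasAntidiagonal.mem_antidiagonal] at hq
        rw [Finset.mem_Icc]
        omega
      · intro u hu
        rw [Finset.mem_Icc] at hu
        simp only
        omega
      · intro q hq
        rw [Finset.HasAntidiagonal.mem_antidiagonal] at hq
        ext <;> simp only <;> omega
      · intro u hu
        rw [Finset.mem_Icc] at hu
        rw [intCoeff, intCoeff, if_pos (by omega), if_pos (by omega)]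
    · intro u _ hu
      rw [Finset.mem_Icc, not_and_or, not_le, not_le] at hu
      rcases hu with h' | h'
      · rw [intCoeff_of_neg A (by omega), zero_mul]
      · rw [intCoeff_of_neg B (by omega), mul_zero]

/-- The geometric series `∑ a ^ d X ^ d`. -/
def geom (a : ℂ) : PowerSeries ℂ := mk fun d => a ^ d

theorem jump_eq_intCoeff (a : ℂ) (x y : ℤ) : jump a x y = intCoeff (geom a) (y - x) := by
  unfold jump intCoeff geom
  by_cases h : x ≤ y
  · rw [if_pos h, if_pos (by omega), coeff_mk]
    congr 1
    omega
  · rw [if_neg h, if_neg (by omega)]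

variable {N : ℕ} {α β : ℕ → ℂ}

/-- Generating series of the jumps of the steps `s + 1, …, s'`. -/
def jumpSeries (N : ℕ) (α β : ℕ → ℂ) (s s' : ℕ) : PowerSeries ℂ :=
  ∏ n ∈ Finset.Ioc s s', geom (stepParam N α β n)

theorem prod_Ioc_eq_mul {R : Type*} [CommMonoid R] (f : ℕ → R) {s s' : ℕ} (h : s < s') :
    ∏ n ∈ Finset.Ioc s s', f n = f (s + 1) * ∏ n ∈ Finset.Ioc (s + 1) s', f n := by
  have : Finset.Ioc s s' = insert (s + 1) (Finset.Ioc (s + 1) s') := by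
    ext m
    simp only [Finset.mem_Ioc, Finset.mem_insert]
    omega
  rw [this, Finset.prod_insert (by simp)]

theorem trans_up {c d : ℤ} {s s' : ℕ} (h : s ≤ s') (hs' : s' ≤ N) {x y : ℤ}
    (hx : x ∈ Finset.Icc c d) (hy : y ∈ Finset.Icc c d) :
    trans (Finset.Icc c d) (step N α β) s s' x y = intCoeff (jumpSeries N α β s s') (y - x) := by
  induction h using Nat.decreasingInduction generalizing x with
  | self =>
    rw [trans_self, jumpSeries, Finset.Ioc_self, Finset.prod_empty, intCoeff_one]
    exact if_congr (by omega) rfl rfl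
  | of_succ s hs ih =>
    rw [trans_of_lt hs, jumpSeries, prod_Ioc_eq_mul _ hs, ← sum_intCoeff_mul _ _ hx hy]
    refine Finset.sum_congr rfl fun u hu => ?_
    rw [ih hu, step, if_pos (by omega), jump_eq_intCoeff]
    rfl

theorem trans_down {c d : ℤ} {s s' : ℕ} (h : s ≤ s') (hs : N ≤ s) {x y : ℤ}
    (hx : x ∈ Finset.Icc c d) (hy : y ∈ Finset.Icc c d) :
    trans (Finset.Icc c d) (step N α β) s s' x y = intCoeff (jumpSeries N α β s s') (x - y) := by
  revert hs
  induction h using Nat.decreasingInduction generalizing x with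
  | self =>
    intro _
    rw [trans_self, jumpSeries, Finset.Ioc_self, Finset.prod_empty, intCoeff_one]
    exact if_congr (by omega) rfl rfl
  | of_succ s hs ih =>
    intro hN
    rw [trans_of_lt hs, jumpSeries, prod_Ioc_eq_mul _ hs, mul_comm, ← sum_intCoeff_mul _ _ hy hx]
    refine Finset.sum_congr rfl fun u hu => ?_
    rw [ih hu (by omega), step, if_neg (by omega), jump_eq_intCoeff, mul_comm]
    rfl

theorem trans_split {I : Finset ℤ} {T : ℕ → ℤ → ℤ → ℂ} {s s' s'' : ℕ} (h : s ≤ s') (h' : s' ≤ s'')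
    {x : ℤ} (hx : x ∈ I) (y : ℤ) :
    trans I T s s'' x y = ∑ u ∈ I, trans I T s s' x u * trans I T s' s'' u y := by
  induction h using Nat.decreasingInduction generalizing x with
  | self => simp [trans_self, hx]
  | of_succ s hs ih =>
    rw [trans_of_lt (hs.trans_le h')]
    simp only [trans_of_lt hs, Finset.sum_mul]
    rw [Finset.sum_comm]
    refine Finset.sum_congr rfl fun u hu => ?_
    rw [ih hu, Finset.mul_sum]
    exact Finset.sum_congr rfl fun w _ => by ring

/-- `f` is the sum of the absolutely convergent power series `A` on the unit circle. -/
def IsSumOnCircle (A : PowerSeries ℂ) (f : ℂ → ℂ) : Prop :=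
  (Summable fun d => ‖coeff d A‖) ∧ ∀ z : ℂ, ‖z‖ = 1 → HasSum (fun d => coeff d A * z ^ d) (f z)

theorem IsSumOnCircle.mul {A B : PowerSeries ℂ} {f g : ℂ → ℂ} (hA : IsSumOnCircle A f)
    (hB : IsSumOnCircle B g) : IsSumOnCircle (A * B) fun z => f z * g z := by
  refine ⟨?_, fun z hz => ?_⟩
  · simp only [coeff_mul]
    exact summable_norm_sum_mul_antidiagonal_of_summable_norm (f := fun d => coeff d A)
      (g := fun d => coeff d B) hA.1 hB.1
  · have hA' : Summable fun d => ‖coeff d A * z ^ d‖ := by simpa [hz] using hA.1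
    have hB' : Summable fun d => ‖coeff d B * z ^ d‖ := by simpa [hz] using hB.1
    have h1 := tsum_mul_tsum_eq_tsum_sum_antidiagonal_of_summable_norm hA' hB'
    have h2 := (summable_norm_sum_mul_antidiagonal_of_summable_norm hA' hB').of_norm.hasSum
    rw [← h1, (hA.2 z hz).tsum_eq, (hB.2 z hz).tsum_eq] at h2
    have e : (fun d => coeff d (A * B) * z ^ d) = fun n =>
        ∑ kl ∈ Finset.HasAntidiagonal.antidiagonal n,
          coeff kl.1 A * z ^ kl.1 * (coeff kl.2 B * z ^ kl.2) := by
      funext d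
      rw [coeff_mul, Finset.sum_mul]
      refine Finset.sum_congr rfl fun q hq => ?_
      rw [← Finset.HasAntidiagonal.mem_antidiagonal.1 hq, pow_add]
      ring
    rw [e]
    exact h2

theorem isSumOnCircle_geom {a : ℂ} (ha : ‖a‖ < 1) :
    IsSumOnCircle (geom a) fun z => (1 - a * z)⁻¹ := by
  refine ⟨?_, fun z hz => ?_⟩
  · simpa [geom] using summable_geometric_of_lt_one (norm_nonneg a) ha
  · have := hasSum_geometric_of_norm_lt_one (ξ := a * z) (by rw [norm_mul, hz, mul_one]; exact ha)
    simpa [geom, mul_pow] using this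

theorem isSumOnCircle_prod {ι : Type*} (s : Finset ι) (a : ι → ℂ) (ha : ∀ i ∈ s, ‖a i‖ < 1) :
    IsSumOnCircle (∏ i ∈ s, geom (a i)) fun z => ∏ i ∈ s, (1 - a i * z)⁻¹ := by
  classical
  induction s using Finset.induction_on with
  | empty =>
    refine ⟨summable_of_ne_finset_zero (s := {0}) fun d hd => ?_, fun z _ => ?_⟩
    · simp [coeff_one, Finset.notMem_singleton.1 hd]
    · have := hasSum_single (f := fun d => coeff d (1 : PowerSeries ℂ) * z ^ d) 0
        (fun d hd => by simp [coeff_one, hd])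
      simpa using this
  | insert i s hi ih =>
    simp only [Finset.prod_insert hi]
    exact (isSumOnCircle_geom (ha i (Finset.mem_insert_self i s))).mul
      (ih fun j hj => ha j (Finset.mem_insert_of_mem hj))

theorem IsSumOnCircle.hasSum_int {A : PowerSeries ℂ} {f : ℂ → ℂ} (hA : IsSumOnCircle A f)
    {z : ℂ} (hz : ‖z‖ = 1) : HasSum (fun d : ℤ => intCoeff A d * z ^ d) (f z) := by
  refine ((Nat.cast_injective (R := ℤ)).hasSum_iff ?_).1 ?_
  · intro d hd
    rw [intCoeff_of_neg, zero_mul]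
    by_contra h
    exact hd ⟨d.toNat, by omega⟩
  · simpa [Function.comp_def, intCoeff_natCast] using hA.2 z hz

theorem IsSumOnCircle.summable_int {A : PowerSeries ℂ} {f : ℂ → ℂ} (hA : IsSumOnCircle A f) :
    Summable fun d : ℤ => ‖intCoeff A d‖ := by
  refine ((Nat.cast_injective (R := ℤ)).summable_iff ?_).1 ?_
  · intro d hd
    rw [intCoeff_of_neg, norm_zero]
    by_contra h
    exact hd ⟨d.toNat, by omega⟩
  · simpa [Function.comp_def, intCoeff_natCast] using hA.1

/-! ### Integrals over the unit circle -/

theorem unitCircleIntegral_congr {f g : ℂ → ℂ} (h : ∀ z : ℂ, ‖z‖ = 1 → f z = g z) :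
    unitCircleIntegral f = unitCircleIntegral g := by
  unfold unitCircleIntegral
  rw [circleIntegral.integral_congr zero_le_one fun z hz => h z (by simpa using hz)]

theorem unitCircleIntegral_const_mul (a : ℂ) (f : ℂ → ℂ) :
    unitCircleIntegral (fun z => a * f z) = a * unitCircleIntegral f := by
  unfold unitCircleIntegral
  rw [circleIntegral.integral_const_mul]
  ring

theorem unitCircleIntegral_zpow (n : ℤ) :
    unitCircleIntegral (fun z => z ^ n) = if n = -1 then 1 else 0 := by
  unfold unitCircleIntegral
  split_ifs with h
  · subst h
    have := circleIntegral.integral_sub_center_inv (0 : ℂ) (one_ne_zero (α := ℝ))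
    simp only [sub_zero] at this
    simp only [zpow_neg_one, this]
    exact inv_mul_cancel₀ Complex.two_pi_I_ne_zero
  · have := circleIntegral.integral_sub_zpow_of_ne h 0 0 1
    simp only [sub_zero] at this
    rw [this, mul_zero]

/-- Termwise integration of a normally convergent series on the unit circle. -/
theorem hasSum_unitCircleIntegral {ι : Type*} [Countable ι] {F : ι → ℂ → ℂ} {f : ℂ → ℂ}
    {b : ι → ℝ} (hb : Summable b) (hF : ∀ i, ContinuousOn (F i) (Metric.sphere 0 1))
    (hFb : ∀ i z, ‖z‖ = 1 → ‖F i z‖ ≤ b i) (hf : ∀ z, ‖z‖ = 1 → HasSum (fun i => F i z) (f z)) :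
    HasSum (fun i => unitCircleIntegral (F i)) (unitCircleIntegral f) := by
  unfold unitCircleIntegral
  refine HasSum.mul_left _ ?_
  simp only [circleIntegral]
  have hn : ∀ t : ℝ, ‖circleMap 0 1 t‖ = 1 := fun t => by simp
  refine intervalIntegral.hasSum_integral_of_dominated_convergence (fun i _ => b i) ?_ ?_ ?_ ?_ ?_
  · intro i
    have : Continuous fun t => deriv (circleMap 0 1) t • F i (circleMap 0 1 t) := by
      simp only [deriv_circleMap]
      refine Continuous.smul ((continuous_circleMap 0 1).mul continuous_const) ?_
      exact (hF i).comp_continuous (continuous_circleMap 0 1) fun t => by simp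
    exact this.aestronglyMeasurable
  · intro i
    refine Filter.Eventually.of_forall fun t _ => ?_
    simpa [deriv_circleMap] using hFb i _ (hn t)
  · exact Filter.Eventually.of_forall fun t _ => hb
  · exact intervalIntegrable_const
  · exact Filter.Eventually.of_forall fun t _ => (hf _ (hn t)).const_smul _

theorem continuousOn_zpow_sphere (n : ℤ) :
    ContinuousOn (fun z : ℂ => z ^ n) (Metric.sphere 0 1) := by
  refine ContinuousOn.zpow₀ continuousOn_id n fun z hz => Or.inl ?_
  rintro rfl
  simp at hz

/-- The integral of a power series against a continuous function, term by term. -/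
theorem IsSumOnCircle.hasSum_integral_mul {A : PowerSeries ℂ} {f h : ℂ → ℂ}
    (hA : IsSumOnCircle A f) (hh : ContinuousOn h (Metric.sphere 0 1)) :
    HasSum (fun d : ℤ => intCoeff A d * unitCircleIntegral fun z => z ^ d * h z)
      (unitCircleIntegral fun z => f z * h z) := by
  obtain ⟨C, hC⟩ := (isCompact_sphere (0 : ℂ) 1).exists_bound_of_continuousOn hh
  have := hasSum_unitCircleIntegral (F := fun (d : ℤ) z => intCoeff A d * (z ^ d * h z))
    (f := fun z => f z * h z) (b := fun d => ‖intCoeff A d‖ * C) (hA.summable_int.mul_right C)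
    (fun d => continuousOn_const.mul ((continuousOn_zpow_sphere d).mul hh))
    (fun d z hz => by
      rw [norm_mul, norm_mul, norm_zpow, hz, one_zpow, one_mul]
      exact mul_le_mul_of_nonneg_left (hC z (by simpa using hz)) (norm_nonneg _))
    (fun z hz => by simpa only [mul_assoc] using (hA.hasSum_int hz).mul_right (h z))
  simpa only [unitCircleIntegral_const_mul] using this

/-- Cauchy's formula for the coefficients. -/
theorem IsSumOnCircle.integral_mul_zpow {A : PowerSeries ℂ} {f : ℂ → ℂ} (hA : IsSumOnCircle A f)
    (m : ℤ) : unitCircleIntegral (fun z => f z * z ^ m) = intCoeff A (-m - 1) := by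
  refine (hA.hasSum_integral_mul (continuousOn_zpow_sphere m)).unique ?_
  have h : ∀ d : ℤ, (intCoeff A d * unitCircleIntegral fun z => z ^ d * z ^ m) =
      if d = -m - 1 then intCoeff A d else 0 := by
    intro d
    rw [unitCircleIntegral_congr (g := fun z => z ^ (d + m)), unitCircleIntegral_zpow]
    · rw [mul_ite, mul_one, mul_zero]
      exact if_congr (by omega) rfl rfl
    · intro z hz
      rw [zpow_add₀]
      rintro rfl
      simp at hz
  simp only [h]
  simpa using hasSum_single (f := fun d : ℤ => if d = -m - 1 then intCoeff A d else 0) (-m - 1)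
    fun d hd => if_neg hd

end Laurent

/-! ### Removal of the bound on the heights -/

section Limits

open Filter Topology

theorem one_sub_mul_ne_zero {a z : ℂ} (ha : ‖a‖ < 1) (hz : ‖z‖ ≤ 1) : 1 - a * z ≠ 0 := by
  intro h
  have h1 : a * z = 1 := (sub_eq_zero.1 h).symm
  have h2 : ‖a‖ * ‖z‖ = 1 := by rw [← norm_mul, h1, norm_one]
  nlinarith [norm_nonneg a, norm_nonneg z]

theorem continuousOn_prod_inv {ι : Type*} (s : Finset ι) (a : ι → ℂ) (ha : ∀ i ∈ s, ‖a i‖ < 1)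
    {S : Set ℂ} {w : ℂ → ℂ} (hw : ContinuousOn w S) (hw1 : ∀ z ∈ S, ‖w z‖ ≤ 1) :
    ContinuousOn (fun z => ∏ i ∈ s, (1 - a i * w z)⁻¹) S :=
  continuousOn_finsetProd s fun i hi => ContinuousOn.inv₀
    (continuousOn_const.sub (continuousOn_const.mul hw))
    fun z hz => one_sub_mul_ne_zero (ha i hi) (hw1 z hz)

theorem continuousOn_inv_sphere : ContinuousOn (fun z : ℂ => z⁻¹) (Metric.sphere 0 1) := by
  simpa using continuousOn_zpow_sphere (-1)

theorem ne_zero_of_norm_eq_one {z : ℂ} (hz : ‖z‖ = 1) : z ≠ 0 := by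
  rintro rfl
  simp at hz

/-- Cauchy's formula for the coefficients of a power series in `z⁻¹`. -/
theorem IsSumOnCircle.integral_inv_mul_zpow {B : PowerSeries ℂ} {g : ℂ → ℂ}
    (hB : IsSumOnCircle B g) (m : ℤ) :
    unitCircleIntegral (fun z => g z⁻¹ * z ^ m) = intCoeff B (m + 1) := by
  have h := hasSum_unitCircleIntegral (F := fun (e : ℤ) z => intCoeff B e * z ^ (m - e))
    (f := fun z => g z⁻¹ * z ^ m) hB.summable_int
    (fun e => continuousOn_const.mul (continuousOn_zpow_sphere _))
    (fun e z hz => by rw [norm_mul, norm_zpow, hz, one_zpow, mul_one])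
    (fun z hz => by
      have h0 := ne_zero_of_norm_eq_one hz
      have := (hB.hasSum_int (z := z⁻¹) (by simp [hz])).mul_right (z ^ m)
      have e : (fun e : ℤ => intCoeff B e * z ^ (m - e)) =
          fun e => intCoeff B e * z⁻¹ ^ e * z ^ m := by
        funext e
        rw [inv_zpow', mul_assoc, ← zpow_add₀ h0]
        congr 2
        ring
      rw [e]
      exact this)
  refine h.unique ?_
  have h2 : ∀ e : ℤ, (unitCircleIntegral fun z => intCoeff B e * z ^ (m - e)) =
      if e = m + 1 then intCoeff B e else 0 := by
    intro e
    rw [unitCircleIntegral_const_mul, unitCircleIntegral_zpow, mul_ite, mul_one, mul_zero]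
    exact if_congr (by omega) rfl rfl
  simp only [h2]
  simpa using hasSum_single (f := fun e : ℤ => if e = m + 1 then intCoeff B e else 0) (m + 1)
    fun e he => if_neg he

variable {N : ℕ} {α β : ℕ → ℂ} {a l : Fin N → ℤ}

theorem norm_stepParam_lt_one (hα : ∀ j ∈ Finset.Icc 1 N, ‖α j‖ < 1)
    (hβ : ∀ j ∈ Finset.Icc 1 N, ‖β j‖ < 1) {n : ℕ} (hn : n ∈ Finset.Ioc 0 (2 * N)) :
    ‖stepParam N α β n‖ < 1 := by
  rw [Finset.mem_Ioc] at hn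
  unfold stepParam
  split_ifs with h
  · exact hα n (by rw [Finset.mem_Icc]; omega)
  · exact hβ _ (by rw [Finset.mem_Icc]; omega)

theorem transitionGF_of_le {n : ℕ} (h : n ≤ N) (z : ℂ) :
    transitionGF N α β n z = (1 - stepParam N α β n * z)⁻¹ := by
  rw [transitionGF, stepParam, if_pos h, if_pos h]

theorem transitionGF_of_lt {n : ℕ} (h : N < n) (z : ℂ) :
    transitionGF N α β n z = (1 - stepParam N α β n * z⁻¹)⁻¹ := by
  rw [transitionGF, stepParam, if_neg (not_le.2 h), if_neg (not_le.2 h), div_eq_mul_inv]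

theorem eventually_mem_Icc (x : ℤ) :
    ∀ᶠ M : ℕ in atTop, x ∈ Finset.Icc (-(M : ℤ)) M := by
  filter_upwards [eventually_ge_atTop x.natAbs] with M hM
  rw [Finset.mem_Icc]
  omega

/-- Transition weights on the lines `0, …, N` are contour integrals. -/
theorem trans_up_eq_integral (hα : ∀ j ∈ Finset.Icc 1 N, ‖α j‖ < 1)
    (hβ : ∀ j ∈ Finset.Icc 1 N, ‖β j‖ < 1) {c d : ℤ} {s s' : ℕ} (h : s ≤ s') (hs' : s' ≤ N)
    {x y : ℤ} (hx : x ∈ Finset.Icc c d) (hy : y ∈ Finset.Icc c d) :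
    trans (Finset.Icc c d) (step N α β) s s' x y = unitCircleIntegral fun z =>
      (∏ n ∈ Finset.Ioc s s', transitionGF N α β n z) * z ^ (x - y - 1) := by
  have hS := isSumOnCircle_prod (Finset.Ioc s s') (stepParam N α β) fun n hn =>
    norm_stepParam_lt_one hα hβ (Finset.Ioc_subset_Ioc (Nat.zero_le s) (by omega) hn)
  rw [trans_up h hs' hx hy, jumpSeries, unitCircleIntegral_congr (g := fun z =>
    (∏ n ∈ Finset.Ioc s s', (1 - stepParam N α β n * z)⁻¹) * z ^ (x - y - 1)),
    hS.integral_mul_zpow]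
  · congr 1
    ring
  · intro z _
    congr 1
    refine Finset.prod_congr rfl fun n hn => transitionGF_of_le ?_ z
    exact (Finset.mem_Ioc.1 hn).2.trans hs'

/-- The weights of the paths to line `2 * N` converge to contour integrals as the bound on the
heights is removed. -/
theorem tendsto_trans (hα : ∀ j ∈ Finset.Icc 1 N, ‖α j‖ < 1)
    (hβ : ∀ j ∈ Finset.Icc 1 N, ‖β j‖ < 1) {s : ℕ} (hs : s ≤ N) (x y : ℤ) :
    Tendsto (fun M : ℕ => trans (Finset.Icc (-(M : ℤ)) M) (step N α β) s (2 * N) x y) atTop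
      (𝓝 (unitCircleIntegral fun z =>
        (∏ n ∈ Finset.Ioc s (2 * N), transitionGF N α β n z) * z ^ (x - y - 1))) := by
  have hA1 : ∀ n ∈ Finset.Ioc s N, ‖stepParam N α β n‖ < 1 := fun n hn =>
    norm_stepParam_lt_one hα hβ (Finset.Ioc_subset_Ioc (Nat.zero_le s) (by omega) hn)
  have hB1 : ∀ n ∈ Finset.Ioc N (2 * N), ‖stepParam N α β n‖ < 1 := fun n hn =>
    norm_stepParam_lt_one hα hβ (Finset.Ioc_subset_Ioc (Nat.zero_le N) le_rfl hn)
  have hA := isSumOnCircle_prod _ _ hA1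
  have hB := isSumOnCircle_prod _ _ hB1
  have hcont : ContinuousOn (fun z : ℂ => (∏ n ∈ Finset.Ioc N (2 * N),
      (1 - stepParam N α β n * z⁻¹)⁻¹) * z ^ (x - y - 1)) (Metric.sphere 0 1) :=
    (continuousOn_prod_inv _ _ hB1 continuousOn_inv_sphere
      fun z hz => by simp [mem_sphere_zero_iff_norm.1 hz]).mul (continuousOn_zpow_sphere _)
  have h1 := hA.hasSum_integral_mul hcont
  have h2 : ∀ d : ℤ, (unitCircleIntegral fun z => z ^ d * ((∏ n ∈ Finset.Ioc N (2 * N),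
      (1 - stepParam N α β n * z⁻¹)⁻¹) * z ^ (x - y - 1))) =
      intCoeff (jumpSeries N α β N (2 * N)) (d + x - y) := by
    intro d
    rw [unitCircleIntegral_congr (g := fun z => (∏ n ∈ Finset.Ioc N (2 * N),
      (1 - stepParam N α β n * z⁻¹)⁻¹) * z ^ (d + x - y - 1)), hB.integral_inv_mul_zpow]
    · rw [sub_add_cancel, jumpSeries]
    · intro z hz
      rw [show d + x - y - 1 = d + (x - y - 1) by ring, zpow_add₀ (ne_zero_of_norm_eq_one hz)]
      ring
  simp only [h2] at h1
  -- sum over the height `u = x + d` on line `N`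
  have h3 := ((Equiv.subRight x).hasSum_iff (f := fun d : ℤ =>
    intCoeff (∏ n ∈ Finset.Ioc s N, geom (stepParam N α β n)) d *
      intCoeff (jumpSeries N α β N (2 * N)) (d + x - y))).2 h1
  have h4 := h3.comp Finset.tendsto_Icc_neg
  have h5 : unitCircleIntegral (fun z =>
        (∏ n ∈ Finset.Ioc s (2 * N), transitionGF N α β n z) * z ^ (x - y - 1)) =
      unitCircleIntegral fun z => (∏ n ∈ Finset.Ioc s N, (1 - stepParam N α β n * z)⁻¹) *
        ((∏ n ∈ Finset.Ioc N (2 * N), (1 - stepParam N α β n * z⁻¹)⁻¹) * z ^ (x - y - 1)) := by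
    refine unitCircleIntegral_congr fun z _ => ?_
    rw [← mul_assoc]
    congr 1
    have hun : Finset.Ioc s (2 * N) = Finset.Ioc s N ∪ Finset.Ioc N (2 * N) :=
      (Finset.Ioc_union_Ioc_eq_Ioc hs (by omega)).symm
    rw [hun, Finset.prod_union]
    · congr 1
      · exact Finset.prod_congr rfl fun n hn => transitionGF_of_le (Finset.mem_Ioc.1 hn).2 z
      · exact Finset.prod_congr rfl fun n hn => transitionGF_of_lt (Finset.mem_Ioc.1 hn).1 z
    · rw [Finset.disjoint_left]
      intro n hn hn'
      rw [Finset.mem_Ioc] at hn hn'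
      omega
  rw [h5]
  refine h4.congr' ?_
  filter_upwards [eventually_mem_Icc x, eventually_mem_Icc y] with M hx hy
  rw [trans_split hs (by omega) hx]
  refine Finset.sum_congr rfl fun u hu => ?_
  rw [trans_up hs le_rfl hx hu, trans_down (by omega) le_rfl hu hy]
  simp [jumpSeries]

theorem gram_apply (i j : Fin N) : gram N a l α β i j = unitCircleIntegral fun z =>
    (∏ n ∈ Finset.Ioc 0 (2 * N), transitionGF N α β n z) * z ^ (a i - l j - 1) := by
  rw [gram, Matrix.of_apply]
  refine unitCircleIntegral_congr fun z hz => ?_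
  rw [← zpow_sub₀ (ne_zero_of_norm_eq_one hz), sub_add_eq_sub_sub]
  rfl

theorem tendsto_endMatrix (hα : ∀ j ∈ Finset.Icc 1 N, ‖α j‖ < 1)
    (hβ : ∀ j ∈ Finset.Icc 1 N, ‖β j‖ < 1) (a l : Fin N → ℤ) :
    Tendsto (fun M : ℕ => endMatrix (Finset.Icc (-(M : ℤ)) M) (step N α β) (2 * N) a l) atTop
      (𝓝 (gram N a l α β)) := by
  refine tendsto_pi_nhds.2 fun i => tendsto_pi_nhds.2 fun j => ?_
  rw [gram_apply]
  exact tendsto_trans hα hβ (Nat.zero_le N) (a i) (l j)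

theorem tendsto_det_endMatrix (hα : ∀ j ∈ Finset.Icc 1 N, ‖α j‖ < 1)
    (hβ : ∀ j ∈ Finset.Icc 1 N, ‖β j‖ < 1) (a l : Fin N → ℤ) :
    Tendsto (fun M : ℕ => (endMatrix (Finset.Icc (-(M : ℤ)) M) (step N α β) (2 * N) a l).det) atTop
      (𝓝 (gram N a l α β).det) :=
  ((continuous_id.matrix_det).tendsto _).comp (tendsto_endMatrix hα hβ a l)

theorem tendsto_inv_endMatrix (hα : ∀ j ∈ Finset.Icc 1 N, ‖α j‖ < 1)
    (hβ : ∀ j ∈ Finset.Icc 1 N, ‖β j‖ < 1) (hG : (gram N a l α β).det ≠ 0) :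
    Tendsto (fun M : ℕ => (endMatrix (Finset.Icc (-(M : ℤ)) M) (step N α β) (2 * N) a l)⁻¹) atTop
      (𝓝 (gram N a l α β)⁻¹) := by
  simp only [Matrix.inv_def, Ring.inverse_eq_inv']
  refine ((tendsto_det_endMatrix hα hβ a l).inv₀ hG).smul ?_
  exact ((continuous_id.matrix_adjugate).tendsto _).comp (tendsto_endMatrix hα hβ a l)

theorem tendsto_boundedKernel (hα : ∀ j ∈ Finset.Icc 1 N, ‖α j‖ < 1)
    (hβ : ∀ j ∈ Finset.Icc 1 N, ‖β j‖ < 1) (hG : (gram N a l α β).det ≠ 0) {s₁ s₂ : ℕ}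
    (hs₁ : s₁ ≤ N) (hs₂ : s₂ ≤ N) (x₁ x₂ : ℤ) :
    Tendsto (fun M : ℕ => boundedKernel (Finset.Icc (-(M : ℤ)) M) (step N α β) (2 * N) a l
      s₁ x₁ s₂ x₂) atTop (𝓝 (kernel N a l α β s₁ x₁ s₂ x₂)) := by
  unfold boundedKernel kernel
  refine Tendsto.add (Tendsto.neg ?_) (tendsto_finsetSum _ fun i _ =>
    tendsto_finsetSum _ fun j _ => Tendsto.mul (Tendsto.mul ?_ ?_) ?_)
  · split_ifs with h
    · refine tendsto_const_nhds.congr' ?_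
      filter_upwards [eventually_mem_Icc x₁, eventually_mem_Icc x₂] with M h₁ h₂
      rw [trans_up_eq_integral hα hβ h.le hs₁ h₂ h₁]
      refine unitCircleIntegral_congr fun z hz => ?_
      rw [div_eq_mul_inv, ← zpow_neg]
      congr 2
      ring
    · exact tendsto_const_nhds
  · exact tendsto_pi_nhds.1 (tendsto_pi_nhds.1 (tendsto_inv_endMatrix hα hβ hG) j) i
  · refine tendsto_const_nhds.congr' ?_
    filter_upwards [eventually_mem_Icc x₁, eventually_mem_Icc (a i)] with M h₁ h₂
    rw [trans_up_eq_integral hα hβ (Nat.zero_le _) hs₁ h₂ h₁]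
    refine unitCircleIntegral_congr fun z hz => ?_
    rw [sub_sub, zpow_sub₀ (ne_zero_of_norm_eq_one hz), mul_comm (z ^ a i), mul_div_assoc]
    rfl
  · have := tendsto_trans hα hβ hs₂ x₂ (l j)
    convert this using 2
    refine unitCircleIntegral_congr fun z hz => ?_
    rw [sub_sub, zpow_sub₀ (ne_zero_of_norm_eq_one hz), mul_div_assoc]

/-- The family of nonintersecting ensembles is absolutely summable: the partial sums are bounded
by the determinants of the model with parameters `|α j|`, `|β j|`, which converge. -/
theorem summable_weight (hα : ∀ j ∈ Finset.Icc 1 N, ‖α j‖ < 1)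
    (hβ : ∀ j ∈ Finset.Icc 1 N, ‖β j‖ < 1) (ha : StrictMono a) (hl : StrictMono l) :
    Summable fun x => Set.indicator {x | IsPathEnsemble N a l x} (fun x => ‖weight N α β x‖) x := by
  classical
  set α' : ℕ → ℂ := fun j => (‖α j‖ : ℂ) with hα'
  set β' : ℕ → ℂ := fun j => (‖β j‖ : ℂ) with hβ'
  have hw : ∀ x, weight N α' β' x = (‖weight N α β x‖ : ℂ) := by
    intro x
    simp only [weight, norm_prod, norm_pow, Complex.ofReal_prod, Complex.ofReal_pow]
    refine Finset.prod_congr rfl fun i _ => Finset.prod_congr rfl fun n _ => ?_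
    congr 1
    simp only [stepParam, hα', hβ']
    split_ifs <;> rfl
  have hlim := tendsto_det_endMatrix (α := α') (β := β') (N := N)
    (fun j hj => by simpa [hα'] using hα j hj) (fun j hj => by simpa [hβ'] using hβ j hj) a l
  obtain ⟨C, hC⟩ := hlim.norm.bddAbove_range
  refine summable_of_sum_le (c := C) (fun x => ?_) fun u => ?_
  · exact Set.indicator_nonneg (fun _ _ => norm_nonneg _) _
  · have hbox : ∀ᶠ M : ℕ in atTop, u ⊆ box N M := by
      have : ∀ x ∈ u, ∀ᶠ M : ℕ in atTop, x ∈ box N M := by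
        intro x _
        simp only [box, Fintype.mem_piFinset, eventually_all]
        exact fun i m => eventually_mem_Icc _
      simpa only [Finset.subset_iff] using (u.eventually_all (l := atTop)
        (p := fun x (M : ℕ) => x ∈ box N M)).2 this
    obtain ⟨M, hM, haM⟩ :=
      (hbox.and (eventually_all.2 fun i => eventually_mem_Icc (a i))).exists
    have hnn : ∀ x, 0 ≤ Set.indicator {x | IsPathEnsemble N a l x}
        (fun x => ‖weight N α β x‖) x :=
      fun x => Set.indicator_nonneg (fun _ _ => norm_nonneg _) x
    have h1 := sum_box_weight (α := α') (β := β') ha hl M haM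
    have h2 : ((∑ x ∈ box N M, Set.indicator {x | IsPathEnsemble N a l x}
        (fun x => ‖weight N α β x‖) x : ℝ) : ℂ) =
        (endMatrix (Finset.Icc (-(M : ℤ)) M) (step N α' β') (2 * N) a l).det := by
      rw [← h1, Complex.ofReal_sum]
      refine Finset.sum_congr rfl fun x _ => ?_
      simp only [Set.indicator_apply, Set.mem_ofPred_eq, hw]
      split_ifs <;> simp
    calc _ ≤ ∑ x ∈ box N M, Set.indicator {x | IsPathEnsemble N a l x}
          (fun x => ‖weight N α β x‖) x :=
          Finset.sum_le_sum_of_subset_of_nonneg hM fun x _ _ => hnn x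
      _ = ‖((∑ x ∈ box N M, Set.indicator {x | IsPathEnsemble N a l x}
          (fun x => ‖weight N α β x‖) x : ℝ) : ℂ)‖ := by
          rw [Complex.norm_real, Real.norm_of_nonneg (Finset.sum_nonneg fun x _ => hnn x)]
      _ ≤ C := by
          rw [h2]
          exact hC ⟨M, rfl⟩

theorem summable_indicator_weight (hα : ∀ j ∈ Finset.Icc 1 N, ‖α j‖ < 1)
    (hβ : ∀ j ∈ Finset.Icc 1 N, ‖β j‖ < 1) (ha : StrictMono a) (hl : StrictMono l)
    (A : (Fin N → Fin (2 * N + 1) → ℤ) → Prop) :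
    Summable (Set.indicator {x | IsPathEnsemble N a l x ∧ A x} (weight N α β)) := by
  refine Summable.of_norm_bounded (summable_weight hα hβ ha hl) fun x => ?_
  rw [norm_indicator_eq_indicator_norm]
  exact Set.indicator_le_indicator_of_subset (fun x hx => hx.1) (fun _ => norm_nonneg _) x

theorem tendsto_box : Tendsto (box N) atTop atTop := by
  refine tendsto_atTop_finset_of_monotone (fun M M' h => ?_) fun x => ?_
  · exact Fintype.piFinset_subset _ _ fun _ => Fintype.piFinset_subset _ _ fun _ =>
      Finset.Icc_subset_Icc (by omega) (by omega)
  · have : ∀ᶠ M : ℕ in atTop, x ∈ box N M := by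
      simp only [box, Fintype.mem_piFinset, eventually_all]
      exact fun i m => eventually_mem_Icc _
    exact this.exists

open Classical in
/-- Total weights are limits of the total weights of ensembles of bounded height. -/
theorem tendsto_sum_box (hα : ∀ j ∈ Finset.Icc 1 N, ‖α j‖ < 1)
    (hβ : ∀ j ∈ Finset.Icc 1 N, ‖β j‖ < 1) (ha : StrictMono a) (hl : StrictMono l)
    (A : (Fin N → Fin (2 * N + 1) → ℤ) → Prop) :
    Tendsto (fun M : ℕ => ∑ x ∈ box N M, if IsPathEnsemble N a l x ∧ A x then weight N α β x else 0)
      atTop (𝓝 (totalWeight N a l α β A)) := by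
  have h1 : totalWeight N a l α β A =
      ∑' x, Set.indicator {x | IsPathEnsemble N a l x ∧ A x} (weight N α β) x :=
    tsum_subtype {x | IsPathEnsemble N a l x ∧ A x} (weight N α β)
  have h2 := summable_indicator_weight hα hβ ha hl A
  rw [h1]
  have h3 := h2.hasSum.comp tendsto_box
  refine h3.congr fun M => Finset.sum_congr rfl fun x _ => ?_
  rw [Set.indicator_apply]
  rfl

/-- The partition function is the determinant of the Gram matrix. -/
theorem partitionFunction_eq_det (hα : ∀ j ∈ Finset.Icc 1 N, ‖α j‖ < 1)
    (hβ : ∀ j ∈ Finset.Icc 1 N, ‖β j‖ < 1) (ha : StrictMono a) (hl : StrictMono l) :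
    partitionFunction N a l α β = (gram N a l α β).det := by
  classical
  refine tendsto_nhds_unique ((tendsto_sum_box hα hβ ha hl fun _ => True).congr' ?_)
    (tendsto_det_endMatrix hα hβ a l)
  filter_upwards [eventually_all.2 fun i => eventually_mem_Icc (a i)] with M hM
  simp only [and_true]
  exact sum_box_weight ha hl M hM

/-- The Eynard–Mehta theorem on the lines `0, …, N`. -/
theorem correlation_eq_det (hα : ∀ j ∈ Finset.Icc 1 N, ‖α j‖ < 1)
    (hβ : ∀ j ∈ Finset.Icc 1 N, ‖β j‖ < 1) (ha : StrictMono a) (hl : StrictMono l)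
    (hG : (gram N a l α β).det ≠ 0) {n : ℕ} {p : Fin n → ℕ × ℕ} (hinj : Function.Injective p)
    (hp : ∀ r, (p r).1 ≤ N) :
    correlation N a l α β p = (Matrix.of fun r q =>
      kernel N a l α β (p r).1 (p r).2 (p q).1 (p q).2).det := by
  classical
  rw [correlation, partitionFunction_eq_det hα hβ ha hl, div_eq_iff hG,
    mul_comm (Matrix.det _) (gram N a l α β).det]
  have hK : Tendsto (fun M : ℕ => (Matrix.of fun r q =>
      boundedKernel (Finset.Icc (-(M : ℤ)) M) (step N α β) (2 * N) a l
        (p r).1 (p r).2 (p q).1 (p q).2 : Matrix (Fin n) (Fin n) ℂ)) atTop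
      (𝓝 (Matrix.of fun r q => kernel N a l α β (p r).1 (p r).2 (p q).1 (p q).2)) :=
    tendsto_pi_nhds.2 fun r => tendsto_pi_nhds.2 fun q =>
      tendsto_boundedKernel hα hβ hG (hp r) (hp q) _ _
  have hdet := ((continuous_id.matrix_det).tendsto _).comp hK
  have hGlim := tendsto_det_endMatrix hα hβ a l
  refine tendsto_nhds_unique ((tendsto_sum_box hα hβ ha hl fun x =>
    ∀ r, PassesThrough x (p r).1 (p r).2).congr' ?_) (hGlim.mul hdet)
  filter_upwards [eventually_all.2 fun i => eventually_mem_Icc (a i), hGlim.eventually_ne hG]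
    with M hM hM'
  refine Eq.trans (Finset.sum_congr rfl fun x _ => ?_) (sum_box_passesThrough ha hl M hM hM'
    (p := fun r => ((p r).1, ((p r).2 : ℤ))) (fun r => (hp r).trans (by omega)) fun r q h => hinj ?_)
  · congr!
  · simp only [Prod.mk.injEq, Nat.cast_inj] at h
    exact Prod.ext h.1 h.2

end Limits

/-! ### Positivity of the partition function -/

section Positivity

variable {N k : ℕ} {α β : ℕ → ℂ} {l : Fin N → ℤ}

theorem equallySpaced_strictMono (hk : 1 ≤ k) : StrictMono (equallySpaced N k) := by
  intro i j hij
  unfold equallySpaced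
  have : (i : ℕ) < (j : ℕ) := hij
  exact mul_lt_mul_of_pos_left (by exact_mod_cast this) (by exact_mod_cast hk)

theorem finish_le_start (hk : 1 ≤ k) (hl : StrictMono l) (hlN : ∀ j, l j ≤ (N : ℤ) - 1)
    (i : Fin N) : l i ≤ equallySpaced N k i := by
  have key : ∀ d : ℕ, ∀ h : (i : ℕ) + d < N, l i + d ≤ l ⟨i + d, h⟩ := by
    intro d
    induction d with
    | zero => intro h; simp
    | succ d ih =>
      intro h
      have h1 := ih (by omega)
      have h2 : l ⟨i + d, by omega⟩ < l ⟨i + (d + 1), h⟩ := hl (Fin.mk_lt_mk.2 (by omega))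
      push_cast
      omega
  have h1 := key (N - 1 - i) (by omega)
  have h2 := hlN ⟨i + (N - 1 - i), by omega⟩
  have h3 : (i : ℤ) ≤ (k : ℤ) * (i : ℕ) :=
    le_mul_of_one_le_left (by positivity) (by exact_mod_cast hk)
  unfold equallySpaced
  omega

/-- The ensemble in which the walkers do not move on the left half, and in which on the right
half walker `i` (from the lowest one up) jumps to its final height in step `N + i + 1`. -/
def oneByOne (N k : ℕ) (l : Fin N → ℤ) (i : Fin N) (m : Fin (2 * N + 1)) : ℤ :=
  if (m : ℕ) ≤ N + i then equallySpaced N k i else l i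

theorem isPathEnsemble_oneByOne (hk : 1 ≤ k) (hl : StrictMono l)
    (hlN : ∀ j, l j ≤ (N : ℤ) - 1) :
    IsPathEnsemble N (equallySpaced N k) l (oneByOne N k l) := by
  have hle := finish_le_start hk hl hlN
  refine ⟨fun i => ?_, fun i => ?_, fun i n hn => ?_, fun i n hn => ?_, fun i j hij n => ?_⟩
  · simp [oneByOne]
  · rw [oneByOne, if_neg (by simp only [Fin.val_last]; omega)]
  · simp only [oneByOne, Fin.val_castSucc, Fin.val_succ]
    rw [if_pos (by omega), if_pos (by omega)]
  · have := hle i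
    simp only [oneByOne, Fin.val_castSucc, Fin.val_succ]
    split_ifs <;> omega
  · wlog hlt : i < j generalizing i j
    · exact (this j i hij.symm (lt_of_le_of_ne (not_lt.1 hlt) hij.symm)).symm
    have h1 := equallySpaced_strictMono (N := N) hk hlt
    have h2 := hl hlt
    have h3 := hle i
    have h4 := hle j
    have h5 : (i : ℕ) < (j : ℕ) := hlt
    rw [Set.disjoint_left]
    intro y hy hy'
    simp only [oneByOne, Fin.val_castSucc, Fin.val_succ, Set.mem_uIcc] at hy hy'
    split_ifs at hy hy' <;> omega

theorem stepParam_nonneg (h : ∀ j ∈ Finset.Icc 1 N, 0 ≤ α j ∧ 0 ≤ β j) (n : Fin (2 * N)) :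
    0 ≤ stepParam N α β (n + 1) := by
  unfold stepParam
  split_ifs
  · exact (h _ (by rw [Finset.mem_Icc]; omega)).1
  · exact (h _ (by rw [Finset.mem_Icc]; omega)).2

theorem partitionFunction_pos (hk : 1 ≤ k) (hα : ∀ j ∈ Finset.Icc 1 N, ‖α j‖ < 1)
    (hβ : ∀ j ∈ Finset.Icc 1 N, ‖β j‖ < 1) (hβ0 : ∀ j ∈ Finset.Icc 1 N, β j ≠ 0)
    (hl : StrictMono l) (hlN : ∀ j, l j ≤ (N : ℤ) - 1)
    (h : ∀ j ∈ Finset.Icc 1 N, 0 ≤ α j ∧ 0 ≤ β j) :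
    0 < partitionFunction N (equallySpaced N k) l α β := by
  have hs : Summable (weight N α β ∘ ((↑) : {x | IsPathEnsemble N (equallySpaced N k) l x ∧
      (fun _ => True) x} → Fin N → Fin (2 * N + 1) → ℤ)) :=
    summable_subtype_iff_indicator.2 (summable_indicator_weight hα hβ
      (equallySpaced_strictMono (N := N) hk) hl fun _ => True)
  refine hs.tsum_pos (fun x => ?_)
    ⟨oneByOne N k l, isPathEnsemble_oneByOne hk hl hlN, trivial⟩ ?_
  · rw [Function.comp_apply, weight]
    exact Finset.prod_nonneg fun i _ => Finset.prod_nonneg fun n _ =>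
      pow_nonneg (stepParam_nonneg h n) _
  · rw [Function.comp_apply, weight]
    refine Finset.prod_pos fun i _ => Finset.prod_pos fun n _ => ?_
    by_cases hn : (n : ℕ) < N
    · simp only [oneByOne, Fin.val_castSucc, Fin.val_succ]
      rw [if_pos (by omega), if_pos (by omega)]
      simp
    · refine pow_pos (lt_of_le_of_ne (stepParam_nonneg h n) ?_) _
      rw [stepParam, if_neg (by omega)]
      exact (hβ0 _ (by rw [Finset.mem_Icc]; omega)).symm

end Positivity

/-! ### Contour integrals of rational functions -/

section Contours

open Polynomial Filter

variable {m : ℕ} {Γ : Fin m → ℝ → ℂ}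

/-- `f` is continuous along the contour `Γ`. -/
def ContinuousAlong (Γ : Fin m → ℝ → ℂ) (f : ℂ → ℂ) : Prop :=
  ∀ i, ContinuousOn (fun t => f (Γ i t)) (Set.Icc 0 1)

theorem IsClosedCurve.intervalIntegrable_mul {γ : ℝ → ℂ} (hγ : IsClosedCurve γ) {f : ℂ → ℂ}
    (hf : ContinuousOn (fun t => f (γ t)) (Set.Icc 0 1)) :
    IntervalIntegrable (fun t => f (γ t) * deriv γ t) MeasureTheory.volume 0 1 := by
  refine hγ.integrable.continuousOn_mul ?_
  rwa [Set.uIcc_of_le zero_le_one]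

theorem contourIntegral_congr {f g : ℂ → ℂ}
    (h : ∀ i, ∀ t ∈ Set.Icc (0 : ℝ) 1, f (Γ i t) = g (Γ i t)) :
    contourIntegral Γ f = contourIntegral Γ g := by
  refine Finset.sum_congr rfl fun i _ => intervalIntegral.integral_congr fun t ht => ?_
  rw [Set.uIcc_of_le zero_le_one] at ht
  simp only [h i t ht]

theorem contourIntegral_const_mul (a : ℂ) (f : ℂ → ℂ) :
    contourIntegral Γ (fun w => a * f w) = a * contourIntegral Γ f := by
  simp only [contourIntegral, Finset.mul_sum, mul_assoc, intervalIntegral.integral_const_mul]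

theorem contourIntegral_add (hΓ : ∀ i, IsClosedCurve (Γ i)) {f g : ℂ → ℂ}
    (hf : ContinuousAlong Γ f) (hg : ContinuousAlong Γ g) :
    contourIntegral Γ (fun w => f w + g w) = contourIntegral Γ f + contourIntegral Γ g := by
  simp only [contourIntegral]
  rw [← Finset.sum_add_distrib]
  refine Finset.sum_congr rfl fun i _ => ?_
  simp only [add_mul]
  exact intervalIntegral.integral_add ((hΓ i).intervalIntegrable_mul (hf i))
    ((hΓ i).intervalIntegrable_mul (hg i))

theorem contourIntegral_sum {ι : Type*} (hΓ : ∀ i, IsClosedCurve (Γ i)) (s : Finset ι)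
    {f : ι → ℂ → ℂ} (hf : ∀ j ∈ s, ContinuousAlong Γ (f j)) :
    contourIntegral Γ (fun w => ∑ j ∈ s, f j w) = ∑ j ∈ s, contourIntegral Γ (f j) := by
  simp only [contourIntegral]
  rw [Finset.sum_comm]
  refine Finset.sum_congr rfl fun i _ => ?_
  simp only [Finset.sum_mul]
  exact intervalIntegral.integral_finsetSum fun j hj => (hΓ i).intervalIntegrable_mul (hf j hj i)

/-- The integral of a function with a primitive along closed curves vanishes. -/
theorem contourIntegral_eq_zero_of_hasDerivAt (hΓ : ∀ i, IsClosedCurve (Γ i)) {F f : ℂ → ℂ}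
    (hF : ∀ i, ∀ t ∈ Set.Icc (0 : ℝ) 1, HasDerivAt F (f (Γ i t)) (Γ i t))
    (hf : ContinuousAlong Γ f) : contourIntegral Γ f = 0 := by
  refine Finset.sum_eq_zero fun i _ => ?_
  obtain ⟨S, hS, hd⟩ := (hΓ i).differentiable
  rw [MeasureTheory.integral_eq_of_hasDerivAt_off_countable_of_le (fun t => F (Γ i t)) _
    zero_le_one hS.countable]
  · simp [(hΓ i).closed]
  · intro t ht
    exact (hF i t ht).continuousAt.comp_continuousWithinAt ((hΓ i).continuousOn t ht)
  · intro t ht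
    exact (hF i t (Set.Ioo_subset_Icc_self ht.1)).comp t (hd t ht).hasDerivAt
  · exact (hΓ i).intervalIntegrable_mul (hf i)

/-- Cauchy's theorem for contours in the unit disc. -/
theorem contourIntegral_eq_zero_of_differentiableOn (hΓ : ∀ i, IsClosedCurve (Γ i))
    (hD : ∀ i, ∀ t ∈ Set.Icc (0 : ℝ) 1, ‖Γ i t‖ < 1) {f : ℂ → ℂ}
    (hf : DifferentiableOn ℂ f (Metric.ball 0 1)) : contourIntegral Γ f = 0 := by
  obtain ⟨F, hF⟩ := hf.isExactOn_ball
  refine contourIntegral_eq_zero_of_hasDerivAt hΓ (F := F)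
    (fun i t ht => hF _ (mem_ball_zero_iff.2 (hD i t ht))) fun i => ?_
  exact hf.continuousOn.comp (hΓ i).continuousOn fun t ht => mem_ball_zero_iff.2 (hD i t ht)

theorem continuousAlong_of_continuous (hΓ : ∀ i, IsClosedCurve (Γ i)) {f : ℂ → ℂ}
    (hf : Continuous f) : ContinuousAlong Γ f :=
  fun i => hf.comp_continuousOn (hΓ i).continuousOn

theorem ContinuousAlong.mul {f g : ℂ → ℂ} (hf : ContinuousAlong Γ f)
    (hg : ContinuousAlong Γ g) : ContinuousAlong Γ fun w => f w * g w :=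
  fun i => (hf i).mul (hg i)

theorem ContinuousAlong.inv {f : ℂ → ℂ} (hf : ContinuousAlong Γ f)
    (h0 : ∀ i, ∀ t ∈ Set.Icc (0 : ℝ) 1, f (Γ i t) ≠ 0) : ContinuousAlong Γ fun w => (f w)⁻¹ :=
  fun i => (hf i).inv₀ (h0 i)

theorem prod_map_sub_ne_zero {s : Multiset ℂ} {w : ℂ} (h : ∀ c ∈ s, w ≠ c) :
    (s.map fun c => w - c).prod ≠ 0 := by
  refine Multiset.prod_ne_zero fun h0 => ?_
  obtain ⟨c, hc, hwc⟩ := Multiset.mem_map.1 h0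
  exact h c hc (sub_eq_zero.1 hwc)

theorem continuous_prod_map_sub (s : Multiset ℂ) :
    Continuous fun w : ℂ => (s.map fun c => w - c).prod :=
  continuous_multiset_prod s fun _ _ => continuous_id.sub continuous_const

theorem continuousAlong_inv_prod (hΓ : ∀ i, IsClosedCurve (Γ i)) {s : Multiset ℂ}
    (h : ∀ c ∈ s, ∀ i, ∀ t ∈ Set.Icc (0 : ℝ) 1, Γ i t ≠ c) :
    ContinuousAlong Γ fun w => ((s.map fun c => w - c).prod)⁻¹ :=
  (continuousAlong_of_continuous hΓ (continuous_prod_map_sub s)).inv fun i t ht =>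
    prod_map_sub_ne_zero fun c hc => h c hc i t ht

/-- If a contour winds equally often around the points of `s`, the integral of
`∏ (w - c)⁻¹` over two or more points vanishes, by partial fractions. -/
theorem contourIntegral_inv_prod (hΓ : ∀ i, IsClosedCurve (Γ i)) {v : ℂ} (s : Multiset ℂ)
    (h : ∀ c ∈ s, ∀ i, ∀ t ∈ Set.Icc (0 : ℝ) 1, Γ i t ≠ c)
    (hv : ∀ c ∈ s, contourIntegral Γ (fun w => (w - c)⁻¹) = v) (hs : 2 ≤ s.card) :
    contourIntegral Γ (fun w => ((s.map fun c => w - c).prod)⁻¹) = 0 := by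
  induction hn : s.card using Nat.strong_induction_on generalizing s with
  | _ n ih =>
  by_cases hne : ∃ b ∈ s, ∃ b' ∈ s, b ≠ b'
  · obtain ⟨b, hb, b', hb', hbb⟩ := hne
    obtain ⟨t, rfl⟩ := Multiset.exists_cons_of_mem hb
    have hb't : b' ∈ t := (Multiset.mem_cons.1 hb').resolve_left hbb.symm
    obtain ⟨u, rfl⟩ := Multiset.exists_cons_of_mem hb't
    have hsub : ∀ c ∈ ({b, b'} : Set ℂ), ∀ d ∈ c ::ₘ u, d ∈ b ::ₘ b' ::ₘ u := by
      intro c hc d hd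
      simp only [Set.mem_insert_iff, Set.mem_singleton_iff, Multiset.mem_cons] at hc hd ⊢
      rcases hd with rfl | hd
      · rcases hc with hc | hc <;> simp [hc]
      · simp [hd]
    have hu : ∀ c ∈ ({b, b'} : Set ℂ), contourIntegral Γ
        (fun w => (((c ::ₘ u).map fun c => w - c).prod)⁻¹) = if u.card = 0 then v else 0 := by
      intro c hc
      split_ifs with hu0
      · rw [Multiset.card_eq_zero] at hu0
        subst hu0
        simpa using hv c (hsub c hc c (Multiset.mem_cons_self _ _))
      · simp only [Multiset.card_cons] at hn
        exact ih (u.card + 1) (by omega) (c ::ₘ u) (fun d hd => h d (hsub c hc d hd))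
          (fun d hd => hv d (hsub c hc d hd))
          (by rw [Multiset.card_cons]; omega) (Multiset.card_cons _ _)
    have hcont : ∀ c ∈ ({b, b'} : Set ℂ), ContinuousAlong Γ
        (fun w => (((c ::ₘ u).map fun c => w - c).prod)⁻¹) := fun c hc =>
      continuousAlong_inv_prod hΓ fun d hd => h d (hsub c hc d hd)
    have key : contourIntegral Γ (fun w => (((b ::ₘ b' ::ₘ u).map fun c => w - c).prod)⁻¹) =
        contourIntegral Γ (fun w => (b - b')⁻¹ * ((((b ::ₘ u).map fun c => w - c).prod)⁻¹ +
          (-1) * (((b' ::ₘ u).map fun c => w - c).prod)⁻¹)) := by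
      refine contourIntegral_congr fun i t ht => ?_
      have h1 : Γ i t - b ≠ 0 := sub_ne_zero.2 (h b hb i t ht)
      have h2 : Γ i t - b' ≠ 0 := sub_ne_zero.2 (h b' hb' i t ht)
      have h3 : b - b' ≠ 0 := sub_ne_zero.2 hbb
      simp only [Multiset.map_cons, Multiset.prod_cons, mul_inv]
      field_simp
      ring
    have hneg : ContinuousAlong Γ
        (fun w => (-1) * (((b' ::ₘ u).map fun c => w - c).prod)⁻¹) :=
      (continuousAlong_of_continuous hΓ continuous_const).mul (hcont b' (by simp))
    rw [key, contourIntegral_const_mul, contourIntegral_add hΓ (hcont b (by simp)) hneg,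
      contourIntegral_const_mul, hu b (by simp), hu b' (by simp)]
    ring
  · push Not at hne
    obtain ⟨b, hb⟩ : ∃ b, b ∈ s := Multiset.card_pos_iff_exists_mem.1 (by omega)
    have hrep : s = Multiset.replicate n b :=
      Multiset.eq_replicate.2 ⟨hn, fun c hc => hne c hc b hb⟩
    have e : (fun w : ℂ => ((s.map fun c => w - c).prod)⁻¹) = fun w => (w - b) ^ (-(n : ℤ)) := by
      funext w
      rw [hrep, Multiset.map_replicate, Multiset.prod_replicate, zpow_neg, zpow_natCast]
    have hcont := continuousAlong_inv_prod hΓ h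
    rw [e] at hcont ⊢
    have hn0 : (1 - (n : ℂ)) ≠ 0 := by
      rw [sub_ne_zero]
      exact_mod_cast (by omega : 1 ≠ n)
    refine contourIntegral_eq_zero_of_hasDerivAt hΓ
      (F := fun w => (1 - (n : ℂ))⁻¹ * (w - b) ^ (1 - (n : ℤ))) (fun i t ht => ?_) hcont
    have h1 : Γ i t - b ≠ 0 := sub_ne_zero.2 (h b hb i t ht)
    have h2 := (((hasDerivAt_zpow (1 - (n : ℤ)) (Γ i t - b) (Or.inl h1)).comp (Γ i t)
      ((hasDerivAt_id (Γ i t)).sub_const b)).const_mul (1 - (n : ℂ))⁻¹)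
    refine h2.congr_deriv ?_
    push_cast
    rw [show (1 : ℤ) - n - 1 = -n by ring]
    field_simp

/-- If a contour winds equally often around all the points of `s`, the integral of
`A / ∏ (w - c)` depends only on the leading coefficient of `A`. -/
theorem contourIntegral_div_prod (hΓ : ∀ i, IsClosedCurve (Γ i)) {v : ℂ} (s : Multiset ℂ)
    (h : ∀ c ∈ s, ∀ i, ∀ t ∈ Set.Icc (0 : ℝ) 1, Γ i t ≠ c)
    (hv : ∀ c ∈ s, contourIntegral Γ (fun w => (w - c)⁻¹) = v) (A : ℂ[X])
    (hA : A.degree < s.card) :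
    contourIntegral Γ (fun w => A.eval w * ((s.map fun c => w - c).prod)⁻¹) =
      v * A.coeff (s.card - 1) := by
  induction s using Multiset.induction generalizing A with
  | empty =>
    have : A = 0 := by
      simpa [Nat.WithBot.lt_zero_iff] using hA
    simp [this, contourIntegral]
  | cons b t ih =>
    have hdiv := modByMonic_add_div A (X - C b)
    rw [modByMonic_X_sub_C_eq_C_eval] at hdiv
    set A₁ := A /ₘ (X - C b) with hA₁
    have h' : ∀ c ∈ t, ∀ i, ∀ t ∈ Set.Icc (0 : ℝ) 1, Γ i t ≠ c :=
      fun c hc => h c (Multiset.mem_cons_of_mem hc)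
    have hv' : ∀ c ∈ t, contourIntegral Γ (fun w => (w - c)⁻¹) = v :=
      fun c hc => hv c (Multiset.mem_cons_of_mem hc)
    have hdeg : A₁.degree < t.card := by
      rcases eq_or_ne A 0 with h0 | h0
      · rw [hA₁, h0, zero_divByMonic, degree_zero]
        exact WithBot.bot_lt_coe _
      · have h1 : A₁.degree < A.degree :=
          degree_divByMonic_lt A _ h0 (by rw [degree_X_sub_C]; exact one_pos)
        have h2 : A.degree ≤ t.card := by
          rw [degree_eq_natDegree h0, Multiset.card_cons] at hA
          rw [degree_eq_natDegree h0]
          exact_mod_cast Nat.lt_succ_iff.1 (by exact_mod_cast hA)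
        exact h1.trans_le h2
    have e : contourIntegral Γ (fun w => A.eval w * (((b ::ₘ t).map fun c => w - c).prod)⁻¹) =
        contourIntegral Γ (fun w => A.eval b * (((b ::ₘ t).map fun c => w - c).prod)⁻¹ +
          A₁.eval w * ((t.map fun c => w - c).prod)⁻¹) := by
      refine contourIntegral_congr fun i u hu => ?_
      have h1 : Γ i u - b ≠ 0 := sub_ne_zero.2 (h b (Multiset.mem_cons_self _ _) i u hu)
      have h2 := congrArg (eval (Γ i u)) hdiv
      simp only [eval_add, eval_C, eval_mul, eval_sub, eval_X] at h2
      simp only [Multiset.map_cons, Multiset.prod_cons, mul_inv]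
      rw [← h2]
      field_simp
    have hc1 : ContinuousAlong Γ (fun w => A.eval b * (((b ::ₘ t).map fun c => w - c).prod)⁻¹) :=
      (continuousAlong_of_continuous hΓ continuous_const).mul (continuousAlong_inv_prod hΓ h)
    have hc2 : ContinuousAlong Γ (fun w => A₁.eval w * ((t.map fun c => w - c).prod)⁻¹) :=
      (continuousAlong_of_continuous hΓ A₁.continuous).mul (continuousAlong_inv_prod hΓ h')
    rw [e, contourIntegral_add hΓ hc1 hc2, contourIntegral_const_mul, ih h' hv' A₁ hdeg,
      Multiset.card_cons, Nat.add_sub_cancel]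
    rcases Nat.eq_zero_or_pos t.card with ht | ht
    · rw [ht] at hdeg
      have hA0 : A₁ = 0 := by simpa [Nat.WithBot.lt_zero_iff] using hdeg
      rw [Multiset.card_eq_zero] at ht
      subst ht
      rw [hA0, mul_zero, add_zero] at hdiv
      have := hv b (Multiset.mem_cons_self _ _)
      simp only [Multiset.cons_zero, Multiset.map_singleton, Multiset.prod_singleton, this, hA0,
        coeff_zero, mul_zero, add_zero, Multiset.card_zero]
      rw [← hdiv]
      simp [mul_comm]
    · rw [contourIntegral_inv_prod hΓ _ h hv (by rw [Multiset.card_cons]; omega), mul_zero,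
        zero_add]
      congr 1
      obtain ⟨n, hn⟩ := Nat.exists_eq_add_of_lt ht
      rw [zero_add] at hn
      rw [hn] at hdeg ⊢
      rw [Nat.add_sub_cancel, ← hdiv, coeff_add, coeff_C_succ, zero_add, sub_mul, coeff_sub,
        coeff_X_mul, coeff_C_mul, coeff_eq_zero_of_degree_lt hdeg]
      ring

/-- If `∮ (w - c)⁻¹ dw` has the same value `v` for all roots `c` of the monic polynomial `p`, and
`deg A < deg p`, the integral of `A / p` is `v` times the coefficient of `A` in degree
`deg p - 1`. -/
theorem contourIntegral_div_monic (hΓ : ∀ i, IsClosedCurve (Γ i)) {v : ℂ} {p : ℂ[X]}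
    (hp : p.Monic) (h : ∀ c, p.IsRoot c → ∀ i, ∀ t ∈ Set.Icc (0 : ℝ) 1, Γ i t ≠ c)
    (hv : ∀ c, p.IsRoot c → contourIntegral Γ (fun w => (w - c)⁻¹) = v) (A : ℂ[X])
    (hA : A.degree < p.degree) :
    contourIntegral Γ (fun w => A.eval w / p.eval w) = v * A.coeff (p.natDegree - 1) := by
  have hsp := IsAlgClosed.splits p
  have hcard : p.roots.card = p.natDegree := hsp.natDegree_eq_card_roots.symm
  have := contourIntegral_div_prod hΓ p.roots (fun c hc => h c (isRoot_of_mem_roots hc))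
    (fun c hc => hv c (isRoot_of_mem_roots hc)) A
    (by rw [hcard, ← degree_eq_natDegree hp.ne_zero]; exact hA)
  rw [hcard] at this
  rw [← this]
  simp only [hsp.eval_eq_prod_roots_of_monic hp, div_eq_mul_inv]

theorem continuousAlong_div (hΓ : ∀ i, IsClosedCurve (Γ i)) {p : ℂ[X]}
    (h : ∀ c, p.IsRoot c → ∀ i, ∀ t ∈ Set.Icc (0 : ℝ) 1, Γ i t ≠ c) (A : ℂ[X]) :
    ContinuousAlong Γ fun w => A.eval w / p.eval w := by
  simp only [div_eq_mul_inv]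
  exact (continuousAlong_of_continuous hΓ A.continuous).mul
    ((continuousAlong_of_continuous hΓ p.continuous).inv fun i t ht h0 => h _ h0 i t ht rfl)

/-- A contour in the unit disc that winds around none of the roots of `p` does not see the poles
of `A / p`. -/
theorem contourIntegral_div_eq_zero (hΓ : ∀ i, IsClosedCurve (Γ i))
    (hD : ∀ i, ∀ t ∈ Set.Icc (0 : ℝ) 1, ‖Γ i t‖ < 1) {p : ℂ[X]}
    (hp : p.Monic) (h : ∀ c, p.IsRoot c → ∀ i, ∀ t ∈ Set.Icc (0 : ℝ) 1, Γ i t ≠ c)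
    (hv : ∀ c, p.IsRoot c → contourIntegral Γ (fun w => (w - c)⁻¹) = 0) (A : ℂ[X]) :
    contourIntegral Γ (fun w => A.eval w / p.eval w) = 0 := by
  have h1 := contourIntegral_div_monic hΓ hp h hv (A %ₘ p) (degree_modByMonic_lt A hp)
  rw [zero_mul] at h1
  have h2 : contourIntegral Γ (fun w => (A /ₘ p).eval w) = 0 :=
    contourIntegral_eq_zero_of_differentiableOn hΓ hD (A /ₘ p).differentiable.differentiableOn
  have e : contourIntegral Γ (fun w => A.eval w / p.eval w) =
      contourIntegral Γ (fun w => (A %ₘ p).eval w / p.eval w + (A /ₘ p).eval w) := by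
    refine contourIntegral_congr fun i t ht => ?_
    have h3 : p.eval (Γ i t) ≠ 0 := fun h0 => h _ h0 i t ht rfl
    conv_lhs => rw [← modByMonic_add_div A p]
    simp only [eval_add, eval_mul]
    field_simp
  rw [e, contourIntegral_add hΓ (continuousAlong_div hΓ h _)
    (continuousAlong_of_continuous hΓ (A /ₘ p).continuous), h1, h2, add_zero]

/-- The image of a closed curve under `w ↦ w ^ k`. -/
theorem IsClosedCurve.pow {γ : ℝ → ℂ} (hγ : IsClosedCurve γ) (k : ℕ) :
    IsClosedCurve (fun t => γ t ^ k) ∧ ∀ᵐ t, t ∈ Set.uIoc (0 : ℝ) 1 →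
      deriv (fun t => γ t ^ k) t = k * γ t ^ (k - 1) * deriv γ t := by
  obtain ⟨S, hS, hd⟩ := hγ.differentiable
  have hae : ∀ᵐ t, t ∈ Set.uIoc (0 : ℝ) 1 →
      deriv (fun t => γ t ^ k) t = k * γ t ^ (k - 1) * deriv γ t := by
    filter_upwards [(hS.insert 1).countable.ae_notMem MeasureTheory.volume] with t ht ht'
    rw [Set.uIoc_of_le zero_le_one] at ht'
    rw [Set.mem_insert_iff, not_or] at ht
    exact ((hd t ⟨⟨ht'.1, lt_of_le_of_ne ht'.2 ht.1⟩, ht.2⟩).hasDerivAt.pow k).deriv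
  refine ⟨⟨hγ.continuousOn.pow k, by simp [hγ.closed], ⟨S, hS, fun t ht => (hd t ht).pow k⟩, ?_⟩,
    hae⟩
  have h1 := hγ.intervalIntegrable_mul (f := fun w => k * w ^ (k - 1))
    (continuousOn_const.mul (hγ.continuousOn.pow _))
  refine h1.congr_ae ?_
  rw [Filter.EventuallyEq, MeasureTheory.ae_restrict_iff' measurableSet_uIoc]
  filter_upwards [hae] with t ht ht'
  exact (ht ht').symm

/-- Substitution `u = w ^ k` in a contour integral. -/
theorem contourIntegral_pow (hΓ : ∀ i, IsClosedCurve (Γ i)) (k : ℕ) (f : ℂ → ℂ) :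
    contourIntegral (fun i t => Γ i t ^ k) f =
      contourIntegral Γ fun w => f (w ^ k) * (k * w ^ (k - 1)) := by
  refine Finset.sum_congr rfl fun i _ => intervalIntegral.integral_congr_ae ?_
  filter_upwards [((hΓ i).pow k).2] with t ht ht'
  rw [ht ht', mul_assoc (f _)]

end Contours

/-! ### Dual polynomials and residue pairings -/

section Duality

open Polynomial

/-- For `Q` of degree `N`, the polynomials `q_i = dualPoly Q i`, `i < N`, with
`(Q(v) - Q(u)) / (v - u) = ∑ v ^ i q_i(u)`: the quotient of `Q` by `X ^ (i + 1)`. -/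
def dualPoly (Q : ℂ[X]) (i : ℕ) : ℂ[X] := divX^[i + 1] Q

theorem coeff_iterate_divX (Q : ℂ[X]) (i n : ℕ) : (divX^[i] Q).coeff n = Q.coeff (n + i) := by
  induction i generalizing n with
  | zero => rfl
  | succ i ih => rw [Function.iterate_succ_apply', coeff_divX, ih]; congr 1; ring

theorem coeff_dualPoly (Q : ℂ[X]) (i n : ℕ) : (dualPoly Q i).coeff n = Q.coeff (n + (i + 1)) :=
  coeff_iterate_divX Q (i + 1) n

theorem eval_sub_eval_eq_sum_dualPoly {Q : ℂ[X]} (hQ : Q.Monic) (u v : ℂ) :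
    Q.eval v - Q.eval u =
      (v - u) * ∑ i ∈ Finset.range Q.natDegree, v ^ i * (dualPoly Q i).eval u := by
  have key : ∀ n : ℕ, (v - u) * ∑ i ∈ Finset.range n, v ^ i * (dualPoly Q i).eval u =
      v ^ n * (divX^[n] Q).eval u - Q.eval u + ∑ i ∈ Finset.range n, Q.coeff i * v ^ i := by
    intro n
    induction n with
    | zero => simp
    | succ n ih =>
      rw [Finset.sum_range_succ, mul_add, ih, Finset.sum_range_succ]
      have h : (divX^[n] Q).eval u = (dualPoly Q n).eval u * u + Q.coeff n := by
        conv_lhs => rw [← divX_mul_X_add (divX^[n] Q)]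
        rw [eval_add, eval_mul, eval_X, eval_C, coeff_iterate_divX, zero_add, dualPoly,
          Function.iterate_succ_apply']
      rw [h, dualPoly]
      ring
  have h1 : divX^[Q.natDegree] Q = 1 := by
    ext n
    rw [coeff_iterate_divX, coeff_one]
    split_ifs with h
    · rw [h, zero_add]
      exact hQ
    · exact coeff_eq_zero_of_natDegree_lt (by omega)
  rw [key, h1, eval_eq_sum_range (p := Q) v, Finset.sum_range_succ, hQ.coeff_natDegree]
  simp
  ring

variable {m : ℕ} {Γ : Fin m → ℝ → ℂ}

/-- The powers `u ^ i` and the dual polynomials are dual to each other for the pairing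
`∮ f g / Q`, along a contour that winds once around each root of `Q`. -/
theorem contourIntegral_dualPoly (hΓ : ∀ i, IsClosedCurve (Γ i))
    (hD : ∀ i, ∀ t ∈ Set.Icc (0 : ℝ) 1, ‖Γ i t‖ < 1) {v : ℂ} {Q : ℂ[X]} (hQ : Q.Monic)
    (h : ∀ c, Q.IsRoot c → ∀ i, ∀ t ∈ Set.Icc (0 : ℝ) 1, Γ i t ≠ c)
    (hv : ∀ c, Q.IsRoot c → contourIntegral Γ (fun w => (w - c)⁻¹) = v) {i j : ℕ}
    (hj : j < Q.natDegree) :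
    contourIntegral Γ (fun u => u ^ j * (dualPoly Q i).eval u / Q.eval u) =
      if i = j then v else 0 := by
  set N := Q.natDegree with hN
  have hdeg : Q.degree = N := degree_eq_natDegree hQ.ne_zero
  have e : (fun u : ℂ => u ^ j * (dualPoly Q i).eval u / Q.eval u) =
      fun u => (X ^ j * dualPoly Q i).eval u / Q.eval u := by
    funext u
    simp
  rw [e]
  rcases le_or_gt j i with hji | hji
  · rw [contourIntegral_div_monic hΓ hQ h hv, coeff_X_pow_mul', if_pos (by omega),
      coeff_dualPoly, ← hN, show N - 1 - j + (i + 1) = N + (i - j) by omega]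
    · split_ifs with hij
      · rw [hij, Nat.sub_self, add_zero, hN, hQ.coeff_natDegree, mul_one]
      · rw [coeff_eq_zero_of_natDegree_lt (by omega), mul_zero]
    · rw [hdeg, degree_lt_iff_coeff_zero]
      intro n hn
      rw [coeff_X_pow_mul', if_pos (by omega), coeff_dualPoly]
      exact coeff_eq_zero_of_natDegree_lt (by omega)
  · -- modulo `Q`, the numerator has degree `< j ≤ N - 1`
    rw [if_neg (by omega)]
    set R : ℂ[X] := X ^ j * dualPoly Q i - X ^ (j - i - 1) * Q with hR
    have hRc : ∀ n, j ≤ n → R.coeff n = 0 := by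
      intro n hn
      rw [hR, coeff_sub, coeff_X_pow_mul', coeff_X_pow_mul', if_pos hn, if_pos (by omega),
        coeff_dualPoly, show n - j + (i + 1) = n - (j - i - 1) by omega, sub_self]
    have h1 : contourIntegral Γ (fun u => R.eval u / Q.eval u) = 0 := by
      rw [contourIntegral_div_monic hΓ hQ h hv, hRc _ (by omega), mul_zero]
      rw [hdeg, degree_lt_iff_coeff_zero]
      exact fun n hn => hRc n (by omega)
    have h2 : contourIntegral Γ (fun u => (X ^ (j - i - 1) : ℂ[X]).eval u) = 0 :=
      contourIntegral_eq_zero_of_differentiableOn hΓ hD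
        (X ^ (j - i - 1) : ℂ[X]).differentiable.differentiableOn
    rw [contourIntegral_congr (g := fun u => R.eval u / Q.eval u +
      (X ^ (j - i - 1) : ℂ[X]).eval u), contourIntegral_add hΓ (continuousAlong_div hΓ h _)
      (continuousAlong_of_continuous hΓ (X ^ (j - i - 1) : ℂ[X]).continuous), h1, h2, add_zero]
    intro a t ht
    have h3 : Q.eval (Γ a t) ≠ 0 := fun h0 => h _ h0 a t ht rfl
    rw [hR, eval_sub, eval_mul (p := X ^ (j - i - 1))]
    field_simp
    ring

end Duality

/-! ### Roots of `X ^ k - b ^ k` inside and outside an admissible contour -/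

section RootsOfPowers

open Polynomial

variable {N k : ℕ} {β : ℕ → ℂ} {m : ℕ} {Γ : Fin m → ℝ → ℂ}

/-- `(X ^ k - b ^ k) / (X - b)`. -/
def cofactor (k : ℕ) (b : ℂ) : ℂ[X] := ∑ i ∈ Finset.range k, X ^ i * C b ^ (k - 1 - i)

theorem cofactor_mul (k : ℕ) (b : ℂ) : cofactor k b * (X - C b) = X ^ k - C (b ^ k) := by
  rw [C_pow]
  exact (Commute.all _ _).geom_sum₂_mul k

theorem cofactor_monic (hk : 1 ≤ k) (b : ℂ) : (cofactor k b).Monic := by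
  refine Monic.of_mul_monic_right (monic_X_sub_C b) ?_
  rw [cofactor_mul]
  exact monic_X_pow_sub_C _ (by omega)

theorem cofactor_eval_self (k : ℕ) (b : ℂ) : (cofactor k b).eval b = k * b ^ (k - 1) := by
  simp only [cofactor, eval_finsetSum, eval_mul, eval_pow, eval_X, eval_C]
  rw [Finset.sum_congr rfl (g := fun _ => b ^ (k - 1))]
  · simp
  · intro i hi
    rw [Finset.mem_range] at hi
    rw [← pow_add]
    congr 1
    omega

/-- The roots of the cofactor are the `k`-th roots of `b ^ k` other than `b`: the root `b` of
`X ^ k - b ^ k` is simple. -/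
theorem pow_eq_of_isRoot_cofactor (hk : 1 ≤ k) {b c : ℂ} (hb : b ≠ 0)
    (hc : (cofactor k b).IsRoot c) : c ^ k = b ^ k ∧ c ≠ b := by
  constructor
  · have := congrArg (eval c) (cofactor_mul k b)
    rw [eval_mul, hc.eq_zero, zero_mul] at this
    simp only [eval_sub, eval_pow, eval_X, eval_C] at this
    exact (sub_eq_zero.1 this.symm)
  · rintro rfl
    have h1 := hc.eq_zero
    rw [cofactor_eval_self] at h1
    have : (k : ℂ) ≠ 0 := by exact_mod_cast (by omega : k ≠ 0)
    exact mul_ne_zero this (pow_ne_zero _ hb) h1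

theorem IsContourAround.contourIntegral_inv (hΓ : IsContourAround N k β Γ) {j : ℕ}
    (hj : j ∈ Finset.Icc 1 N) :
    contourIntegral Γ (fun w => (w - β j)⁻¹) = 2 * Real.pi * Complex.I := by
  have := hΓ.around j hj
  rwa [windingNumber, inv_mul_eq_iff_eq_mul₀ Complex.two_pi_I_ne_zero, mul_one] at this

theorem IsContourAround.contourIntegral_inv_eq_zero (hΓ : IsContourAround N k β Γ) {j : ℕ}
    (hj : j ∈ Finset.Icc 1 N) {c : ℂ} (hc : c ^ k = β j ^ k) (hc' : c ≠ β j) :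
    contourIntegral Γ (fun w => (w - c)⁻¹) = 0 := by
  have := hΓ.not_around j hj c hc hc'
  rwa [windingNumber, inv_mul_eq_iff_eq_mul₀ Complex.two_pi_I_ne_zero, mul_zero] at this

/-- The `k`-th power of an admissible contour winds once around each `(β j) ^ k`. -/
theorem IsContourAround.contourIntegral_pow_inv (hk : 1 ≤ k) (hΓ : IsContourAround N k β Γ) {j : ℕ}
    (hj : j ∈ Finset.Icc 1 N) (hb : β j ≠ 0) :
    contourIntegral (fun i t => Γ i t ^ k) (fun u => (u - β j ^ k)⁻¹) =
      2 * Real.pi * Complex.I := by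
  rw [contourIntegral_pow hΓ.curve]
  -- partial fractions: `k w ^ (k - 1) / (w ^ k - b ^ k) = 1 / (w - b) + B / cofactor`
  obtain ⟨B, hB⟩ : X - C (β j) ∣ C (k : ℂ) * X ^ (k - 1) - cofactor k (β j) := by
    rw [dvd_iff_isRoot, IsRoot, eval_sub, cofactor_eval_self]
    simp
  have hroot : ∀ c, (cofactor k (β j)).IsRoot c → ∀ i, ∀ t ∈ Set.Icc (0 : ℝ) 1, Γ i t ≠ c := by
    rintro c hc i t ht rfl
    exact hΓ.avoids i t ht j hj (pow_eq_of_isRoot_cofactor hk hb hc).1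
  have havoid : ∀ i, ∀ t ∈ Set.Icc (0 : ℝ) 1, Γ i t - β j ≠ 0 := by
    intro i t ht h
    exact hΓ.avoids i t ht j hj (by rw [sub_eq_zero.1 h])
  have h1 : contourIntegral Γ (fun w => B.eval w / (cofactor k (β j)).eval w) = 0 :=
    contourIntegral_div_eq_zero hΓ.curve hΓ.mem_disc (cofactor_monic hk _) hroot
      (fun c hc => hΓ.contourIntegral_inv_eq_zero hj (pow_eq_of_isRoot_cofactor hk hb hc).1
        (pow_eq_of_isRoot_cofactor hk hb hc).2) B
  have hc1 : ContinuousAlong Γ fun w => (w - β j)⁻¹ :=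
    (continuousAlong_of_continuous hΓ.curve (f := fun w => w - β j) (by fun_prop)).inv havoid
  rw [contourIntegral_congr (g := fun w => (w - β j)⁻¹ + B.eval w / (cofactor k (β j)).eval w),
    contourIntegral_add hΓ.curve hc1 (continuousAlong_div hΓ.curve hroot B), h1, add_zero,
    hΓ.contourIntegral_inv hj]
  intro i t ht
  have h2 := havoid i t ht
  have h3 : (cofactor k (β j)).eval (Γ i t) ≠ 0 := fun h0 => hroot _ h0 i t ht rfl
  have h4 := congrArg (eval (Γ i t)) (cofactor_mul k (β j))
  have h5 := congrArg (eval (Γ i t)) hB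
  simp only [eval_mul, eval_sub, eval_pow, eval_X, eval_C] at h4 h5
  rw [← h4, eq_add_of_sub_eq h5]
  field_simp
  ring

/-- `∏ (X - β j)`, the denominator of the final functions. -/
def poleP (N : ℕ) (β : ℕ → ℂ) : ℂ[X] := ∏ j ∈ Finset.Icc 1 N, (X - C (β j))

theorem poleP_monic : (poleP N β).Monic := monic_prod_X_sub_C _ _

theorem poleP_natDegree : (poleP N β).natDegree = N := by
  simp [poleP, natDegree_prod_of_monic _ _ fun j _ => monic_X_sub_C (β j)]

theorem poleP_eval (w : ℂ) : (poleP N β).eval w = ∏ j ∈ Finset.Icc 1 N, (w - β j) := by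
  simp [poleP, eval_prod]

/-- The product of the cofactors, `∏ (X ^ k - (β j) ^ k) / (X - β j)`. -/
def cofactorProd (N k : ℕ) (β : ℕ → ℂ) : ℂ[X] := ∏ j ∈ Finset.Icc 1 N, cofactor k (β j)

theorem poleP_eval_pow (w : ℂ) : (poleP N fun j => β j ^ k).eval (w ^ k) =
    (cofactorProd N k β).eval w * (poleP N β).eval w := by
  rw [poleP_eval, poleP_eval, cofactorProd, eval_prod, ← Finset.prod_mul_distrib]
  refine Finset.prod_congr rfl fun j _ => ?_
  have := congrArg (eval w) (cofactor_mul k (β j))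
  simpa using this.symm

theorem isRoot_poleP {c : ℂ} (hc : (poleP N β).IsRoot c) : ∃ j ∈ Finset.Icc 1 N, c = β j := by
  rw [IsRoot, poleP_eval, Finset.prod_eq_zero_iff] at hc
  obtain ⟨j, hj, h⟩ := hc
  exact ⟨j, hj, sub_eq_zero.1 h⟩

theorem isRoot_cofactorProd {c : ℂ} (hc : (cofactorProd N k β).IsRoot c) :
    ∃ j ∈ Finset.Icc 1 N, (cofactor k (β j)).IsRoot c := by
  rw [IsRoot, cofactorProd, eval_prod, Finset.prod_eq_zero_iff] at hc
  exact hc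

/-- The functional that extracts the coefficient of `X ^ (k * i)`, in the expansion of a
polynomial modulo `∏ (X - β j)` in powers of `X ^ k`, is a contour integral. -/
theorem IsContourAround.contourIntegral_eq_coeff (hk : 1 ≤ k) (hΓ : IsContourAround N k β Γ)
    (hβ0 : ∀ j ∈ Finset.Icc 1 N, β j ≠ 0) (c : Fin N → ℂ) (f : ℂ[X]) (i : Fin N) :
    contourIntegral Γ (fun w =>
      (∑ j : Fin N, C (c j) * X ^ (k * (j : ℕ)) + poleP N β * f).eval w *
        (k * w ^ (k - 1) * (dualPoly (poleP N fun j => β j ^ k) i).eval (w ^ k) /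
          (poleP N fun j => β j ^ k).eval (w ^ k))) = 2 * Real.pi * Complex.I * c i := by
  set Q := poleP N fun j => β j ^ k with hQ
  set S := cofactorProd N k β with hS
  set P := poleP N β with hP
  have hSroot : ∀ c, S.IsRoot c → ∀ i, ∀ t ∈ Set.Icc (0 : ℝ) 1, Γ i t ≠ c := by
    rintro c hc i t ht rfl
    obtain ⟨j, hj, hr⟩ := isRoot_cofactorProd hc
    exact hΓ.avoids i t ht j hj (pow_eq_of_isRoot_cofactor hk (hβ0 j hj) hr).1
  have hQ0 : ∀ i, ∀ t ∈ Set.Icc (0 : ℝ) 1, Q.eval (Γ i t ^ k) ≠ 0 := by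
    intro i t ht h0
    obtain ⟨j, hj, hr⟩ := isRoot_poleP h0
    exact hΓ.avoids i t ht j hj hr
  have hcont : ∀ F : ℂ → ℂ, Continuous F → ContinuousAlong Γ fun w => F w / Q.eval (w ^ k) := by
    intro F hF
    simp only [div_eq_mul_inv]
    refine (continuousAlong_of_continuous hΓ.curve hF).mul
      ((continuousAlong_of_continuous hΓ.curve ?_).inv hQ0)
    exact Q.continuous.comp (continuous_pow k)
  -- the multiples of `P` have no residues inside the contour
  have h1 : contourIntegral Γ (fun w => (f * (C (k : ℂ) * X ^ (k - 1)) *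
      (dualPoly Q i).comp (X ^ k)).eval w / S.eval w) = 0 := by
    refine contourIntegral_div_eq_zero hΓ.curve hΓ.mem_disc
      (monic_prod_of_monic _ _ fun j _ => cofactor_monic hk _) hSroot (fun c hc => ?_) _
    obtain ⟨j, hj, hr⟩ := isRoot_cofactorProd hc
    have := pow_eq_of_isRoot_cofactor hk (hβ0 j hj) hr
    exact hΓ.contourIntegral_inv_eq_zero hj this.1 this.2
  -- the powers of `X ^ k` are handled by the substitution `u = w ^ k`
  have h2 : ∀ j : Fin N, contourIntegral Γ (fun w =>
      w ^ (k * (j : ℕ)) * (k * w ^ (k - 1)) * (dualPoly Q i).eval (w ^ k) / Q.eval (w ^ k)) =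
      if (i : ℕ) = j then 2 * Real.pi * Complex.I else 0 := by
    intro j
    have h3 := contourIntegral_dualPoly (Γ := fun i t => Γ i t ^ k) (Q := Q) (i := i) (j := j)
      (fun a => ((hΓ.curve a).pow k).1)
      (fun a t ht => by
        rw [norm_pow]
        exact pow_lt_one₀ (norm_nonneg _) (hΓ.mem_disc a t ht) (by omega))
      poleP_monic
      (fun c hc a t ht h0 => by
        subst h0
        exact hQ0 a t ht hc)
      (v := 2 * Real.pi * Complex.I)
      (fun c hc => by
        obtain ⟨j, hj, rfl⟩ := isRoot_poleP hc
        exact hΓ.contourIntegral_pow_inv hk hj (hβ0 j hj))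
      (by rw [hQ, poleP_natDegree]; exact j.2)
    rw [contourIntegral_pow hΓ.curve] at h3
    rw [← h3]
    congr 1
    funext w
    rw [pow_mul]
    ring
  have e : contourIntegral Γ (fun w =>
      (∑ j : Fin N, C (c j) * X ^ (k * (j : ℕ)) + P * f).eval w *
        (k * w ^ (k - 1) * (dualPoly Q i).eval (w ^ k) / Q.eval (w ^ k))) =
      contourIntegral Γ (fun w => (∑ j : Fin N, c j * (w ^ (k * (j : ℕ)) * (k * w ^ (k - 1)) *
        (dualPoly Q i).eval (w ^ k) / Q.eval (w ^ k))) + (f * (C (k : ℂ) * X ^ (k - 1)) *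
      (dualPoly Q i).comp (X ^ k)).eval w / S.eval w) := by
    refine contourIntegral_congr fun a t ht => ?_
    have h4 := hQ0 a t ht
    have h5 : Q.eval (Γ a t ^ k) = S.eval (Γ a t) * P.eval (Γ a t) := poleP_eval_pow _
    have h6 : S.eval (Γ a t) ≠ 0 := fun h0 => hSroot _ h0 a t ht rfl
    have h7 : P.eval (Γ a t) ≠ 0 := by
      rw [h5] at h4
      exact right_ne_zero_of_mul h4
    rw [eval_add, eval_finsetSum, add_mul, Finset.sum_mul]
    congr 1
    · refine Finset.sum_congr rfl fun j _ => ?_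
      simp only [eval_mul, eval_C, eval_pow, eval_X]
      ring
    · simp only [eval_mul, eval_C, eval_pow, eval_X, eval_comp]
      rw [h5]
      field_simp
  have hc1 : ∀ j ∈ (Finset.univ : Finset (Fin N)), ContinuousAlong Γ fun w =>
      c j * (w ^ (k * (j : ℕ)) * (k * w ^ (k - 1)) *
        (dualPoly Q i).eval (w ^ k) / Q.eval (w ^ k)) := by
    intro j _
    refine (continuousAlong_of_continuous hΓ.curve continuous_const).mul (hcont _ ?_)
    exact (by fun_prop : Continuous fun w : ℂ => w ^ (k * (j : ℕ)) * (k * w ^ (k - 1))).mul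
      ((dualPoly Q i).continuous.comp (continuous_pow k))
  rw [e, contourIntegral_add hΓ.curve (fun a => ?_) (continuousAlong_div hΓ.curve hSroot _), h1,
    add_zero, contourIntegral_sum hΓ.curve _ hc1]
  · simp only [contourIntegral_const_mul, h2, Fin.val_inj, mul_ite, mul_zero, Finset.sum_ite_eq,
      Finset.mem_univ, if_true]
    ring
  · exact continuousOn_finsetSum _ fun j hj => hc1 j hj a

end RootsOfPowers

/-! ### Expansion of the kernel in a dual basis -/

section KernelFormula

open Polynomial

variable {N k : ℕ} {α β : ℕ → ℂ} {l : Fin N → ℤ}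

theorem unitCircleIntegral_add {f g : ℂ → ℂ} (hf : ContinuousOn f (Metric.sphere 0 1))
    (hg : ContinuousOn g (Metric.sphere 0 1)) :
    unitCircleIntegral (fun z => f z + g z) = unitCircleIntegral f + unitCircleIntegral g := by
  unfold unitCircleIntegral
  rw [circleIntegral.integral_add (hf.circleIntegrable zero_le_one)
    (hg.circleIntegrable zero_le_one), mul_add]

theorem unitCircleIntegral_sum {ι : Type*} (s : Finset ι) {f : ι → ℂ → ℂ}
    (hf : ∀ i ∈ s, ContinuousOn (f i) (Metric.sphere 0 1)) :
    unitCircleIntegral (fun z => ∑ i ∈ s, f i z) = ∑ i ∈ s, unitCircleIntegral (f i) := by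
  unfold unitCircleIntegral
  rw [circleIntegral.integral_fun_sum fun i hi => (hf i hi).circleIntegrable zero_le_one,
    Finset.mul_sum]

/-- The numerator `z ^ e ∏ (1 - α_r z)⁻¹` of the final functions, where `e = N - 1 - l_j`. It is
holomorphic on the closed unit disc because `l_j ≤ N - 1`. -/
def finalNumerator (N : ℕ) (α : ℕ → ℂ) (e : ℕ) (z : ℂ) : ℂ :=
  z ^ e * ∏ n ∈ Finset.Icc 1 N, (1 - α n * z)⁻¹

/-- The functional `f ↦ (2πi)⁻¹ ∮ f h / P` on polynomials that represents the final functions,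
where `P = ∏ (X - β j)` and `h` is the numerator of the final function. -/
def residueFunctional (N : ℕ) (α β : ℕ → ℂ) (e : ℕ) (f : ℂ[X]) : ℂ :=
  unitCircleIntegral fun z => f.eval z * (finalNumerator N α e z / (poleP N β).eval z)

theorem poleP_eval_ne_zero (hβ : ∀ j ∈ Finset.Icc 1 N, ‖β j‖ < 1) {z : ℂ} (hz : ‖z‖ = 1) :
    (poleP N β).eval z ≠ 0 := by
  intro h
  obtain ⟨j, hj, rfl⟩ := isRoot_poleP h
  exact (hβ j hj).ne hz

theorem differentiableAt_finalNumerator (hα : ∀ j ∈ Finset.Icc 1 N, ‖α j‖ < 1) (e : ℕ) {z : ℂ}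
    (hz : ‖z‖ ≤ 1) : DifferentiableAt ℂ (finalNumerator N α e) z := by
  unfold finalNumerator
  refine (differentiableAt_id.pow e).mul (DifferentiableAt.fun_finsetProd fun n hn => ?_)
  exact ((differentiableAt_const _).sub ((differentiableAt_const _).mul differentiableAt_id)).inv
    (one_sub_mul_ne_zero (hα n hn) hz)

theorem continuousOn_residueFunctional (hα : ∀ j ∈ Finset.Icc 1 N, ‖α j‖ < 1)
    (hβ : ∀ j ∈ Finset.Icc 1 N, ‖β j‖ < 1) (e : ℕ) (f : ℂ[X]) :
    ContinuousOn (fun z => f.eval z * (finalNumerator N α e z / (poleP N β).eval z))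
      (Metric.sphere 0 1) := by
  refine f.continuous.continuousOn.mul (ContinuousOn.div (fun z hz => ?_)
    (poleP N β).continuous.continuousOn fun z hz => ?_)
  · exact (differentiableAt_finalNumerator hα e
      (mem_sphere_zero_iff_norm.1 hz).le).continuousAt.continuousWithinAt
  · exact poleP_eval_ne_zero hβ (mem_sphere_zero_iff_norm.1 hz)

/-- The residue functional vanishes on the multiples of `P`, by Cauchy's theorem. -/
theorem residueFunctional_mul_poleP (hα : ∀ j ∈ Finset.Icc 1 N, ‖α j‖ < 1)
    (hβ : ∀ j ∈ Finset.Icc 1 N, ‖β j‖ < 1) (e : ℕ) (f : ℂ[X]) :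
    residueFunctional N α β e (poleP N β * f) = 0 := by
  have h : residueFunctional N α β e (poleP N β * f) =
      unitCircleIntegral fun z => f.eval z * finalNumerator N α e z := by
    refine unitCircleIntegral_congr fun z hz => ?_
    have := poleP_eval_ne_zero (N := N) hβ hz
    rw [eval_mul]
    field_simp
  have hd : ∀ z : ℂ, ‖z‖ ≤ 1 →
      DifferentiableAt ℂ (fun z => f.eval z * finalNumerator N α e z) z := fun z hz =>
    f.differentiable.differentiableAt.mul (differentiableAt_finalNumerator hα e hz)
  rw [h, unitCircleIntegral, Complex.circleIntegral_eq_zero_of_differentiable_on_off_countable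
    zero_le_one (s := ∅) Set.countable_empty, mul_zero]
  · intro z hz
    exact (hd z (mem_closedBall_zero_iff.1 hz)).continuousAt.continuousWithinAt
  · intro z hz
    exact hd z (mem_ball_zero_iff.1 hz.1).le

theorem residueFunctional_expansion (hα : ∀ j ∈ Finset.Icc 1 N, ‖α j‖ < 1)
    (hβ : ∀ j ∈ Finset.Icc 1 N, ‖β j‖ < 1) (e : ℕ) (c : Fin N → ℂ) (f : ℂ[X]) :
    residueFunctional N α β e (∑ i : Fin N, C (c i) * X ^ (k * (i : ℕ)) + poleP N β * f) =
      ∑ i : Fin N, c i * residueFunctional N α β e (X ^ (k * (i : ℕ))) := by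
  have h1 := residueFunctional_mul_poleP hα hβ e f
  have hc := continuousOn_residueFunctional hα hβ e
  have h2 : residueFunctional N α β e (∑ i : Fin N, C (c i) * X ^ (k * (i : ℕ)) + poleP N β * f) =
      unitCircleIntegral fun z => (∑ i : Fin N, (C (c i) * X ^ (k * (i : ℕ)) : ℂ[X]).eval z *
        (finalNumerator N α e z / (poleP N β).eval z)) +
        (poleP N β * f).eval z * (finalNumerator N α e z / (poleP N β).eval z) := by
    refine unitCircleIntegral_congr fun z _ => ?_
    rw [eval_add, add_mul, eval_finsetSum, Finset.sum_mul]
  rw [h2, unitCircleIntegral_add (continuousOn_finsetSum _ fun i _ => hc _) (hc _),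
    unitCircleIntegral_sum _ fun i _ => hc _]
  unfold residueFunctional at h1 ⊢
  rw [h1, add_zero]
  refine Finset.sum_congr rfl fun i _ => ?_
  rw [← unitCircleIntegral_const_mul]
  refine unitCircleIntegral_congr fun z _ => ?_
  simp only [eval_mul, eval_C]
  ring

theorem prod_transitionGF_down {z : ℂ} (hz : z ≠ 0) :
    ∏ n ∈ Finset.Ioc N (2 * N), transitionGF N α β n z = z ^ N / (poleP N β).eval z := by
  have h1 : ∏ n ∈ Finset.Ioc N (2 * N), transitionGF N α β n z =
      ∏ j ∈ Finset.Icc 1 N, (1 - β j / z)⁻¹ := by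
    refine Finset.prod_nbij' (fun n => 2 * N - n + 1) (fun j => 2 * N - j + 1) ?_ ?_ ?_ ?_ ?_
    · intro n hn
      simp only [Finset.mem_Ioc, Finset.mem_Icc] at hn ⊢
      omega
    · intro n hn
      simp only [Finset.mem_Ioc, Finset.mem_Icc] at hn ⊢
      omega
    · intro n hn
      simp only [Finset.mem_Ioc] at hn
      omega
    · intro n hn
      simp only [Finset.mem_Icc] at hn
      omega
    · intro n hn
      rw [transitionGF, if_neg (not_le.2 (Finset.mem_Ioc.1 hn).1)]
  have h2 : z ^ N = ∏ _j ∈ Finset.Icc 1 N, z := by simp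
  rw [h1, poleP_eval, h2, ← Finset.prod_div_distrib]
  refine Finset.prod_congr rfl fun j _ => ?_
  rw [show 1 - β j / z = (z - β j) / z by field_simp, inv_div]

/-- `X ^ x ∏_{r ≤ s} (1 - α_r X)`, the polynomial that represents height `x` on line `s`. -/
def linePoly (α : ℕ → ℂ) (s x : ℕ) : ℂ[X] := X ^ x * ∏ r ∈ Finset.Icc 1 s, (1 - C (α r) * X)

theorem linePoly_eval (s x : ℕ) (z : ℂ) :
    (linePoly α s x).eval z = z ^ x * ∏ r ∈ Finset.Icc 1 s, (1 - α r * z) := by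
  simp [linePoly, eval_prod]

/-- The final functions in terms of residues. -/
theorem integral_eq_residueFunctional (hα : ∀ j ∈ Finset.Icc 1 N, ‖α j‖ < 1)
    {s x e : ℕ} (hs : s ≤ N) {b : ℤ} (he : (e : ℤ) = N - 1 - b) :
    (unitCircleIntegral fun z => (∏ n ∈ Finset.Ioc s (2 * N), transitionGF N α β n z) *
      z ^ ((x : ℤ) - b - 1)) = residueFunctional N α β e (linePoly α s x) := by
  refine unitCircleIntegral_congr fun z hz => ?_
  have hz0 := ne_zero_of_norm_eq_one hz
  have h1 : ∏ n ∈ Finset.Ioc s (2 * N), transitionGF N α β n z =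
      (∏ n ∈ Finset.Ioc s N, (1 - α n * z)⁻¹) * (z ^ N / (poleP N β).eval z) := by
    rw [← prod_transitionGF_down hz0, ← Finset.prod_Ioc_consecutive _ hs (by omega)]
    congr 1
    refine Finset.prod_congr rfl fun n hn => ?_
    rw [transitionGF, if_pos (Finset.mem_Ioc.1 hn).2]
  have h2 : ∏ n ∈ Finset.Icc 1 N, (1 - α n * z)⁻¹ =
      (∏ n ∈ Finset.Icc 1 s, (1 - α n * z)⁻¹) * ∏ n ∈ Finset.Ioc s N, (1 - α n * z)⁻¹ :=
    (Finset.prod_Ioc_consecutive _ (Nat.zero_le s) hs).symm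
  have h3 : (∏ n ∈ Finset.Icc 1 s, (1 - α n * z)) * ∏ n ∈ Finset.Icc 1 s, (1 - α n * z)⁻¹ = 1 := by
    rw [← Finset.prod_mul_distrib]
    refine Finset.prod_eq_one fun n hn => mul_inv_cancel₀ (one_sub_mul_ne_zero (hα n ?_) hz.le)
    exact Finset.Icc_subset_Icc le_rfl hs hn
  have h4 : z ^ N * z ^ ((x : ℤ) - b - 1) = z ^ x * z ^ e := by
    rw [← zpow_natCast, ← zpow_natCast, ← zpow_natCast, ← zpow_add₀ hz0, ← zpow_add₀ hz0, he]
    congr 1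
    ring
  rw [h1, linePoly_eval, finalNumerator, h2]
  calc _ = (∏ n ∈ Finset.Ioc s N, (1 - α n * z)⁻¹) * (z ^ N * z ^ ((x : ℤ) - b - 1)) /
        (poleP N β).eval z := by ring
    _ = ((∏ n ∈ Finset.Icc 1 s, (1 - α n * z)) * ∏ n ∈ Finset.Icc 1 s, (1 - α n * z)⁻¹) *
        (∏ n ∈ Finset.Ioc s N, (1 - α n * z)⁻¹) * (z ^ x * z ^ e) / (poleP N β).eval z := by
        rw [h3, h4, one_mul]
    _ = _ := by ring

theorem gram_eq_residueFunctional (hα : ∀ j ∈ Finset.Icc 1 N, ‖α j‖ < 1)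
    (hlN : ∀ j, l j ≤ (N : ℤ) - 1) (i j : Fin N) :
    gram N (equallySpaced N k) l α β i j =
      residueFunctional N α β ((N : ℤ) - 1 - l j).toNat (X ^ (k * (i : ℕ))) := by
  have := integral_eq_residueFunctional (β := β) hα (x := k * (i : ℕ)) (Nat.zero_le N)
    (Int.toNat_of_nonneg (sub_nonneg.2 (hlN j)))
  rw [gram_apply]
  rw [linePoly, Finset.Icc_eq_empty (by norm_num), Finset.prod_empty, mul_one] at this
  rw [← this]
  simp [equallySpaced]

/-- If the Gram matrix is invertible, the powers `1, X ^ k, …, X ^ (k (N - 1))` are linearly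
independent modulo `P`. -/
theorem eq_zero_of_poleP_dvd (hα : ∀ j ∈ Finset.Icc 1 N, ‖α j‖ < 1)
    (hβ : ∀ j ∈ Finset.Icc 1 N, ‖β j‖ < 1) (hlN : ∀ j, l j ≤ (N : ℤ) - 1)
    (hG : (gram N (equallySpaced N k) l α β).det ≠ 0) {c : Fin N → ℂ}
    (h : poleP N β ∣ ∑ i : Fin N, C (c i) * X ^ (k * (i : ℕ))) : c = 0 := by
  obtain ⟨f, hf⟩ := h
  refine Matrix.eq_zero_of_vecMul_eq_zero hG (funext fun j => ?_)
  have h1 := residueFunctional_expansion (k := k) hα hβ ((N : ℤ) - 1 - l j).toNat c (-f)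
  rw [hf, ← mul_add, add_neg_cancel, mul_zero] at h1
  simp only [Matrix.vecMul, dotProduct, gram_eq_residueFunctional hα hlN, Pi.zero_apply]
  rw [← h1]
  simp [residueFunctional, unitCircleIntegral, circleIntegral]

/-- If the Gram matrix is invertible, the powers `1, X ^ k, …, X ^ (k (N - 1))` span the
polynomials modulo `P`. -/
theorem exists_expansion (hα : ∀ j ∈ Finset.Icc 1 N, ‖α j‖ < 1)
    (hβ : ∀ j ∈ Finset.Icc 1 N, ‖β j‖ < 1) (hlN : ∀ j, l j ≤ (N : ℤ) - 1)
    (hG : (gram N (equallySpaced N k) l α β).det ≠ 0) (g : ℂ[X]) :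
    ∃ (c : Fin N → ℂ) (f : ℂ[X]),
      g = ∑ i : Fin N, C (c i) * X ^ (k * (i : ℕ)) + poleP N β * f := by
  -- the linear map from `c` to the remainder of `∑ c i X ^ (k i)` modulo `P`, given by its `N`
  -- coefficients, is injective and hence surjective
  set T : (Fin N → ℂ) →ₗ[ℂ] ℂ[X] :=
    ∑ i : Fin N, (LinearMap.toSpanSingleton ℂ ℂ[X] (X ^ (k * (i : ℕ)))).comp (LinearMap.proj i)
    with hT
  have hTa : ∀ c, T c = ∑ i : Fin N, C (c i) * X ^ (k * (i : ℕ)) := by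
    intro c
    simp [hT, smul_eq_C_mul]
  set E : (Fin N → ℂ) →ₗ[ℂ] (Fin N → ℂ) :=
    LinearMap.pi fun j => (lcoeff ℂ (j : ℕ)).comp ((modByMonicHom (poleP N β)).comp T) with hE
  have hEa : ∀ c j, E c j = (T c %ₘ poleP N β).coeff j := fun c j => rfl
  have hext : ∀ p q : ℂ[X], (∀ j : Fin N, (p %ₘ poleP N β).coeff j = (q %ₘ poleP N β).coeff j) →
      p %ₘ poleP N β = q %ₘ poleP N β := by
    intro p q h
    have hd : ∀ r : ℂ[X], (r %ₘ poleP N β).degree < N := fun r => by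
      have := degree_modByMonic_lt r (poleP_monic (N := N) (β := β))
      rwa [degree_eq_natDegree poleP_monic.ne_zero, poleP_natDegree] at this
    ext n
    rcases lt_or_ge n N with hn | hn
    · exact h ⟨n, hn⟩
    · rw [(degree_lt_iff_coeff_zero _ _).1 (hd p) n hn, (degree_lt_iff_coeff_zero _ _).1 (hd q) n hn]
  have hinj : Function.Injective E := by
    rw [← LinearMap.ker_eq_bot, LinearMap.ker_eq_bot']
    intro c hc
    refine eq_zero_of_poleP_dvd hα hβ hlN hG ?_
    rw [← hTa, ← modByMonic_eq_zero_iff_dvd poleP_monic, ← zero_modByMonic (poleP N β)]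
    refine hext _ _ fun j => ?_
    rw [← hEa, hc, zero_modByMonic]
    simp
  obtain ⟨c, hc⟩ := LinearMap.injective_iff_surjective.1 hinj
    fun j : Fin N => (g %ₘ poleP N β).coeff j
  have h1 : T c %ₘ poleP N β = g %ₘ poleP N β := hext _ _ fun j => congrFun hc j
  refine ⟨c, g /ₘ poleP N β - T c /ₘ poleP N β, ?_⟩
  have h2 := modByMonic_add_div g (poleP N β)
  have h3 := modByMonic_add_div (T c) (poleP N β)
  rw [← hTa]
  linear_combination (exp := 1) h3 - h2 - h1

end KernelFormula

section Formula

open Polynomial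

variable {N k : ℕ} {α β : ℕ → ℂ} {l : Fin N → ℤ} {m : ℕ} {Γ : Fin m → ℝ → ℂ}

/-- The coefficient of `X ^ (k * i)` in the expansion of `X ^ x ∏_{r ≤ s} (1 - α_r X)` modulo
`∏ (X - β j)` in powers of `X ^ k`, written as an integral over an admissible contour `Γ`. -/
def dualFunction (N k : ℕ) (α β : ℕ → ℂ) (Γ : Fin m → ℝ → ℂ) (s x i : ℕ) : ℂ :=
  (2 * (Real.pi : ℂ) * Complex.I)⁻¹ * contourIntegral Γ fun w => (linePoly α s x).eval w *
    (k * w ^ (k - 1) * (dualPoly (poleP N fun j => β j ^ k) i).eval (w ^ k) /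
      (poleP N fun j => β j ^ k).eval (w ^ k))

/-- The final functions are combinations of the dual functions, with the entries of the Gram
matrix as coefficients. -/
theorem residueFunctional_eq_sum_dualFunction (hk : 1 ≤ k)
    (hα : ∀ j ∈ Finset.Icc 1 N, ‖α j‖ < 1) (hβ : ∀ j ∈ Finset.Icc 1 N, ‖β j‖ < 1)
    (hβ0 : ∀ j ∈ Finset.Icc 1 N, β j ≠ 0) (hlN : ∀ j, l j ≤ (N : ℤ) - 1)
    (hG : (gram N (equallySpaced N k) l α β).det ≠ 0) (hΓ : IsContourAround N k β Γ)
    (s x : ℕ) (j : Fin N) :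
    residueFunctional N α β ((N : ℤ) - 1 - l j).toNat (linePoly α s x) =
      ∑ i : Fin N, dualFunction N k α β Γ s x i * gram N (equallySpaced N k) l α β i j := by
  obtain ⟨c, f, hcf⟩ := exists_expansion (k := k) hα hβ hlN hG (linePoly α s x)
  have h1 : ∀ i : Fin N, dualFunction N k α β Γ s x i = c i := by
    intro i
    rw [dualFunction, hcf, hΓ.contourIntegral_eq_coeff hk hβ0 c f i,
      inv_mul_cancel_left₀ Complex.two_pi_I_ne_zero]
  simp only [h1, gram_eq_residueFunctional hα hlN]
  rw [hcf, residueFunctional_expansion hα hβ]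

/-- The second term of the kernel as a combination of initial and dual functions. -/
theorem kernel_eq_sum_dualFunction (hk : 1 ≤ k)
    (hα : ∀ j ∈ Finset.Icc 1 N, ‖α j‖ < 1) (hβ : ∀ j ∈ Finset.Icc 1 N, ‖β j‖ < 1)
    (hβ0 : ∀ j ∈ Finset.Icc 1 N, β j ≠ 0) (hlN : ∀ j, l j ≤ (N : ℤ) - 1)
    (hG : (gram N (equallySpaced N k) l α β).det ≠ 0) (hΓ : IsContourAround N k β Γ)
    {s₁ s₂ : ℕ} (hs₁ : s₁ ≤ N) (hs₂ : s₂ ≤ N) (x₁ x₂ : ℕ) :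
    kernel N (equallySpaced N k) l α β s₁ x₁ s₂ x₂ = singleIntegralTerm α s₁ x₁ s₂ x₂ +
      ∑ i : Fin N, dualFunction N k α β Γ s₂ x₂ i * unitCircleIntegral fun z =>
        z ^ (k * (i : ℕ)) / ((∏ n ∈ Finset.Icc 1 s₁, (1 - α n * z)) * z ^ (x₁ + 1)) := by
  set G := gram N (equallySpaced N k) l α β with hGdef
  set φ : Fin N → ℂ := fun i => unitCircleIntegral fun z =>
        z ^ (k * (i : ℕ)) / ((∏ n ∈ Finset.Icc 1 s₁, (1 - α n * z)) * z ^ (x₁ + 1)) with hφ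
  have h1 : ∀ i : Fin N, (unitCircleIntegral fun z => z ^ equallySpaced N k i *
      (∏ n ∈ Finset.Icc 1 s₁, transitionGF N α β n z) / z ^ ((x₁ : ℤ) + 1)) = φ i := by
    intro i
    refine unitCircleIntegral_congr fun z _ => ?_
    have e1 : z ^ equallySpaced N k i = z ^ (k * (i : ℕ)) := by
      rw [← zpow_natCast, equallySpaced]
      push_cast
      rfl
    have e2 : z ^ ((x₁ : ℤ) + 1) = z ^ (x₁ + 1) := by
      rw [← zpow_natCast]
      push_cast
      rfl
    have e3 : ∏ n ∈ Finset.Icc 1 s₁, transitionGF N α β n z =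
        (∏ n ∈ Finset.Icc 1 s₁, (1 - α n * z))⁻¹ := by
      rw [← Finset.prod_inv_distrib]
      refine Finset.prod_congr rfl fun n hn => ?_
      rw [transitionGF, if_pos ((Finset.mem_Icc.1 hn).2.trans hs₁)]
    rw [e1, e2, e3, div_eq_mul_inv, div_eq_mul_inv, mul_inv, mul_assoc]
  have h2 : ∀ j : Fin N, (unitCircleIntegral fun z =>
      (∏ n ∈ Finset.Ioc s₂ (2 * N), transitionGF N α β n z) * z ^ (x₂ : ℤ) / z ^ (l j + 1)) =
      ∑ i : Fin N, dualFunction N k α β Γ s₂ x₂ i * G i j := by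
    intro j
    rw [← residueFunctional_eq_sum_dualFunction hk hα hβ hβ0 hlN hG hΓ,
      ← integral_eq_residueFunctional hα hs₂ (Int.toNat_of_nonneg (sub_nonneg.2 (hlN j)))]
    refine unitCircleIntegral_congr fun z hz => ?_
    rw [sub_sub, zpow_sub₀ (ne_zero_of_norm_eq_one hz), mul_div_assoc]
  have h3 : ∀ i : Fin N, ∑ j : Fin N, (∑ i' : Fin N, dualFunction N k α β Γ s₂ x₂ i' * G i' j) *
      (G⁻¹) j i = dualFunction N k α β Γ s₂ x₂ i := by
    intro i
    have hinv := Matrix.mul_nonsing_inv G (isUnit_iff_ne_zero.2 hG)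
    have := congrFun (Matrix.vecMul_vecMul
      (fun i : Fin N => dualFunction N k α β Γ s₂ x₂ i) G G⁻¹) i
    rw [hinv, Matrix.vecMul_one] at this
    exact this
  unfold kernel
  congr 1
  · unfold singleIntegralTerm
    congr 1
    refine if_congr Iff.rfl (unitCircleIntegral_congr fun z _ => ?_) rfl
    congr 1
    refine Finset.prod_congr rfl fun n hn => ?_
    rw [transitionGF, if_pos ((Finset.mem_Ioc.1 hn).2.trans hs₁)]
  · simp only [h1, h2]
    refine Finset.sum_congr rfl fun i _ => ?_
    rw [← h3 i, Finset.sum_mul]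
    refine Finset.sum_congr rfl fun j _ => ?_
    rw [Matrix.transpose_apply]
    ring

/-- For fixed `z`, the inner integral is a combination of the dual functions, up to the integral of
a function of `w` that is holomorphic on the disc. -/
theorem doubleIntegralKernel_eq_sum_dualFunction (hk : 1 ≤ k)
    (hα : ∀ j ∈ Finset.Icc 1 N, ‖α j‖ < 1) (hΓ : IsContourAround N k β Γ)
    {s₁ : ℕ} (hs₁ : s₁ ≤ N) (s₂ x₁ x₂ : ℕ) :
    doubleIntegralKernel N k α β Γ s₁ x₁ s₂ x₂ = singleIntegralTerm α s₁ x₁ s₂ x₂ +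
      ∑ i : Fin N, dualFunction N k α β Γ s₂ x₂ i * unitCircleIntegral fun z =>
        z ^ (k * (i : ℕ)) / ((∏ n ∈ Finset.Icc 1 s₁, (1 - α n * z)) * z ^ (x₁ + 1)) := by
  set Q := poleP N fun j => β j ^ k with hQ
  have hk0 : (k : ℂ) ≠ 0 := by exact_mod_cast (by omega : k ≠ 0)
  have hQ0 : ∀ i, ∀ t ∈ Set.Icc (0 : ℝ) 1, Q.eval (Γ i t ^ k) ≠ 0 := by
    intro i t ht h0
    obtain ⟨j, hj, hr⟩ := isRoot_poleP h0
    exact hΓ.avoids i t ht j hj hr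
  set E : ℕ → ℂ := fun i => contourIntegral Γ fun w => (linePoly α s₂ x₂).eval w *
    (k * w ^ (k - 1) * (dualPoly Q i).eval (w ^ k) / Q.eval (w ^ k)) with hE
  have hinner : ∀ z : ℂ, ‖z‖ = 1 → (contourIntegral Γ fun w =>
      ((∏ r ∈ Finset.Icc 1 s₂, (1 - α r * w)) * ∏ j ∈ Finset.Icc 1 N, (z ^ k - β j ^ k)) /
        ((∏ n ∈ Finset.Icc 1 s₁, (1 - α n * z)) * ∏ t ∈ Finset.Icc 1 N, (w ^ k - β t ^ k)) *
      (w ^ (x₂ + k - 1) / (z ^ (x₁ + 1) * (z ^ k - w ^ k)))) =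
      ∑ i : Fin N, (k : ℂ)⁻¹ * E i *
        (z ^ (k * (i : ℕ)) / ((∏ n ∈ Finset.Icc 1 s₁, (1 - α n * z)) * z ^ (x₁ + 1))) := by
    intro z hz
    set a : ℂ := ((∏ n ∈ Finset.Icc 1 s₁, (1 - α n * z)) * z ^ (x₁ + 1))⁻¹ with ha
    have hzw : ∀ w : ℂ, ‖w‖ < 1 → z ^ k - w ^ k ≠ 0 := by
      intro w hw h0
      have h1 : ‖w ^ k‖ < 1 := by
        rw [norm_pow]
        exact pow_lt_one₀ (norm_nonneg _) hw (by omega)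
      rw [← sub_eq_zero.1 h0, norm_pow, hz, one_pow] at h1
      exact lt_irrefl _ h1
    -- the part of the integrand that is holomorphic in `w` on the disc
    set F : ℂ → ℂ := fun w => (linePoly α s₂ x₂).eval w * w ^ (k - 1) / (z ^ k - w ^ k) with hF
    have hFd : DifferentiableOn ℂ F (Metric.ball 0 1) := by
      intro w hw
      refine DifferentiableAt.differentiableWithinAt (DifferentiableAt.div ?_ (by fun_prop)
        (hzw w (mem_ball_zero_iff.1 hw)))
      exact (linePoly α s₂ x₂).differentiable.differentiableAt.mul (by fun_prop)
    have hF0 := contourIntegral_eq_zero_of_differentiableOn hΓ.curve hΓ.mem_disc hFd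
    have hFc : ContinuousAlong Γ F := fun i => hFd.continuousOn.comp (hΓ.curve i).continuousOn
      fun t ht => mem_ball_zero_iff.2 (hΓ.mem_disc i t ht)
    have hcont : ∀ i ∈ (Finset.univ : Finset (Fin N)), ContinuousAlong Γ fun w =>
        (k : ℂ)⁻¹ * z ^ (k * (i : ℕ)) * ((linePoly α s₂ x₂).eval w *
          (k * w ^ (k - 1) * (dualPoly Q i).eval (w ^ k) / Q.eval (w ^ k))) := by
      intro i _
      simp only [div_eq_mul_inv]
      have hdual : Continuous fun w : ℂ => (dualPoly Q i).eval (w ^ k) :=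
        (dualPoly Q i).continuous.comp (continuous_pow k)
      refine (continuousAlong_of_continuous hΓ.curve continuous_const).mul
        ((continuousAlong_of_continuous hΓ.curve (linePoly α s₂ x₂).continuous).mul
        ((continuousAlong_of_continuous hΓ.curve (by fun_prop)).mul
          ((continuousAlong_of_continuous hΓ.curve ?_).inv hQ0)))
      exact Q.continuous.comp (continuous_pow k)
    rw [contourIntegral_congr (g := fun w => a * (∑ i : Fin N,
        (k : ℂ)⁻¹ * z ^ (k * (i : ℕ)) * ((linePoly α s₂ x₂).eval w *
          (k * w ^ (k - 1) * (dualPoly Q i).eval (w ^ k) / Q.eval (w ^ k))) + F w)),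
      contourIntegral_const_mul, contourIntegral_add hΓ.curve
        (fun i => continuousOn_finsetSum _ fun j hj => hcont j hj i) hFc,
      contourIntegral_sum hΓ.curve _ hcont, hF0, add_zero, Finset.mul_sum]
    · refine Finset.sum_congr rfl fun i _ => ?_
      rw [contourIntegral_const_mul, ha]
      simp only [hE]
      ring
    · intro i t ht
      set w := Γ i t with hw
      have h1 := hzw w (hΓ.mem_disc i t ht)
      have h2 := hQ0 i t ht
      rw [← hw] at h2
      have h3 := eval_sub_eval_eq_sum_dualPoly (Q := Q) poleP_monic (w ^ k) (z ^ k)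
      rw [hQ, poleP_natDegree, ← hQ, Finset.sum_range] at h3
      have h4 : ∏ j ∈ Finset.Icc 1 N, (z ^ k - β j ^ k) = Q.eval (z ^ k) := (poleP_eval _).symm
      have h5 : ∏ j ∈ Finset.Icc 1 N, (w ^ k - β j ^ k) = Q.eval (w ^ k) := (poleP_eval _).symm
      have h6 : ∑ i : Fin N, (k : ℂ)⁻¹ * z ^ (k * (i : ℕ)) * ((linePoly α s₂ x₂).eval w *
          (k * w ^ (k - 1) * (dualPoly Q i).eval (w ^ k) / Q.eval (w ^ k))) =
          (linePoly α s₂ x₂).eval w * w ^ (k - 1) / Q.eval (w ^ k) *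
            ∑ i : Fin N, (z ^ k) ^ (i : ℕ) * (dualPoly Q i).eval (w ^ k) := by
        rw [Finset.mul_sum]
        refine Finset.sum_congr rfl fun i _ => ?_
        rw [pow_mul]
        field_simp
      have h7 : ∑ i : Fin N, (z ^ k) ^ (i : ℕ) * (dualPoly Q i).eval (w ^ k) =
          (Q.eval (z ^ k) - Q.eval (w ^ k)) / (z ^ k - w ^ k) := by
        rw [h3, mul_div_cancel_left₀ _ h1]
      have h8 : w ^ (x₂ + k - 1) = w ^ x₂ * w ^ (k - 1) := by
        rw [← pow_add]
        congr 1
        omega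
      rw [h4, h5, h6, h7, h8, ha, hF]
      simp only [linePoly_eval]
      have h9 : (w ^ x₂ * ∏ r ∈ Finset.Icc 1 s₂, (1 - α r * w)) * w ^ (k - 1) / Q.eval (w ^ k) *
          ((Q.eval (z ^ k) - Q.eval (w ^ k)) / (z ^ k - w ^ k)) +
          (w ^ x₂ * ∏ r ∈ Finset.Icc 1 s₂, (1 - α r * w)) * w ^ (k - 1) / (z ^ k - w ^ k) =
          (w ^ x₂ * ∏ r ∈ Finset.Icc 1 s₂, (1 - α r * w)) * w ^ (k - 1) *
            Q.eval (z ^ k) / (Q.eval (w ^ k) * (z ^ k - w ^ k)) := by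
        field_simp
        ring_nf
      rw [h9]
      simp only [div_eq_mul_inv, mul_inv]
      ring
  unfold doubleIntegralKernel
  congr 1
  have hcirc : ∀ f : ℂ → ℂ, (∮ z in C(0, 1), f z) =
      2 * (Real.pi : ℂ) * Complex.I * unitCircleIntegral f := fun f => by
    rw [unitCircleIntegral, mul_inv_cancel_left₀ Complex.two_pi_I_ne_zero]
  rw [hcirc, unitCircleIntegral_congr hinner, unitCircleIntegral_sum, Finset.mul_sum,
    Finset.mul_sum]
  · refine Finset.sum_congr rfl fun i _ => ?_
    have hd : dualFunction N k α β Γ s₂ x₂ i =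
      (2 * (Real.pi : ℂ) * Complex.I)⁻¹ * E i := rfl
    have := Complex.two_pi_I_ne_zero
    rw [unitCircleIntegral_const_mul, hd]
    field_simp
  · intro i _
    refine continuousOn_const.mul (ContinuousOn.div (by fun_prop) (by fun_prop) fun z hz => ?_)
    have hz1 := mem_sphere_zero_iff_norm.1 hz
    refine mul_ne_zero (Finset.prod_ne_zero_iff.2 fun n hn => ?_)
      (pow_ne_zero _ (ne_zero_of_norm_eq_one hz1))
    exact one_sub_mul_ne_zero (hα n (Finset.Icc_subset_Icc le_rfl hs₁ hn)) hz1.le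

end Formula

/-! ### Existence of admissible contours -/

section Existence

open Polynomial

variable {N k : ℕ} {α β : ℕ → ℂ} {l : Fin N → ℤ}

/-- If `β i ≠ β j` have the same `k`-th power, then `∏_{t ≠ i} (X ^ k - β t ^ k)` is a nonzero
combination of `1, X ^ k, …, X ^ (k (N - 1))` divisible by `∏ (X - β t)`, and the Gram determinant
vanishes. -/
theorem eq_of_pow_eq (hα : ∀ j ∈ Finset.Icc 1 N, ‖α j‖ < 1)
    (hβ : ∀ j ∈ Finset.Icc 1 N, ‖β j‖ < 1) (hlN : ∀ j, l j ≤ (N : ℤ) - 1)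
    (hG : (gram N (equallySpaced N k) l α β).det ≠ 0) {i j : ℕ} (hi : i ∈ Finset.Icc 1 N)
    (hj : j ∈ Finset.Icc 1 N) (h : β i ^ k = β j ^ k) : β i = β j := by
  by_contra hne
  have hij : i ≠ j := fun e => hne (by rw [e])
  -- `p(X ^ k)` is divisible by `P`: its factor `X ^ k - (β j) ^ k` has both roots `β i` and `β j`
  set p : ℂ[X] := ∏ t ∈ (Finset.Icc 1 N).erase i, (X - C (β t ^ k)) with hp
  have hmonic : p.Monic := monic_prod_X_sub_C _ _
  have hdeg : p.natDegree = N - 1 := by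
    rw [hp, natDegree_prod_of_monic _ _ fun j _ => monic_X_sub_C _,
      Finset.sum_congr rfl fun t _ => natDegree_X_sub_C (β t ^ k)]
    simp [Finset.card_erase_of_mem hi]
  have hN : 1 ≤ N := (Finset.mem_Icc.1 hi).1.trans (Finset.mem_Icc.1 hi).2
  have hj' : j ∈ (Finset.Icc 1 N).erase i := Finset.mem_erase.2 ⟨hij.symm, hj⟩
  have hexp : expand ℂ k p = ∏ t ∈ (Finset.Icc 1 N).erase i, (X ^ k - C (β t ^ k)) := by
    simp [hp, map_prod]
  have hdvd : poleP N β ∣ expand ℂ k p := by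
    rw [hexp, poleP, ← Finset.mul_prod_erase _ _ hi, ← Finset.mul_prod_erase _ _ hj', ← mul_assoc,
      ← Finset.mul_prod_erase _ (fun t => X ^ k - C (β t ^ k)) hj']
    refine mul_dvd_mul (IsCoprime.mul_dvd ?_ ?_ ?_) (Finset.prod_dvd_prod_of_dvd _ _ fun t _ => ?_)
    · exact isCoprime_X_sub_C_of_isUnit_sub (isUnit_iff_ne_zero.2 (sub_ne_zero.2 hne))
    · rw [dvd_iff_isRoot]
      simp [h]
    · rw [dvd_iff_isRoot]
      simp
    · rw [dvd_iff_isRoot]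
      simp
  have hsum : expand ℂ k p = ∑ m : Fin N, C (p.coeff m) * X ^ (k * (m : ℕ)) := by
    conv_lhs => rw [p.as_sum_range_C_mul_X_pow, hdeg, Nat.sub_add_cancel hN]
    rw [map_sum, Finset.sum_range]
    refine Finset.sum_congr rfl fun m _ => ?_
    rw [map_mul, expand_C, map_pow, expand_X, pow_mul]
  rw [hsum] at hdvd
  have h0 := eq_zero_of_poleP_dvd hα hβ hlN hG hdvd
  have h1 := congrFun h0 ⟨N - 1, by omega⟩
  have h2 : p.coeff (N - 1) = 1 := by
    rw [← hdeg]
    exact hmonic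
  simp only [Pi.zero_apply] at h1
  rw [h2] at h1
  exact one_ne_zero h1

/-- The circle, run through once over `[0, 1]`. -/
def circleCurve (c : ℂ) (r : ℝ) (t : ℝ) : ℂ := circleMap c r (2 * Real.pi * t)

theorem hasDerivAt_circleCurve (c : ℂ) (r t : ℝ) :
    HasDerivAt (circleCurve c r)
      ((2 * Real.pi : ℝ) * deriv (circleMap c r) (2 * Real.pi * t)) t := by
  have h1 := (differentiable_circleMap c r (2 * Real.pi * t)).hasDerivAt
  have h2 : HasDerivAt (fun t : ℝ => 2 * Real.pi * t) (2 * Real.pi) t := by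
    simpa using (hasDerivAt_id t).const_mul (2 * Real.pi)
  exact h1.scomp t h2

theorem isClosedCurve_circleCurve (c : ℂ) (r : ℝ) : IsClosedCurve (circleCurve c r) := by
  refine ⟨?_, ?_, ⟨∅, Set.finite_empty, fun t _ => (hasDerivAt_circleCurve c r t).differentiableAt⟩,
    ?_⟩
  · exact fun t _ => (hasDerivAt_circleCurve c r t).continuousAt.continuousWithinAt
  · simp [circleCurve, circleMap]
  · refine Continuous.intervalIntegrable ?_ 0 1
    rw [funext fun t => (hasDerivAt_circleCurve c r t).deriv]
    simp only [deriv_circleMap]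
    fun_prop

theorem norm_circleCurve_sub (c : ℂ) {r : ℝ} (hr : 0 ≤ r) (t : ℝ) :
    ‖circleCurve c r t - c‖ = r := by
  simp [circleCurve, abs_of_nonneg hr]

theorem integral_circleCurve (c : ℂ) (r : ℝ) (f : ℂ → ℂ) :
    ∫ t in (0 : ℝ)..1, f (circleCurve c r t) * deriv (circleCurve c r) t = ∮ w in C(c, r), f w := by
  have h := intervalIntegral.smul_integral_comp_mul_left (a := 0) (b := 1)
    (fun θ => deriv (circleMap c r) θ • f (circleMap c r θ)) (2 * Real.pi)
  rw [mul_zero, mul_one] at h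
  rw [circleIntegral, ← h, ← intervalIntegral.integral_smul]
  refine intervalIntegral.integral_congr fun t _ => ?_
  simp only [(hasDerivAt_circleCurve c r t).deriv, circleCurve, smul_eq_mul, Complex.real_smul]
  ring

/-- If no two different parameters have the same `k`-th power, small circles around the
parameters form an admissible contour. -/
theorem exists_isContourAround (hk : 1 ≤ k) (hβ : ∀ j ∈ Finset.Icc 1 N, ‖β j‖ < 1)
    (hinj : ∀ i ∈ Finset.Icc 1 N, ∀ j ∈ Finset.Icc 1 N, β i ^ k = β j ^ k → β i = β j) :
    ∃ (m : ℕ) (Γ : Fin m → ℝ → ℂ), IsContourAround N k β Γ := by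
  classical
  set B : Finset ℂ := (Finset.Icc 1 N).image β with hB
  -- the zeros of all the polynomials `w ^ k - (β j) ^ k`
  set R : Finset ℂ := ((poleP N fun j => β j ^ k).comp (X ^ k)).roots.toFinset with hR
  have hne : (poleP N fun j => β j ^ k).comp (X ^ k) ≠ 0 :=
    (poleP_monic.comp (monic_X_pow k) (by simp; omega)).ne_zero
  have hmemR : ∀ j ∈ Finset.Icc 1 N, ∀ c : ℂ, c ^ k = β j ^ k → c ∈ R := by
    intro j hj c hc
    rw [hR, Multiset.mem_toFinset, mem_roots hne, IsRoot, eval_comp, eval_pow, eval_X, poleP_eval,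
      Finset.prod_eq_zero hj]
    exact sub_eq_zero.2 hc
  have hrad : ∀ b : ℂ, ∃ r : ℝ, 0 < r ∧ (b ∈ B →
      Metric.closedBall b r ⊆ Metric.ball 0 1 ∩ ((R.erase b : Finset ℂ) : Set ℂ)ᶜ) := by
    intro b
    by_cases hb : b ∈ B
    · have hopen : IsOpen (Metric.ball (0 : ℂ) 1 ∩ ((R.erase b : Finset ℂ) : Set ℂ)ᶜ) :=
        Metric.isOpen_ball.inter (R.erase b).finite_toSet.isClosed.isOpen_compl
      obtain ⟨j, hj, rfl⟩ := Finset.mem_image.1 hb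
      have hmem : β j ∈ Metric.ball (0 : ℂ) 1 ∩ ((R.erase (β j) : Finset ℂ) : Set ℂ)ᶜ :=
        ⟨mem_ball_zero_iff.2 (hβ j hj), by simp⟩
      obtain ⟨r, hr, hsub⟩ := Metric.nhds_basis_closedBall.mem_iff.1 (hopen.mem_nhds hmem)
      exact ⟨r, hr, fun _ => hsub⟩
    · exact ⟨1, one_pos, fun h => absurd h hb⟩
  choose r hr hsub using hrad
  set b : Fin B.card → ℂ := fun i => (B.equivFin.symm i : ℂ) with hb
  have hbB : ∀ i, b i ∈ B := fun i => (B.equivFin.symm i).2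
  set Γ : Fin B.card → ℝ → ℂ := fun i => circleCurve (b i) (r (b i)) with hΓ
  have hmem : ∀ i t, Γ i t ∈ Metric.ball (0 : ℂ) 1 ∩ ((R.erase (b i) : Finset ℂ) : Set ℂ)ᶜ := by
    intro i t
    refine hsub (b i) (hbB i) (mem_closedBall_iff_norm.2 ?_)
    exact (norm_circleCurve_sub (b i) (hr _).le t).le
  have hint : ∀ c ∈ R, contourIntegral Γ (fun w => (w - c)⁻¹) =
      if c ∈ B then 2 * (Real.pi : ℂ) * Complex.I else 0 := by
    intro c hc
    have h1 : ∀ i, (∫ t in (0 : ℝ)..1, (Γ i t - c)⁻¹ * deriv (Γ i) t) =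
        if b i = c then 2 * (Real.pi : ℂ) * Complex.I else 0 := by
      intro i
      rw [hΓ, integral_circleCurve (b i) (r (b i)) fun w => (w - c)⁻¹]
      split_ifs with hbc
      · rw [hbc]
        exact circleIntegral.integral_sub_center_inv c (hr c).ne'
      · have hnot : ∀ w ∈ Metric.closedBall (b i) (r (b i)), w - c ≠ 0 := by
          intro w hw h0
          refine (hsub (b i) (hbB i) hw).2 ?_
          rw [sub_eq_zero.1 h0]
          exact Finset.mem_coe.2 (Finset.mem_erase.2 ⟨fun e => hbc e.symm, hc⟩)
        refine Complex.circleIntegral_eq_zero_of_differentiable_on_off_countable (hr _).le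
          (s := ∅) Set.countable_empty ?_ fun w hw => ?_
        · exact ContinuousOn.inv₀ (by fun_prop) hnot
        · exact DifferentiableAt.inv (by fun_prop) (hnot w (Metric.ball_subset_closedBall hw.1))
    have h2 : ∑ i, (if b i = c then 2 * (Real.pi : ℂ) * Complex.I else 0) =
        ∑ x ∈ B, if x = c then 2 * (Real.pi : ℂ) * Complex.I else 0 := by
      rw [← Finset.sum_coe_sort B]
      exact Fintype.sum_equiv B.equivFin.symm _ _ fun i => rfl
    simp only [contourIntegral, h1]
    rw [h2, Finset.sum_ite_eq']
  refine ⟨B.card, Γ, ⟨fun i => isClosedCurve_circleCurve _ _,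
    fun i t _ => mem_ball_zero_iff.1 (hmem i t).1, fun i t _ j hj h => ?_, fun j hj => ?_,
    fun j hj c hc hne => ?_⟩⟩
  · refine (hmem i t).2 (Finset.mem_coe.2 (Finset.mem_erase.2 ⟨fun e => ?_, hmemR j hj _ h⟩))
    have := norm_circleCurve_sub (b i) (hr (b i)).le t
    rw [show circleCurve (b i) (r (b i)) t = b i from e, sub_self, norm_zero] at this
    exact (hr (b i)).ne this
  · rw [windingNumber, hint _ (hmemR j hj _ rfl), if_pos (Finset.mem_image_of_mem β hj),
      inv_mul_cancel₀ Complex.two_pi_I_ne_zero]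
  · rw [windingNumber, hint _ (hmemR j hj _ hc), if_neg, mul_zero]
    intro hcB
    obtain ⟨i, hi, rfl⟩ := Finset.mem_image.1 hcB
    exact hne (hinj i hi j hj hc)

end Existence

end NonintersectingWalks

end

theorem mainTheorem2 (N k : ℕ) (hN : 1 ≤ N) (hk : 1 ≤ k) (α β : ℕ → ℂ)
    (hα : ∀ j ∈ Finset.Icc 1 N, ‖α j‖ < 1)
    (hβ : ∀ j ∈ Finset.Icc 1 N, ‖β j‖ < 1)
    (hβ0 : ∀ j ∈ Finset.Icc 1 N, β j ≠ 0)
    (l : Fin N → ℤ) (hl : StrictMono l) (hlN : ∀ j, l j ≤ (N : ℤ) - 1) :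
    -- for nonnegative parameters the conditioned model is a genuine probability model
    ((∀ j ∈ Finset.Icc 1 N, 0 ≤ α j ∧ 0 ≤ β j) →
      0 < NonintersectingWalks.partitionFunction N
        (NonintersectingWalks.equallySpaced N k) l α β) ∧
    -- whenever the model can be normalised
    (NonintersectingWalks.partitionFunction N
        (NonintersectingWalks.equallySpaced N k) l α β ≠ 0 →
      -- admissible contours exist
      (∃ (m : ℕ) (Γ : Fin m → ℝ → ℂ), NonintersectingWalks.IsContourAround N k β Γ) ∧
      ∀ (m : ℕ) (Γ : Fin m → ℝ → ℂ), NonintersectingWalks.IsContourAround N k β Γ →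
        -- the kernel is the double contour integral
        (∀ s₁ x₁ s₂ x₂ : ℕ, s₁ ≤ N → s₂ ≤ N →
          NonintersectingWalks.kernel N (NonintersectingWalks.equallySpaced N k) l α β
              s₁ x₁ s₂ x₂ =
            NonintersectingWalks.doubleIntegralKernel N k α β Γ s₁ x₁ s₂ x₂) ∧
        -- the point process on the lines `s ≤ N` is determinantal with this kernel
        (∀ (n : ℕ) (p : Fin n → ℕ × ℕ), Function.Injective p → (∀ r, (p r).1 ≤ N) →
          NonintersectingWalks.correlation N (NonintersectingWalks.equallySpaced N k) l α β p =
            (Matrix.of fun r q => NonintersectingWalks.doubleIntegralKernel N k α β Γ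
              (p r).1 (p r).2 (p q).1 (p q).2).det) ∧
        -- all `β j` equal
        (∀ b : ℂ, (∀ j ∈ Finset.Icc 1 N, β j = b) →
          ∀ s₁ x₁ s₂ x₂ : ℕ, s₁ ≤ N → s₂ ≤ N →
            NonintersectingWalks.kernel N (NonintersectingWalks.equallySpaced N k) l α β
                s₁ x₁ s₂ x₂ =
              NonintersectingWalks.doubleIntegralKernelConst N k α b Γ s₁ x₁ s₂ x₂)) := by
  have ha : StrictMono (NonintersectingWalks.equallySpaced N k) :=
    NonintersectingWalks.equallySpaced_strictMono hk
  refine ⟨NonintersectingWalks.partitionFunction_pos hk hα hβ hβ0 hl hlN, fun hZ => ?_⟩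
  have hG : (NonintersectingWalks.gram N
      (NonintersectingWalks.equallySpaced N k) l α β).det ≠ 0 := by
    rwa [NonintersectingWalks.partitionFunction_eq_det hα hβ ha hl] at hZ
  refine ⟨NonintersectingWalks.exists_isContourAround hk hβ fun i hi j hj =>
    NonintersectingWalks.eq_of_pow_eq hα hβ hlN hG hi hj, fun m Γ hΓ => ?_⟩
  have hK : ∀ s₁ x₁ s₂ x₂ : ℕ, s₁ ≤ N → s₂ ≤ N →
      NonintersectingWalks.kernel N (NonintersectingWalks.equallySpaced N k) l α β s₁ x₁ s₂ x₂ =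
        NonintersectingWalks.doubleIntegralKernel N k α β Γ s₁ x₁ s₂ x₂ := by
    intro s₁ x₁ s₂ x₂ hs₁ hs₂
    rw [NonintersectingWalks.kernel_eq_sum_dualFunction hk hα hβ hβ0 hlN hG hΓ hs₁ hs₂,
      NonintersectingWalks.doubleIntegralKernel_eq_sum_dualFunction hk hα hΓ hs₁]
  refine ⟨hK, fun n p hp hpN => ?_, fun b hb s₁ x₁ s₂ x₂ hs₁ hs₂ => ?_⟩
  · rw [NonintersectingWalks.correlation_eq_det hα hβ ha hl hG hp hpN]
    simp only [hK _ _ _ _ (hpN _) (hpN _)]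
  · rw [hK _ _ _ _ hs₁ hs₂]
    have hprod : ∀ z : ℂ, ∏ j ∈ Finset.Icc 1 N, (z ^ k - β j ^ k) = (z ^ k - b ^ k) ^ N := by
      intro z
      rw [Finset.prod_congr rfl fun j hj => by rw [hb j hj], Finset.prod_const, Nat.card_Icc,
        Nat.add_sub_cancel]
    simp only [NonintersectingWalks.doubleIntegralKernel,
      NonintersectingWalks.doubleIntegralKernelConst, hprod]
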